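/- **Setting.** Let $\omega_1,\omega_2>0$, $\omega=(\omega_1,\omega_2)$, $\Omega=(0,\omega_1)\times(0,\omega_2)$, $\widetilde\Omega=(-\omega_1,\omega_1)\times(-\omega_2,\omega_2)$, and let $s\in L^2(\widetilde\Omega)$ be normalized by $$\int_0^{\omega_1}s(-t_1,x_2)\,dt_1=0\ \text{ for a.e. } |x_2|<\omega_2,\qquad \int_0^{\omega_2}s(x_1,-t_2)\,dt_2=0\ \text{ for a.e. } |x_1|<\omega_1 .$$ Let $S$ be a bounded operator on $L^2(\Omega)$ with a bounded inverse, of the form $$Sf=\frac{\partial^2}{\partial x_1\partial x_2}\int_\Omega q(x,t)f(t)\,dt,\qquad q(x,t)=s(x-t)-s(x_1-t_1,-t_2)-s(-t_1,x_2-t_2)+s(-t),$$ in the sense that $\int_0^{x_1}\!\int_0^{x_2}(Sf)(u)\,du=\int_\Omega q(x,t)f(t)\,dt$ for all $f\in L^2(\Omega)$ and a.e. $x\in\Omega$. For $\lambda,\mu\in\mathbb C^2$ put $\lambda x=\lambda_1x_1+\lambda_2x_2$ and $$\rho(\lambda,\mu)=\int_\Omega e^{-i\mu x}\big(S^{-1}e^{i\lambda\,\cdot}\big)(x)\,dx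 .$$ Below $i,k\in\{1,2\}$, $i\neq k$, and $L^2_2(0,\ell)=L^2(0,\ell)\oplus L^2(0,\ell)$. Define $$\mathcal A_if=i\int_0^{x_i}f(t)\,dt,\quad (M_{2k}f)(x_i)=\int_0^{\omega_k}f\,dt_k,\quad (M_{3k}f)(x)=f(x_i),\quad K_{3i}f=\int_0^{\omega_k}f(t_k)\,dt_k\cdot\mathbf 1,$$ $$(M_{11}f)(x)=\tfrac{\partial}{\partial x_2}\int_0^{\omega_2}s(x_1,x_2-t_2)f(t_2)\,dt_2,\quad (M_{12}f)(x)=\tfrac{\partial}{\partial x_1}\int_0^{\omega_1}s(x_1-t_1,x_2)f(t_1)\,dt_1,$$ $$(M_{41}f)(x_2)=-\tfrac{\partial}{\partial x_2}\int_\Omega s(-t_1,x_2-t_2)f(t)\,dt,\quad (M_{42}f)(x_1)=-\tfrac{\partial}{\partial x_1}\int_\Omega s(x_1-t_1,-t_2)f(t)\,dt,$$ $$K_{11}f=-\int_0^{\omega_2}s(x_1,-t_2)f(t_2)\,dt_2,\qquad K_{12}f=-\int_0^{\omega_1}s(-t_1,x_2)f(t_1)\,dt_1 ,$$ derivatives in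 one variable being those of absolutely continuous functions. Here $M_{1k},M_{3k}$ act from $L^2(0,\omega_i)$ into $L^2(\Omega)$, $M_{2k},M_{4k}$ from $L^2(\Omega)$ into $L^2(0,\omega_i)$, and $K_{1i},K_{3i}$ from $L^2(0,\omega_k)$ into $L^2(0,\omega_i)$. Put $\Pi_k=[M_{1k}\ \ M_{3k}]$, $\widehat\Pi_k=\begin{bmatrix}M_{2k}\\M_{4k}\end{bmatrix}$, $$g_{ik}=\begin{bmatrix}K_{3i}\\K_{1i}\end{bmatrix}\begin{bmatrix}I&0\end{bmatrix}-\widehat\Pi_kS^{-1}\Pi_i:\ L^2_2(0,\omega_k)\to L^2_2(0,\omega_i),\qquad G(\lambda)=\begin{bmatrix}I-\lambda_1(\mathcal A_1\oplus\mathcal A_1)& i\lambda_2g_{12}\\ i\lambda_1g_{21}&I-\lambda_2(\mathcal A_2\oplus\mathcal A_2)\end{bmatrix},$$ $(U_if)(x_i)=\overline{f(\omega_i-x_i)}$ (componentwise on $L^2_2(0,\omega_i)$) and $J_i=i\begin{bmatrix}0&-I\\I&0\end{bmatrix}$. For $h\in L^2(\Omega)$ put $$\theta_h(\lambda)=1+\lambda_1\lambda_2\int_\Omega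 e^{i\lambda(\omega-x)}h(x)\,dx .$$ We say that $\theta_hG^{-1}\mathrm{col}[0,\mathbf 1,0,\mathbf 1]$ *has no poles or zeros and represents* $\psi$ if $\psi:\mathbb C^2\to L^2_2(0,\omega_1)\oplus L^2_2(0,\omega_2)$ is holomorphic, vanishes at no point, and $\psi(\lambda)=\theta_h(\lambda)G(\lambda)^{-1}\mathrm{col}[0,\mathbf 1,0,\mathbf 1]$ wherever $G(\lambda)$ has a bounded inverse. **Theorem.** 1. Each of the formulas above for $\mathcal A_i,M_{1k},M_{2k},M_{3k},M_{4k},K_{1i},K_{3i}$ defines exactly one bounded operator, and $g_{ki}=-U_kJ_kg_{ik}^*J_iU_i$ for $i\ne k$. 2. There is exactly one $h\in L^2(\Omega)$ for which $\theta_hG^{-1}\mathrm{col}[0,\mathbf 1,0,\mathbf 1]$ has no poles or zeros and represents some function $\psi=\begin{bmatrix}\psi_1\\ \psi_2\end{bmatrix}$, $\psi_i(\lambda)\in L^2_2(0,\omega_i)$. It is $h=S^{-1}y$ with $y(x)=s(x-\omega)$, and $\psi$ is unique. 3. With this $\psi$, for $i\neq k$ and all $\lambda,\mu\in\mathbb C^2$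 with $\mu_k\ne\lambda_k$, $$\rho(\lambda,\mu)=\frac1{\mu_k-\lambda_k}\int_0^{\omega_i}e^{-i\omega\mu}\big(J_iU_i\psi_i(\mu,x_i)\big)^*\psi_i(\lambda,x_i)\,dx_i .$$ 4. One operator $g_{ik}$ determines everything: if $S'$, $s'$ satisfy the same assumptions (with the same $\omega$) and $g_{ik}(S)=g_{ik}(S')$ for one pair $i\neq k$, then $g_{ki}(S)=g_{ki}(S')$, the $\rho$-functions of $S$ and $S'$ coincide, and $S^{-1}=S'^{-1}$. -/

import Mathlib

open MeasureTheory Set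

noncomputable section

namespace RectConv

/-! Coordinates are indexed by `Fin 2`, so the indices 1, 2 of the text are `0`, `1` here.
A pair of indices `i ≠ k` means that `i` is one coordinate and `k` is the other one. -/

/-- The open rectangle `{x : 0 < x i < a i}`. `box ω` is the rectangle `Ω`. -/
def box (a : Fin 2 → ℝ) : Set (Fin 2 → ℝ) := univ.pi fun i => Ioo 0 (a i)

/-- The rectangle `Ω̃ = {x : |x i| < ω i}`. -/
def symBox (ω : Fin 2 → ℝ) : Set (Fin 2 → ℝ) := univ.pi fun i => Ioo (-ω i) (ω i)

/-- The point of the plane with coordinate `a` at the index `i` and coordinate `b` at the other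
index. -/
def pt (i : Fin 2) (a b : ℝ) : Fin 2 → ℝ := fun j => if j = i then a else b

/-- `L²(Ω)`. -/
abbrev L2Rect (ω : Fin 2 → ℝ) := Lp ℂ 2 (volume.restrict (box ω))

/-- `L²(0, ℓ)`. -/
abbrev L2 (l : ℝ) := Lp ℂ 2 (volume.restrict (Ioo (0 : ℝ) l))

/-- The Hilbert space `L²₂(0, ℓ)` of `ℂ²`-valued square integrable functions on `(0, ℓ)`, as the
orthogonal sum of two copies of `L²(0, ℓ)`. -/
abbrev L2Two (l : ℝ) := WithLp 2 (L2 l × L2 l)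

/-- `L²₂(0, ω₁) ⊕ L²₂(0, ω₂)` (only its linear and topological structure is used). -/
abbrev L2Sum (ω : Fin 2 → ℝ) := ∀ i : Fin 2, L2Two (ω i)

/-! ### Convolution operators on the rectangle -/

/-- The kernel `q(x,t) = s(x-t) - s(x₁-t₁,-t₂) - s(-t₁,x₂-t₂) + s(-t)`. -/
def kernel (s : (Fin 2 → ℝ) → ℂ) (x t : Fin 2 → ℝ) : ℂ :=
  s (x - t) - s (pt 0 (x 0 - t 0) (-t 1)) - s (pt 0 (-t 0) (x 1 - t 1)) + s (-t)

/-- `S f = ∂²/∂x₁∂x₂ ∫_Ω q(x,t) f(t) dt`: the function `x ↦ ∫_Ω q(x,t) f(t) dt` is the generating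
function of the absolutely continuous charge with density `S f`, that is, it equals
`∫_{0 < u₁ < x₁, 0 < u₂ < x₂} (S f)(u) du`. -/
def IsConvolution (ω : Fin 2 → ℝ) (s : (Fin 2 → ℝ) → ℂ) (S : L2Rect ω →L[ℂ] L2Rect ω) : Prop :=
  ∀ f : L2Rect ω, ∀ᵐ x ∂volume.restrict (box ω),
    ∫ u in box x, S f u = ∫ t in box ω, kernel s x t * f t

/-- The normalization `∫_0^{ω₁} s(-t₁,x₂) dt₁ = 0` and `∫_0^{ω₂} s(x₁,-t₂) dt₂ = 0`. -/
def IsNormalized (ω : Fin 2 → ℝ) (s : (Fin 2 → ℝ) → ℂ) : Prop :=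
  ∀ i k : Fin 2, i ≠ k → ∀ᵐ y ∂volume.restrict (Ioo (-ω i) (ω i)),
    ∫ t in (0 : ℝ)..ω k, s (pt i y (-t)) = 0

/-! ### The auxiliary operators

Each operator is characterized by its formula, and then chosen to be the bounded operator that is
given by that formula. `OperatorsWellDefined` says that there is exactly one such operator in each
case. A derivative in one variable is understood in the sense of absolutely continuous
functions: `∂F = w` means `F(y) - F(0) = ∫_0^y w`. -/

/-- `(𝒜 f)(x) = i ∫_0^x f(t) dt` on `L²(0, ℓ)`. -/
def IsA (l : ℝ) (T : L2 l →L[ℂ] L2 l) : Prop :=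
  ∀ f : L2 l, T f =ᵐ[volume.restrict (Ioo (0 : ℝ) l)] fun x => Complex.I * ∫ t in (0 : ℝ)..x, f t

/-- `M_{1k}`, `i ≠ k`: for `k = 1` it is `(M₁₁ f)(x) = ∂/∂x₂ ∫_0^{ω₂} s(x₁, x₂-t₂) f(t₂) dt₂`. -/
def IsM1 (ω : Fin 2 → ℝ) (s : (Fin 2 → ℝ) → ℂ) (k i : Fin 2)
    (T : L2 (ω i) →L[ℂ] L2Rect ω) : Prop :=
  ∀ f : L2 (ω i), ∀ᵐ x ∂volume.restrict (box ω),
    ∫ u in (0 : ℝ)..x i, T f (pt i u (x k)) =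
      (∫ t in (0 : ℝ)..ω i, s (pt i (x i - t) (x k)) * f t) -
        ∫ t in (0 : ℝ)..ω i, s (pt i (0 - t) (x k)) * f t

/-- `M_{2k}`, `i ≠ k`: for `k = 1` it is `(M₂₁ f)(x₂) = ∫_0^{ω₁} f(t₁, x₂) dt₁`. -/
def IsM2 (ω : Fin 2 → ℝ) (k i : Fin 2) (T : L2Rect ω →L[ℂ] L2 (ω i)) : Prop :=
  ∀ f : L2Rect ω, T f =ᵐ[volume.restrict (Ioo (0 : ℝ) (ω i))]
    fun y => ∫ t in (0 : ℝ)..ω k, f (pt i y t)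

/-- `M_{3k}`, `i ≠ k`: `(M_{3k} f)(x) = f(x_i)`. -/
def IsM3 (ω : Fin 2 → ℝ) (i : Fin 2) (T : L2 (ω i) →L[ℂ] L2Rect ω) : Prop :=
  ∀ f : L2 (ω i), T f =ᵐ[volume.restrict (box ω)] fun x => f (x i)

/-- `M_{4k}`, `i ≠ k`: for `k = 1` it is
`(M₄₁ f)(x₂) = - ∂/∂x₂ ∫_Ω s(-t₁, x₂-t₂) f(t) dt`. -/
def IsM4 (ω : Fin 2 → ℝ) (s : (Fin 2 → ℝ) → ℂ) (k i : Fin 2)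
    (T : L2Rect ω →L[ℂ] L2 (ω i)) : Prop :=
  ∀ f : L2Rect ω, ∀ᵐ y ∂volume.restrict (Ioo (0 : ℝ) (ω i)),
    ∫ u in (0 : ℝ)..y, T f u =
      -((∫ t in box ω, s (pt i (y - t i) (-t k)) * f t) -
        ∫ t in box ω, s (pt i (0 - t i) (-t k)) * f t)

/-- `K_{1i}`, `i ≠ k`: for `i = 1` it is `(K₁₁ f)(x₁) = - ∫_0^{ω₂} s(x₁, -t₂) f(t₂) dt₂`. -/
def IsK1 (ω : Fin 2 → ℝ) (s : (Fin 2 → ℝ) → ℂ) (i k : Fin 2)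
    (T : L2 (ω k) →L[ℂ] L2 (ω i)) : Prop :=
  ∀ f : L2 (ω k), T f =ᵐ[volume.restrict (Ioo (0 : ℝ) (ω i))]
    fun y => -∫ t in (0 : ℝ)..ω k, s (pt i y (-t)) * f t

/-- `K_{3i}`, `i ≠ k`: `K_{3i} f` is the constant function `∫_0^{ω_k} f(t) dt`. -/
def IsK3 (ω : Fin 2 → ℝ) (i k : Fin 2) (T : L2 (ω k) →L[ℂ] L2 (ω i)) : Prop :=
  ∀ f : L2 (ω k), T f =ᵐ[volume.restrict (Ioo (0 : ℝ) (ω i))]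
    fun _ => ∫ t in (0 : ℝ)..ω k, f t

def opA (l : ℝ) : L2 l →L[ℂ] L2 l := Classical.epsilon (IsA l)

def M1 (ω : Fin 2 → ℝ) (s : (Fin 2 → ℝ) → ℂ) (k i : Fin 2) : L2 (ω i) →L[ℂ] L2Rect ω :=
  Classical.epsilon (IsM1 ω s k i)

def M2 (ω : Fin 2 → ℝ) (k i : Fin 2) : L2Rect ω →L[ℂ] L2 (ω i) :=
  Classical.epsilon (IsM2 ω k i)

def M3 (ω : Fin 2 → ℝ) (i : Fin 2) : L2 (ω i) →L[ℂ] L2Rect ω :=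
  Classical.epsilon (IsM3 ω i)

def M4 (ω : Fin 2 → ℝ) (s : (Fin 2 → ℝ) → ℂ) (k i : Fin 2) : L2Rect ω →L[ℂ] L2 (ω i) :=
  Classical.epsilon (IsM4 ω s k i)

def K1 (ω : Fin 2 → ℝ) (s : (Fin 2 → ℝ) → ℂ) (i k : Fin 2) : L2 (ω k) →L[ℂ] L2 (ω i) :=
  Classical.epsilon (IsK1 ω s i k)

def K3 (ω : Fin 2 → ℝ) (i k : Fin 2) : L2 (ω k) →L[ℂ] L2 (ω i) :=
  Classical.epsilon (IsK3 ω i k)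

/-- Each of the formulas above defines one and only one bounded operator. -/
def OperatorsWellDefined (ω : Fin 2 → ℝ) (s : (Fin 2 → ℝ) → ℂ) : Prop :=
  (∀ i, ∃! T, IsA (ω i) T) ∧
  ∀ i k : Fin 2, i ≠ k →
    (∃! T, IsM1 ω s k i T) ∧ (∃! T, IsM2 ω k i T) ∧ (∃! T, IsM3 ω i T) ∧ (∃! T, IsM4 ω s k i T) ∧
    (∃! T, IsK1 ω s i k T) ∧ (∃! T, IsK3 ω i k T)

/-! ### The operators `g_{ik}` and `G(λ)` -/

/-- The block column `[P; Q]`. -/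
def col {l : ℝ} {E : Type*} [NormedAddCommGroup E] [NormedSpace ℂ E] (P Q : E →L[ℂ] L2 l) :
    E →L[ℂ] L2Two l :=
  (WithLp.prodContinuousLinearEquiv 2 ℂ (L2 l) (L2 l)).symm.toContinuousLinearMap ∘L (P.prod Q)

/-- The projection `[I 0]`. -/
def pr1 (l : ℝ) : L2Two l →L[ℂ] L2 l := WithLp.fstL 2 ℂ (L2 l) (L2 l)

/-- The projection `[0 I]`. -/
def pr2 (l : ℝ) : L2Two l →L[ℂ] L2 l := WithLp.sndL 2 ℂ (L2 l) (L2 l)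

/-- `Π_k = [M_{1k}  M_{3k}]`, acting from `L²₂(0, ω_i)` into `L²(Ω)`, `i ≠ k`. -/
def PiOp (ω : Fin 2 → ℝ) (s : (Fin 2 → ℝ) → ℂ) (k i : Fin 2) : L2Two (ω i) →L[ℂ] L2Rect ω :=
  M1 ω s k i ∘L pr1 (ω i) + M3 ω i ∘L pr2 (ω i)

/-- `Π̂_k = [M_{2k}; M_{4k}]`, acting from `L²(Ω)` into `L²₂(0, ω_i)`, `i ≠ k`. -/
def PiHat (ω : Fin 2 → ℝ) (s : (Fin 2 → ℝ) → ℂ) (k i : Fin 2) : L2Rect ω →L[ℂ] L2Two (ω i) :=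
  col (M2 ω k i) (M4 ω s k i)

/-- `g_{ik} = [K_{3i}; K_{1i}] [I  0] - Π̂_k S⁻¹ Π_i`, acting from `L²₂(0, ω_k)` into
`L²₂(0, ω_i)`, `i ≠ k`. -/
def g (ω : Fin 2 → ℝ) (s : (Fin 2 → ℝ) → ℂ) (S : L2Rect ω ≃L[ℂ] L2Rect ω) (i k : Fin 2) :
    L2Two (ω k) →L[ℂ] L2Two (ω i) :=
  col (K3 ω i k) (K1 ω s i k) ∘L pr1 (ω k) -
    PiHat ω s k i ∘L (S.symm : L2Rect ω →L[ℂ] L2Rect ω) ∘L PiOp ω s i k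

/-- The diagonal block `diag(I - z 𝒜, I - z 𝒜)`. -/
def diagBlock (l : ℝ) (z : ℂ) : L2Two l →L[ℂ] L2Two l :=
  ContinuousLinearMap.id ℂ _ - z • col (opA l ∘L pr1 l) (opA l ∘L pr2 l)

/-- `G(λ)`: its diagonal blocks are `diag(I - λ_i 𝒜_i, I - λ_i 𝒜_i)`, its off-diagonal blocks are
`i λ₂ g₁₂` in the first row and `i λ₁ g₂₁` in the second row. (`1 - i` is the index other
than `i`.) -/
def G (ω : Fin 2 → ℝ) (s : (Fin 2 → ℝ) → ℂ) (S : L2Rect ω ≃L[ℂ] L2Rect ω) (lam : Fin 2 → ℂ) :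
    L2Sum ω →L[ℂ] L2Sum ω :=
  ContinuousLinearMap.pi fun i =>
    diagBlock (ω i) (lam i) ∘L ContinuousLinearMap.proj i +
      (Complex.I * lam (1 - i)) • (g ω s S i (1 - i) ∘L ContinuousLinearMap.proj (1 - i))

/-- `col [0 1 0 1]`. -/
def col0101 (ω : Fin 2 → ℝ) : L2Sum ω :=
  fun _ => WithLp.toLp 2 (0, Lp.const 2 _ (1 : ℂ))

/-! ### The maps `U` and `J` -/

theorem memLp_reflect {l : ℝ} (f : L2 l) :
    MemLp (fun x => (starRingEnd ℂ) (f (l - x))) 2 (volume.restrict (Ioo (0 : ℝ) l)) := by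
  have h : MeasurePreserving (fun x : ℝ => l - x) (volume.restrict (Ioo (0 : ℝ) l))
      (volume.restrict (Ioo (0 : ℝ) l)) := by
    have h0 := (Measure.measurePreserving_sub_left (volume : Measure ℝ) l).restrict_preimage
      (measurableSet_Ioo (a := (0 : ℝ)) (b := l))
    have h1 : (fun x : ℝ => l - x) ⁻¹' Ioo 0 l = Ioo 0 l := by
      ext x
      simp only [mem_preimage, mem_Ioo]
      constructor <;> rintro ⟨h1, h2⟩ <;> constructor <;> linarith
    rwa [h1] at h0
  exact ((Lp.memLp f).comp_measurePreserving h).star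

/-- `(U f)(x) = conj (f (ℓ - x))` on `L²(0, ℓ)`. -/
def U {l : ℝ} (f : L2 l) : L2 l := (memLp_reflect f).toLp _

/-- `U` on `L²₂(0, ℓ)`, acting componentwise. -/
def U2 {l : ℝ} (f : L2Two l) : L2Two l := WithLp.toLp 2 (U f.fst, U f.snd)

/-- `J = i [0 -I; I 0]` on `L²₂(0, ℓ)`. -/
def J {l : ℝ} (f : L2Two l) : L2Two l :=
  WithLp.toLp 2 (-(Complex.I • f.snd), Complex.I • f.fst)

/-! ### The `ρ`-function -/

/-- `λ x = λ₁ x₁ + λ₂ x₂`. -/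
def dot (lam : Fin 2 → ℂ) (x : Fin 2 → ℝ) : ℂ := ∑ j, lam j * (x j : ℂ)

theorem memLp_exp (ω : Fin 2 → ℝ) (lam : Fin 2 → ℂ) :
    MemLp (fun x : Fin 2 → ℝ => Complex.exp (Complex.I * dot lam x)) 2
      (volume.restrict (box ω)) := by
  have hc : Continuous (fun x : Fin 2 → ℝ => Complex.exp (Complex.I * dot lam x)) := by
    unfold dot
    fun_prop
  have hsub : box ω ⊆ Icc 0 ω := fun x hx =>
    ⟨fun i => (hx i (mem_univ i)).1.le, fun i => (hx i (mem_univ i)).2.le⟩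
  obtain ⟨C, hC⟩ := (isCompact_Icc (a := (0 : Fin 2 → ℝ)) (b := ω)).exists_bound_of_continuousOn
    hc.continuousOn
  have : IsFiniteMeasure (volume.restrict (Icc (0 : Fin 2 → ℝ) ω)) :=
    ⟨by simpa using (isCompact_Icc (a := (0 : Fin 2 → ℝ)) (b := ω)).measure_lt_top⟩
  have h : MemLp (fun x : Fin 2 → ℝ => Complex.exp (Complex.I * dot lam x)) 2
      (volume.restrict (Icc 0 ω)) :=
    MemLp.of_bound hc.aestronglyMeasurable C
      ((ae_restrict_iff' measurableSet_Icc).2 (Filter.Eventually.of_forall hC))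
  exact h.mono_measure (Measure.restrict_mono hsub le_rfl)

/-- The function `e^{iλx}` as an element of `L²(Ω)`. -/
def expFun (ω : Fin 2 → ℝ) (lam : Fin 2 → ℂ) : L2Rect ω := (memLp_exp ω lam).toLp _

/-- `ρ(λ,μ) = ∫_Ω e^{-iμx} (S⁻¹ e^{iλx})(x) dx`. -/
def rho (ω : Fin 2 → ℝ) (S : L2Rect ω ≃L[ℂ] L2Rect ω) (lam mu : Fin 2 → ℂ) : ℂ :=
  ∫ x in box ω, Complex.exp (-Complex.I * dot mu x) * S.symm (expFun ω lam) x

/-- `θ(λ) = 1 + λ₁ λ₂ ∫_Ω e^{iλ(ω-x)} h(x) dx`. -/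
def theta (ω : Fin 2 → ℝ) (h : L2Rect ω) (lam : Fin 2 → ℂ) : ℂ :=
  1 + lam 0 * lam 1 * ∫ x in box ω, Complex.exp (Complex.I * dot lam (ω - x)) * h x

/-- The expression `θ(λ) G(λ)⁻¹ col [0 1 0 1]` has no poles and no zeros, and `ψ` is the function
that it represents: `ψ` is holomorphic on all of `ℂ²`, vanishes nowhere, and equals this expression
wherever `G(λ)` is boundedly invertible. -/
def RepresentsWithoutPolesOrZeros (ω : Fin 2 → ℝ) (s : (Fin 2 → ℝ) → ℂ)
    (S : L2Rect ω ≃L[ℂ] L2Rect ω) (θ : (Fin 2 → ℂ) → ℂ) (ψ : (Fin 2 → ℂ) → L2Sum ω) : Prop :=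
  Differentiable ℂ ψ ∧ (∀ lam, ψ lam ≠ 0) ∧
    ∀ lam, IsUnit (G ω s S lam) → ψ lam = θ lam • Ring.inverse (G ω s S lam) (col0101 ω)

/-- `∫_0^ℓ v(x)^* w(x) c dx` for `ℂ²`-valued functions `v`, `w` and a scalar `c`. -/
def pairing {l : ℝ} (c : ℂ) (v w : L2Two l) : ℂ :=
  ∫ x in (0 : ℝ)..l,
    c * ((starRingEnd ℂ) (v.fst x) * w.fst x + (starRingEnd ℂ) (v.snd x) * w.snd x)

end RectConv

end

open MeasureTheory RectConv

noncomputable section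

namespace RectConv

open Set
open scoped InnerProductSpace

/-! ### Quotients of entire functions of exponential type -/

section Entire

open Complex Metric Filter Topology Real

/-! Write `e_λ` for the function `e^{iλx}`, `y(x) = s(x - ω)`, and let `𝒜_k` also denote `i` times
integration in `x_k` on `L²(Ω)`. The structural fact is that the commutator `X_k = -i(𝒜_k S - S
𝒜_k^*)` factors through functions of one variable, `X_k = M_{1k} M_{2k} + M_{3k} M_{4k}`
(`commOp_eq`). It is verified on indicator functions of rectangles with a corner at 0. There `S` is
a mixed second difference of the double primitive of `s` (`inner_chi_convolution`), `𝒜_k` integrates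
over a coordinate of the corner, and a telescoping identity in one variable collapses the two terms
of the commutator (`integral_dd_add_integral_dd`). The same identity intertwines `M_{2k}` and
`M_{4k}` with `𝒜_i` (`opA_M2`, `opA_M4`); for `M_{4k}` a rank one term containing `y` is left over.

The second ingredient is the symmetric bilinear form `∫ F(ω - x) G(x) dx`. With respect to it `S`
and `S⁻¹` are their own transposes, `M_{3k}` and `M_{2k}` are transposes of each other, and `M_{1k}`
has the transpose `M_{2k} S - M_{4k}`. Hence the blocks of `g_{ki}` are, up to sign, transposes of
blocks of `g_{ik}`, which is the relation of part 1 (`g_relation`).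

The function `ψ` is explicit: `ψ_i = (iλ_k M_{2k} S⁻¹e_λ, e^{iλ_i x_i} + iλ_k M_{4k} S⁻¹e_λ)`. The
operator identities give `G ψ = θ col[0,1,0,1]`, where the rank one term produces `θ = θ_h` with `h
= S⁻¹y` (`G_psi`). Evaluating `X_k` between `S⁻¹e_μ` and `S⁻¹e_λ` in the bilinear form in two ways
expresses `ρ` by `ψ` (`mul_form_expFun`). The same formula shows that `ψ` has no zeros: if `ψ(λ) =
0`, then `S⁻¹e_λ` annihilates a total family of exponentials.

For uniqueness, `G(0) = I`, so two representations satisfy `θ'ψ = θψ'` near 0 on each complex line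
through 0, hence on the whole line. As `ψ` and `ψ'` vanish nowhere, `θ` and `θ'` have the same zeros
on the line. There both are of exponential type and equal `1 + O(z²)` at 0. Their zero free quotient
is the exponential of a polynomial of degree at most one (`deriv_log_const_of_exponential_type`),
hence 1. So `θ` determines `h`, and then `ψ` is determined.

Part 4 follows: `g_{ik}` determines `g_{ki}`, these determine `G`, then `ψ` by uniqueness, and then
`ρ` and `S⁻¹`, because exponentials are total. -/

theorem circleIntegrable_log_norm_of_differentiable {f : ℂ → ℂ} (hf : Differentiable ℂ f) (R : ℝ) :
    CircleIntegrable (fun z => Real.log ‖f z‖) 0 R :=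
  MeromorphicOn.circleIntegrable_log_norm fun z _ => (hf.analyticAt z).meromorphicAt

/-- Jensen's inequality for the absolute value of `log |f|`. -/
theorem circleAverage_abs_log_norm_le {f : ℂ → ℂ} (hf : Differentiable ℂ f) (h0 : f 0 = 1)
    {B R : ℝ} (hR : 0 < R) (hB : 0 ≤ B) (hb : ∀ z, ‖z‖ = R → Real.log ‖f z‖ ≤ B) :
    circleAverage (fun z => |Real.log ‖f z‖|) 0 R ≤ 2 * B := by
  have hi := circleIntegrable_log_norm_of_differentiable hf R
  -- By Jensen's formula the mean is `log |f 0| = 0` plus the sum of `log (R / |u|)` over the zeros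
  -- `u` in the disc.
  have hJ : 0 ≤ circleAverage (fun z => Real.log ‖f z‖) 0 R := by
    rw [AnalyticOnNhd.circleAverage_log_norm hR.ne' (fun z _ => hf.analyticAt z) (by simp [h0])]
    simp only [h0, norm_one, Real.log_one, add_zero]
    refine finsum_nonneg fun u => ?_
    by_cases hu : u ∈ closedBall (0 : ℂ) |R|
    · have hd : 0 ≤ MeromorphicOn.divisor f (closedBall 0 |R|) u :=
        MeromorphicOn.AnalyticOnNhd.divisor_nonneg (fun z _ => hf.analyticAt z) u
      refine mul_nonneg (by exact_mod_cast hd) ?_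
      rw [zero_sub, norm_neg]
      by_cases hu0 : u = 0
      · simp [hu0]
      · have hu' : ‖u‖ ≤ R := by simpa [abs_of_pos hR] using hu
        refine Real.log_nonneg ?_
        rw [← div_eq_mul_inv, one_le_div (norm_pos_iff.2 hu0)]
        exact hu'
    · simp [hu]
  -- `|t| + t` is twice the positive part of `t`, hence at most `2B` because `B ≥ 0`.
  have h1 : circleAverage (fun z => |Real.log ‖f z‖| + Real.log ‖f z‖) 0 R ≤ 2 * B := by
    refine circleAverage_mono_on_of_le_circle (hi.abs.add hi) fun z hz => ?_
    have := hb z (by simpa [abs_of_pos hR] using hz)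
    rcases abs_cases (Real.log ‖f z‖) with h | h <;> linarith
  have hia : CircleIntegrable (fun z => |Real.log ‖f z‖|) 0 R := hi.abs
  rw [circleAverage_fun_add hia hi] at h1
  linarith

/-- Harnack's bounds: the kernel lies between `(R - |w|)/(R + |w|)` and `(R + |w|)/(R - |w|)`, and
the latter is at most 3 when `|w| ≤ R/2`. -/
theorem poissonKernel_le_three {R : ℝ} (hR : 0 < R) {w z : ℂ} (hz : z ∈ sphere (0 : ℂ) |R|)
    (hw : ‖w‖ ≤ R / 2) : 0 ≤ poissonKernel 0 w z ∧ poissonKernel 0 w z ≤ 3 := by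
  rw [abs_of_pos hR] at hz
  have hwb : w ∈ ball (0 : ℂ) R := by simp; linarith
  have h1 := re_herglotzRieszKernel_le hz hwb
  have h2 := le_re_herglotzRieszKernel hz hwb
  rw [poissonKernel_eq_re_herglotzRieszKernel, Function.comp_apply, herglotzRieszKernel_def]
  have hn := norm_nonneg w
  simp only [sub_zero] at h1 h2 ⊢
  constructor
  · refine le_trans ?_ h2
    apply div_nonneg <;> linarith
  · refine h1.trans ?_
    rw [div_le_iff₀ (by linarith)]
    linarith

/-- If a zero free entire function is the quotient of two entire functions of exponential type,
then it is the exponential of a polynomial of degree one. -/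
theorem deriv_log_const_of_exponential_type {f g P : ℂ → ℂ} (hf : Differentiable ℂ f)
    (hg : Differentiable ℂ g) (hP : Differentiable ℂ P) (hf0 : f 0 = 1) (hg0 : g 0 = 1)
    {B : ℝ} (hB : 0 ≤ B) (hfB : ∀ z, Real.log ‖f z‖ ≤ B * (1 + ‖z‖))
    (hgB : ∀ z, Real.log ‖g z‖ ≤ B * (1 + ‖z‖)) (hfg : ∀ z, f z = g z * exp (P z)) (w : ℂ) :
    deriv P w = deriv P 0 := by
  -- `Re P = log |f| - log |g|` off the zeros of `g`, which do not affect circle averages. The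
  -- Poisson formula with kernel at most 3 and two means of size `2B(1 + R)` give the constant 12.
  have hre : ∀ R : ℝ, 0 < R → ∀ w : ℂ, ‖w‖ ≤ R / 2 → (P w).re ≤ 12 * B * (1 + R) := by
    intro R hR w hw
    have hwb : w ∈ ball (0 : ℂ) R := by simp; linarith
    have hharm : InnerProductSpace.HarmonicOnNhd (fun z => (P z).re) (closedBall 0 R) :=
      fun z _ => (hP.analyticAt z).harmonicAt_re
    have hpois := hharm.circleAverage_poissonKernel_smul hwb
    have hcod : (poissonKernel 0 w • fun z => (P z).re) =ᶠ[codiscreteWithin (sphere 0 |R|)]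
        poissonKernel 0 w • fun z => Real.log ‖f z‖ - Real.log ‖g z‖ := by
      have h1 : g ⁻¹' {0}ᶜ ∈ codiscrete ℂ :=
        AnalyticOnNhd.preimage_zero_mem_codiscrete (x := 0) (fun z _ => hg.analyticAt z)
          (by simp [hg0])
      filter_upwards [codiscreteWithin_mono (subset_univ (sphere (0 : ℂ) |R|)) h1] with z hz
      have hz : g z ≠ 0 := hz
      simp only [Pi.smul_apply', hfg z, norm_mul, norm_exp, smul_eq_mul]
      rw [Real.log_mul (by simpa using hz) (Real.exp_ne_zero _), Real.log_exp]
      ring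
    rw [circleAverage_congr_codiscreteWithin hcod hR.ne'] at hpois
    have hfi := circleIntegrable_log_norm_of_differentiable hf R
    have hgi := circleIntegrable_log_norm_of_differentiable hg R
    have hint1 : CircleIntegrable (poissonKernel 0 w • fun z => (P z).re) 0 R := by
      refine ContinuousOn.circleIntegrable hR.le ?_
      refine ContinuousOn.smul ?_ (Complex.continuous_re.comp hP.continuous).continuousOn
      rw [poissonKernel_eq_re_herglotzRieszKernel]
      have := continuousOn_herglotzRieszKernel_sphere hwb
      rw [abs_of_pos hR] at this
      exact Complex.continuous_re.comp_continuousOn this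
    have hint := hint1.congr_codiscreteWithin hcod
    have hb1 := circleAverage_abs_log_norm_le hf hf0 hR (B := B * (1 + R)) (by positivity)
      (fun z hz => hz ▸ hfB z)
    have hb2 := circleAverage_abs_log_norm_le hg hg0 hR (B := B * (1 + R)) (by positivity)
      (fun z hz => hz ▸ hgB z)
    have hmono : circleAverage (poissonKernel 0 w • fun z => Real.log ‖f z‖ - Real.log ‖g z‖) 0 R
        ≤ circleAverage (fun z => (3 : ℝ) • (|Real.log ‖f z‖| + |Real.log ‖g z‖|)) 0 R := by
      refine circleAverage_mono hint ((hfi.abs.add hgi.abs).const_smul) fun z hz => ?_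
      obtain ⟨k0, k3⟩ := poissonKernel_le_three hR hz hw
      simp only [Pi.smul_apply', smul_eq_mul]
      calc poissonKernel 0 w z * (Real.log ‖f z‖ - Real.log ‖g z‖)
          ≤ poissonKernel 0 w z * (|Real.log ‖f z‖| + |Real.log ‖g z‖|) := by
            gcongr
            linarith [le_abs_self (Real.log ‖f z‖), neg_abs_le (Real.log ‖g z‖)]
        _ ≤ 3 * (|Real.log ‖f z‖| + |Real.log ‖g z‖|) := by gcongr
    have hfa : CircleIntegrable (fun z => |Real.log ‖f z‖|) 0 R := hfi.abs
    have hga : CircleIntegrable (fun z => |Real.log ‖g z‖|) 0 R := hgi.abs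
    rw [circleAverage_fun_smul, hpois,
      circleAverage_fun_add hfa hga, smul_eq_mul] at hmono
    linarith
  -- Borel–Carathéodory on the disc of radius `R/2`, evaluated at `|z| ≤ R/4`, so that its two
  -- quotients are at most 2 and 3. The `+ 1` keeps the bound for `Re P` positive when `B = 0`.
  have hlin : ∀ R : ℝ, 0 < R → ∀ z : ℂ, ‖z‖ ≤ R / 4 →
      ‖P z‖ ≤ 2 * (12 * B * (1 + R) + 1) + 3 * ‖P 0‖ := by
    intro R hR z hz
    have hbc := borelCaratheodory (f := P) (M := 12 * B * (1 + R) + 1) (R := R / 2) (z := z)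
      (by positivity) hP.differentiableOn
      (fun w hw => by
        have := hre R hR w (by simpa using (mem_ball_zero_iff.1 hw).le)
        simp only [Set.mem_ofPred_eq]; linarith) (by linarith)
      (by simp; linarith)
    refine hbc.trans (add_le_add ?_ ?_)
    · have hn := norm_nonneg z
      have hM : 0 ≤ 12 * B * (1 + R) + 1 := by positivity
      rw [div_le_iff₀ (by linarith)]
      nlinarith [mul_le_mul_of_nonneg_left (show ‖z‖ ≤ R / 2 - ‖z‖ by linarith) hM]
    · have hn := norm_nonneg z
      rw [div_le_iff₀ (by linarith)]
      nlinarith [mul_le_mul_of_nonneg_left (show R / 2 + ‖z‖ ≤ 3 * (R / 2 - ‖z‖) by linarith)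
        (norm_nonneg (P 0))]
  -- Cauchy's estimate on the circle of radius `1 + |w|` about `w`, whose points have modulus at
  -- most `2(1 + |w|)`; hence `R = 8(1 + |w|)`. Linear growth of `P` divided by this radius bounds
  -- `P'`, and Liouville's theorem finishes the proof.
  have hbd : ∀ w, ‖deriv P w‖ ≤ 2 * (12 * B * 9 + 1) + 3 * ‖P 0‖ := by
    intro w
    have hn := norm_nonneg w
    have h := norm_deriv_le_of_forall_mem_sphere_norm_le (c := w) (R := 1 + ‖w‖)
      (C := 2 * (12 * B * (1 + (8 * (1 + ‖w‖))) + 1) + 3 * ‖P 0‖) (f := P) (by linarith)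
      hP.diffContOnCl (fun z hz => hlin (8 * (1 + ‖w‖)) (by linarith) z (by
        have : ‖z - w‖ = 1 + ‖w‖ := by simpa [dist_eq_norm] using hz
        have := norm_le_norm_add_norm_sub' z w
        linarith))
    refine h.trans ?_
    rw [div_le_iff₀ (by linarith)]
    have h0 := norm_nonneg (P 0)
    nlinarith [mul_nonneg hB hn, mul_nonneg hn h0]
  have hd : Differentiable ℂ (deriv P) := fun z => ((hP.analyticAt z).deriv).differentiableAt
  refine hd.apply_eq_apply_of_bounded ?_ w 0
  exact isBounded_iff_forall_norm_le.2 ⟨_, by rintro _ ⟨w, rfl⟩; exact hbd w⟩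

/-- `P` is the primitive of `u'/u` that vanishes at 0; then `u e^{-P}` has zero derivative. -/
theorem exists_entire_log {u : ℂ → ℂ} (hu : Differentiable ℂ u) (hne : ∀ z, u z ≠ 0) :
    ∃ P : ℂ → ℂ, Differentiable ℂ P ∧ ∀ z, u z = u 0 * exp (P z) := by
  have hd : Differentiable ℂ (deriv u) := fun z => ((hu.analyticAt z).deriv).differentiableAt
  obtain ⟨P, hP0, hP⟩ := ((hd.div hu hne).isExactOn_univ).with_val_at 0 0
  refine ⟨P, fun z => (hP z trivial).differentiableAt, fun z => ?_⟩
  have hv : Differentiable ℂ fun z => u z * exp (-P z) := fun z =>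
    (hu z).mul ((hP z trivial).differentiableAt.neg.cexp)
  have h0 : ∀ z, deriv (fun z => u z * exp (-P z)) z = 0 := fun z => by
    have := (hu z).hasDerivAt.mul ((hP z trivial).neg.cexp)
    refine (this.deriv).trans ?_
    have := hne z
    simp only [Pi.div_apply]
    field_simp
    ring
  have hc := is_const_of_deriv_eq_zero hv h0 z 0
  simp only [hP0, neg_zero, Complex.exp_zero, mul_one] at hc
  rw [← hc, mul_assoc, ← Complex.exp_add]
  simp

/-- Two entire functions with the same zeros (expressed by means of two zero free vector
functions) have a zero free entire quotient. -/
theorem exists_zero_free_quotient {E : Type*} [NormedAddCommGroup E] [NormedSpace ℂ E]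
    [CompleteSpace E]
    {f g : ℂ → ℂ} {φ ψ : ℂ → E} (hf : Differentiable ℂ f) (hg : Differentiable ℂ g)
    (hφ : Differentiable ℂ φ) (hψ : Differentiable ℂ ψ) (hφ0 : ∀ z, φ z ≠ 0) (hψ0 : ∀ z, ψ z ≠ 0)
    (hg0 : g 0 ≠ 0) (h : ∀ z, f z • φ z = g z • ψ z) :
    ∃ u : ℂ → ℂ, Differentiable ℂ u ∧ (∀ z, u z ≠ 0) ∧ ∀ z, f z = g z * u z := by
  have hfm : ∀ z, MeromorphicAt f z := fun z => (hf.analyticAt z).meromorphicAt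
  have hgm : ∀ z, MeromorphicAt g z := fun z => (hg.analyticAt z).meromorphicAt
  have hvec : ∀ (χ : ℂ → E), Differentiable ℂ χ → (∀ z, χ z ≠ 0) → ∀ z,
      meromorphicOrderAt χ z = 0 := fun χ hχ h0 z => by
    rw [(hχ.analyticAt z).meromorphicOrderAt_eq,
      (hχ.analyticAt z).analyticOrderAt_eq_zero.2 (h0 z)]
    rfl
  -- Vector functions without zeros have order 0 everywhere, so they do not contribute to the order
  -- of the products `f • φ = g • ψ`.
  have hord : ∀ z, meromorphicOrderAt f z = meromorphicOrderAt g z := fun z => by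
    have h1 := meromorphicOrderAt_smul (hfm z) (hφ.analyticAt z).meromorphicAt
    have h2 := meromorphicOrderAt_smul (hgm z) (hψ.analyticAt z).meromorphicAt
    rw [hvec φ hφ hφ0 z, add_zero] at h1
    rw [hvec ψ hψ hψ0 z, add_zero] at h2
    rw [← h1, ← h2]
    exact congrArg (meromorphicOrderAt · z) (funext h)
  have htop : ∀ z, meromorphicOrderAt g z ≠ ⊤ := fun z => by
    have h0 : meromorphicOrderAt g 0 ≠ ⊤ := by
      rw [(hg.analyticAt 0).meromorphicOrderAt_eq,
        (hg.analyticAt 0).analyticOrderAt_eq_zero.2 hg0]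
      simp
    have hU : MeromorphicOn g univ := fun z _ => hgm z
    exact hU.meromorphicOrderAt_ne_top_of_isPreconnected isPreconnected_univ
      (mem_univ 0) (mem_univ z) h0
  have hq : MeromorphicOn (f / g) univ := fun z _ => (hfm z).div (hgm z)
  have hq0 : ∀ z, meromorphicOrderAt (f / g) z = 0 := fun z => by
    rw [meromorphicOrderAt_div (hfm z) (hgm z), hord z]
    lift meromorphicOrderAt g z to ℤ using htop z with n
    norm_cast
    simp
  -- The normal form fills in the removable singularities of `f / g`. Having order 0 everywhere, it
  -- is analytic and zero free.
  set u := toMeromorphicNFOn (f / g) univ with hu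
  have hun : ∀ z, MeromorphicNFAt u z := fun z => meromorphicNFOn_toMeromorphicNFOn _ _ (mem_univ z)
  have hu0 : ∀ z, meromorphicOrderAt u z = 0 := fun z => by
    rw [hu, meromorphicOrderAt_toMeromorphicNFOn hq (mem_univ z), hq0]
  have hua : ∀ z, AnalyticAt ℂ u z := fun z =>
    (hun z).meromorphicOrderAt_nonneg_iff_analyticAt.1 (hu0 z).ge
  refine ⟨u, fun z => (hua z).differentiableAt,
    fun z => (hun z).meromorphicOrderAt_eq_zero_iff.1 (hu0 z), fun z => ?_⟩
  have hev : f =ᶠ[𝓝[≠] z] fun w => g w * u w := by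
    have h1 := hq.toMeromorphicNFOn_eq_self_on_nhdsNE (mem_univ z)
    have h2 := (meromorphicOrderAt_ne_top_iff_eventually_ne_zero (hgm z)).1 (htop z)
    filter_upwards [h1, h2] with w hw1 hw2
    rw [hu, hw1, Pi.div_apply, mul_div_cancel₀ _ hw2]
  have := (ContinuousAt.eventuallyEq_nhds_iff_eventuallyEq_nhdsNE
    (hf.continuous.continuousAt) ((hg.continuous.continuousAt).mul (hua z).continuousAt)).1 hev
  exact this.eq_of_nhds

/-- Entire functions of exponential type with the same zeros, the same value `1` and the same
derivative at the origin coincide. -/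
theorem eq_of_exponential_type_of_same_zeros {E : Type*} [NormedAddCommGroup E] [NormedSpace ℂ E]
    [CompleteSpace E]
    {f g : ℂ → ℂ} {φ ψ : ℂ → E} (hf : Differentiable ℂ f) (hg : Differentiable ℂ g)
    (hφ : Differentiable ℂ φ) (hψ : Differentiable ℂ ψ) (hφ0 : ∀ z, φ z ≠ 0) (hψ0 : ∀ z, ψ z ≠ 0)
    (hf0 : f 0 = 1) (hg0 : g 0 = 1) (hd : deriv f 0 = deriv g 0) {B : ℝ} (hB : 0 ≤ B)
    (hfB : ∀ z, Real.log ‖f z‖ ≤ B * (1 + ‖z‖)) (hgB : ∀ z, Real.log ‖g z‖ ≤ B * (1 + ‖z‖))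
    (h : ∀ z, f z • φ z = g z • ψ z) : f = g := by
  obtain ⟨u, hu, hune, hfu⟩ := exists_zero_free_quotient hf hg hφ hψ hφ0 hψ0 (by simp [hg0]) h
  have hu0 : u 0 = 1 := by simpa [hf0, hg0] using (hfu 0).symm
  obtain ⟨P, hP, hPu⟩ := exists_entire_log hu hune
  simp only [hu0, one_mul] at hPu
  have hc := deriv_log_const_of_exponential_type hf hg hP hf0 hg0 hB hfB hgB
    (fun z => by rw [hfu, hPu])
  -- Differentiating `f = g u` at 0, where `g` and `u` equal 1, gives `f' = g' + u'`. So the linear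
  -- coefficient of `P` vanishes, and `P` is constant.
  have hud : deriv u 0 = 0 := by
    have h1 : deriv f 0 = deriv g 0 * u 0 + g 0 * deriv u 0 := by
      rw [show f = fun z => g z * u z from funext hfu]
      exact deriv_fun_mul (hg 0) (hu 0)
    rw [hd, hu0, hg0] at h1
    simpa using h1
  have hPd : deriv P 0 = 0 := by
    have h1 : deriv u 0 = exp (P 0) * deriv P 0 := by
      rw [show u = fun z => exp (P z) from funext hPu]
      exact ((hP 0).hasDerivAt.cexp).deriv
    rw [hud] at h1
    simpa using h1.symm
  have hPc : ∀ z, P z = P 0 := fun z =>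
    is_const_of_deriv_eq_zero hP (fun w => (hc w).trans hPd) z 0
  funext z
  rw [hfu, hPu, hPc, ← hPu, hu0, mul_one]

end Entire

/-! ### Integral operators between `L²` spaces -/

section IntegralOperator

open scoped ENNReal

variable {X Y Z : Type*} [MeasurableSpace X] [MeasurableSpace Y] [MeasurableSpace Z]

theorem lintegral_mul_sq_le (ν : Measure Y) {a b : Y → ℝ≥0∞} (ha : AEMeasurable a ν)
    (hb : AEMeasurable b ν) :
    (∫⁻ y, a y * b y ∂ν) ^ 2 ≤ (∫⁻ y, a y ^ 2 ∂ν) * ∫⁻ y, b y ^ 2 ∂ν := by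
  have h := ENNReal.lintegral_mul_le_Lp_mul_Lq ν Real.HolderConjugate.two_two ha hb
  calc (∫⁻ y, a y * b y ∂ν) ^ 2
      ≤ ((∫⁻ y, a y ^ (2 : ℝ) ∂ν) ^ (1 / 2 : ℝ) * (∫⁻ y, b y ^ (2 : ℝ) ∂ν) ^ (1 / 2 : ℝ)) ^ 2 := by
        gcongr
        exact h
    _ = _ := by
        rw [mul_pow, ← ENNReal.rpow_natCast, ← ENNReal.rpow_natCast, ← ENNReal.rpow_mul,
          ← ENNReal.rpow_mul]
        norm_num

theorem lintegral_enorm_sq_Lp {ξ : Measure Z} (f : Lp ℂ 2 ξ) :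
    ∫⁻ z, ‖f z‖ₑ ^ 2 ∂ξ = ‖f‖ₑ ^ 2 := by
  rw [Lp.enorm_def]
  have := eLpNorm_nnreal_pow_eq_lintegral (f := f) (μ := ξ) (p := 2) two_ne_zero
  simp only [NNReal.coe_ofNat, ENNReal.coe_ofNat, ENNReal.rpow_ofNat] at this
  exact this.symm

theorem eLpNorm_two_sq {μ : Measure X} (f : X → ℂ) :
    eLpNorm f 2 μ ^ 2 = ∫⁻ x, ‖f x‖ₑ ^ 2 ∂μ := by
  have := eLpNorm_nnreal_pow_eq_lintegral (f := f) (μ := μ) (p := 2) two_ne_zero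
  simpa only [NNReal.coe_ofNat, ENNReal.coe_ofNat, ENNReal.rpow_ofNat] using this

/-- An integral operator `f ↦ ∫ K(x,y) f(τ(x,y)) dy` is bounded between `L²` spaces if the bound
that comes from the Cauchy–Schwarz inequality is finite. -/
theorem exists_integralOperator {μ : Measure X} {ν : Measure Y} {ξ : Measure Z} [SFinite μ]
    [SFinite ν] {K : X × Y → ℂ} (hK : AEStronglyMeasurable K (μ.prod ν)) {τ : X × Y → Z}
    (hτ : Measure.QuasiMeasurePreserving τ (μ.prod ν) ξ) {C : NNReal}
    (hC : ∀ f : Lp ℂ 2 ξ, ∫⁻ x, (∫⁻ y, ‖K (x, y)‖ₑ ^ 2 ∂ν) * (∫⁻ y, ‖f (τ (x, y))‖ₑ ^ 2 ∂ν) ∂μ ≤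
      (C * ‖f‖ₑ) ^ 2) :
    ∃ T : Lp ℂ 2 ξ →L[ℂ] Lp ℂ 2 μ,
      ∀ f : Lp ℂ 2 ξ, T f =ᵐ[μ] fun x => ∫ y, K (x, y) * f (τ (x, y)) ∂ν := by
  have hf : ∀ f : Lp ℂ 2 ξ, AEStronglyMeasurable (fun p => f (τ p)) (μ.prod ν) := fun f =>
    (Lp.aestronglyMeasurable f).comp_quasiMeasurePreserving hτ
  have hN : ∀ f : Lp ℂ 2 ξ, ∫⁻ x, (∫⁻ y, ‖K (x, y) * f (τ (x, y))‖ₑ ∂ν) ^ 2 ∂μ ≤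
      (C * ‖f‖ₑ) ^ 2 := by
    intro f
    refine le_trans (lintegral_mono_ae ?_) (hC f)
    filter_upwards [hK.prodMk_left, (hf f).prodMk_left] with x h1 h2
    simp only [enorm_mul]
    exact lintegral_mul_sq_le ν h1.enorm h2.enorm
  have hgm : ∀ f : Lp ℂ 2 ξ, AEStronglyMeasurable (fun p => K p * f (τ p)) (μ.prod ν) := fun f =>
    hK.mul (hf f)
  have hint : ∀ f : Lp ℂ 2 ξ, ∀ᵐ x ∂μ, Integrable (fun y => K (x, y) * f (τ (x, y))) ν := by
    intro f
    have hm : AEMeasurable (fun x => (∫⁻ y, ‖K (x, y) * f (τ (x, y))‖ₑ ∂ν) ^ 2) μ :=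
      ((hgm f).enorm.lintegral_prod_right').pow_const 2
    have hfin := ae_lt_top' hm (((hN f).trans_lt
      (ENNReal.pow_lt_top (ENNReal.mul_lt_top ENNReal.coe_lt_top enorm_lt_top))).ne)
    filter_upwards [hfin, (hgm f).prodMk_left] with x h1 h2
    refine ⟨h2, ?_⟩
    rw [hasFiniteIntegral_iff_enorm]
    by_contra h
    rw [not_lt_top_iff.1 h] at h1
    simp at h1
  have hnorm : ∀ f : Lp ℂ 2 ξ, eLpNorm (fun x => ∫ y, K (x, y) * f (τ (x, y)) ∂ν) 2 μ ≤
      C * ‖f‖ₑ := by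
    intro f
    have h : eLpNorm (fun x => ∫ y, K (x, y) * f (τ (x, y)) ∂ν) 2 μ ^ 2 ≤ (C * ‖f‖ₑ) ^ 2 := by
      rw [eLpNorm_two_sq]
      refine le_trans (lintegral_mono fun x => ?_) (hN f)
      gcongr
      exact enorm_integral_le_lintegral_enorm _
    exact (ENNReal.pow_le_pow_left_iff two_ne_zero).1 h
  have hmem : ∀ f : Lp ℂ 2 ξ, MemLp (fun x => ∫ y, K (x, y) * f (τ (x, y)) ∂ν) 2 μ := fun f =>
    ⟨(hgm f).integral_prod_right',
      (hnorm f).trans_lt (ENNReal.mul_lt_top ENNReal.coe_lt_top enorm_lt_top)⟩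
  have hslice : ∀ {p : Z → Prop}, (∀ᵐ z ∂ξ, p z) → ∀ᵐ x ∂μ, ∀ᵐ y ∂ν, p (τ (x, y)) := fun hp =>
    Measure.ae_ae_of_ae_prod (hτ.ae hp)
  let T₀ : Lp ℂ 2 ξ →ₗ[ℂ] Lp ℂ 2 μ :=
    { toFun := fun f => (hmem f).toLp _
      map_add' := fun f g => by
        rw [← MemLp.toLp_add]
        refine MemLp.toLp_congr _ _ ?_
        filter_upwards [hint f, hint g, hslice (Lp.coeFn_add f g)] with x h1 h2 h3
        rw [Pi.add_apply, ← integral_add h1 h2]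
        refine integral_congr_ae ?_
        filter_upwards [h3] with y hy
        rw [hy, Pi.add_apply, mul_add]
      map_smul' := fun c f => by
        rw [RingHom.id_apply, ← MemLp.toLp_const_smul]
        refine MemLp.toLp_congr _ _ ?_
        filter_upwards [hslice (Lp.coeFn_smul c f)] with x h3
        rw [Pi.smul_apply, ← integral_smul]
        refine integral_congr_ae ?_
        filter_upwards [h3] with y hy
        rw [hy, Pi.smul_apply, smul_eq_mul, smul_eq_mul]
        ring }
  refine ⟨T₀.mkContinuous C fun f => ?_, fun f => (hmem f).coeFn_toLp⟩
  change ‖(hmem f).toLp _‖ ≤ _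
  rw [Lp.norm_toLp]
  refine ENNReal.toReal_le_of_le_ofReal (by positivity) ((hnorm f).trans ?_)
  rw [ENNReal.ofReal_mul (by positivity), ENNReal.ofReal_coe_nnreal, ofReal_norm]

/-- Hilbert–Schmidt integral operators. -/
theorem exists_hilbertSchmidt {μ : Measure X} {ν : Measure Y} [SFinite μ] [SFinite ν]
    {K : X × Y → ℂ} (hK : MemLp K 2 (μ.prod ν)) :
    ∃ T : Lp ℂ 2 ν →L[ℂ] Lp ℂ 2 μ, ∀ f : Lp ℂ 2 ν, T f =ᵐ[μ] fun x => ∫ y, K (x, y) * f y ∂ν := by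
  refine exists_integralOperator hK.1 (τ := Prod.snd) Measure.quasiMeasurePreserving_snd
    (C := (eLpNorm K 2 (μ.prod ν)).toNNReal) fun f => ?_
  change ∫⁻ x, (∫⁻ y, ‖K (x, y)‖ₑ ^ 2 ∂ν) * (∫⁻ y, ‖f y‖ₑ ^ 2 ∂ν) ∂μ ≤ _
  rw [lintegral_mul_const'' _ (hK.1.enorm.pow_const 2).lintegral_prod_right',
    lintegral_enorm_sq_Lp, mul_pow, ENNReal.coe_toNNReal hK.2.ne, eLpNorm_two_sq,
    lintegral_prod _ (hK.1.enorm.pow_const 2)]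

/-- Integral operators with a bounded kernel, along a map `τ` that preserves the measure up to a
constant. -/
theorem exists_integralOperator_of_bounded {μ : Measure X} {ν : Measure Y} {ξ : Measure Z}
    [SFinite μ] [IsFiniteMeasure ν] {K : X × Y → ℂ} (hK : AEStronglyMeasurable K (μ.prod ν))
    {B : NNReal} (hB : ∀ p, ‖K p‖₊ ≤ B) {τ : X × Y → Z} (hτm : Measurable τ) {c : NNReal}
    (hτ : (μ.prod ν).map τ = c • ξ) :
    ∃ T : Lp ℂ 2 ξ →L[ℂ] Lp ℂ 2 μ,
      ∀ f : Lp ℂ 2 ξ, T f =ᵐ[μ] fun x => ∫ y, K (x, y) * f (τ (x, y)) ∂ν := by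
  have hq : Measure.QuasiMeasurePreserving τ (μ.prod ν) ξ :=
    ⟨hτm, by rw [hτ]; exact Measure.smul_absolutelyContinuous⟩
  set D : NNReal := B ^ 2 * (ν univ).toNNReal * c with hD
  refine exists_integralOperator hK hq (C := NNReal.sqrt D) fun f => ?_
  have hf2 : AEMeasurable (fun p => ‖f (τ p)‖ₑ ^ 2) (μ.prod ν) :=
    (((Lp.aestronglyMeasurable f).comp_quasiMeasurePreserving hq).enorm.pow_const 2)
  calc ∫⁻ x, (∫⁻ y, ‖K (x, y)‖ₑ ^ 2 ∂ν) * (∫⁻ y, ‖f (τ (x, y))‖ₑ ^ 2 ∂ν) ∂μ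
      ≤ ∫⁻ x, (B ^ 2 * ν univ) * (∫⁻ y, ‖f (τ (x, y))‖ₑ ^ 2 ∂ν) ∂μ := by
        gcongr with x
        calc ∫⁻ y, ‖K (x, y)‖ₑ ^ 2 ∂ν ≤ ∫⁻ _, (B : ℝ≥0∞) ^ 2 ∂ν := by
              gcongr with y
              exact ENNReal.coe_le_coe.2 (hB (x, y))
          _ = _ := by rw [lintegral_const]
    _ = (B ^ 2 * ν univ) * ∫⁻ p, ‖f (τ p)‖ₑ ^ 2 ∂(μ.prod ν) := by
        rw [lintegral_const_mul'' _ hf2.lintegral_prod_right', lintegral_prod _ hf2]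
    _ = (B ^ 2 * ν univ) * ∫⁻ z, ‖f z‖ₑ ^ 2 ∂((μ.prod ν).map τ) := by
        rw [lintegral_map' ?_ hτm.aemeasurable]
        rw [hτ]
        exact ((Lp.aestronglyMeasurable f).enorm.pow_const 2).mono_ac
          Measure.smul_absolutelyContinuous
    _ = D * ‖f‖ₑ ^ 2 := by
        rw [hτ, lintegral_smul_measure, lintegral_enorm_sq_Lp, hD]
        push_cast
        rw [ENNReal.coe_toNNReal (measure_ne_top ν univ), ENNReal.smul_def, smul_eq_mul]
        ring
    _ = (NNReal.sqrt D * ‖f‖ₑ) ^ 2 := by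
        rw [mul_pow, ← ENNReal.coe_pow, NNReal.sq_sqrt]

end IntegralOperator

/-! ### Integrable functions that are determined by their integrals -/

section Determined

/-- The sets over which `F` has integral zero form a Dynkin system, so a generating π-system
suffices. -/
theorem ae_eq_zero_of_isPiSystem {α : Type*} {m : MeasurableSpace α} {μ : Measure α}
    {C : Set (Set α)} (hgen : m = MeasurableSpace.generateFrom C) (hC : IsPiSystem C) {F : α → ℂ}
    (hF : Integrable F μ) (huniv : ∫ x, F x ∂μ = 0) (h : ∀ t ∈ C, ∫ x in t, F x ∂μ = 0) :
    F =ᵐ[μ] 0 := by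
  refine hF.ae_eq_zero_of_forall_setIntegral_eq_zero fun s hs _ => ?_
  rename_i hfin
  clear hfin
  induction s, hs using MeasurableSpace.induction_on_inter hgen hC with
  | empty => simp
  | basic t ht => exact h t ht
  | compl t htm ih =>
    have := integral_add_compl htm hF
    rw [ih, huniv, zero_add] at this
    exact this
  | iUnion f hd hfm ih =>
    rw [integral_iUnion hfm hd hF.integrableOn]
    simp [ih]

theorem measurableSet_box (a : Fin 2 → ℝ) : MeasurableSet (box a) :=
  MeasurableSet.univ_pi fun _ => measurableSet_Ioo

theorem isCountablySpanning_range_Iio : IsCountablySpanning (range (Iio : ℝ → Set ℝ)) :=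
  ⟨fun n => Iio (n : ℝ), fun n => mem_range_self _, by
    rw [eq_univ_iff_forall]
    intro x
    obtain ⟨n, hn⟩ := exists_nat_gt x
    exact mem_iUnion.2 ⟨n, hn⟩⟩

theorem ae_eq_zero_of_integral_box {ω : Fin 2 → ℝ} (hω : ∀ i, 0 < ω i) {F : (Fin 2 → ℝ) → ℂ}
    (hF : IntegrableOn F (box ω)) (h : ∀ b ∈ Icc 0 ω, ∫ x in box b, F x = 0) :
    F =ᵐ[volume.restrict (box ω)] 0 := by
  have hgen : (MeasurableSpace.pi : MeasurableSpace (Fin 2 → ℝ)) =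
      MeasurableSpace.generateFrom (pi univ '' pi univ fun _ => range (Iio : ℝ → Set ℝ)) := by
    rw [← generateFrom_pi_eq fun _ => isCountablySpanning_range_Iio]
    rw [← borel_eq_generateFrom_Iio, ← BorelSpace.measurable_eq]
  refine ae_eq_zero_of_isPiSystem hgen (IsPiSystem.pi fun _ => isPiSystem_Iio) hF
    (h ω ⟨fun i => (hω i).le, le_rfl⟩) ?_
  rintro _ ⟨t, ht, rfl⟩
  choose c hc using fun i => ht i (mem_univ i)
  rw [Measure.restrict_restrict (MeasurableSet.univ_pi fun i => by
    rw [← hc i]; exact measurableSet_Iio)]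
  -- A quadrant cuts the rectangle in another rectangle with a corner at 0; the clipping covers
  -- quadrants that miss it or exceed it.
  have hb : pi univ t ∩ box ω = box fun i => max 0 (min (c i) (ω i)) := by
    ext x
    simp only [box, ← hc, mem_inter_iff, mem_univ_pi, mem_Iio, mem_Ioo, lt_max_iff, lt_min_iff]
    constructor
    · rintro ⟨h1, h2⟩ i
      exact ⟨(h2 i).1, Or.inr ⟨h1 i, (h2 i).2⟩⟩
    · intro h1
      refine ⟨fun i => ?_, fun i => ⟨(h1 i).1, ?_⟩⟩ <;>
      · rcases (h1 i).2 with h2 | h2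
        · linarith [(h1 i).1]
        · first | exact h2.1 | exact h2.2
  rw [hb]
  exact h _ ⟨fun i => le_max_left _ _, fun i => max_le (hω i).le (min_le_right _ _)⟩

theorem ae_eq_zero_of_integral_Ioo {l : ℝ} (hl : 0 < l) {F : ℝ → ℂ}
    (hF : IntegrableOn F (Ioo 0 l)) (h : ∀ b ∈ Icc 0 l, ∫ x in Ioo 0 b, F x = 0) :
    F =ᵐ[volume.restrict (Ioo 0 l)] 0 := by
  have hgen : Real.measurableSpace =
      MeasurableSpace.generateFrom (range (Iio : ℝ → Set ℝ)) := by
    rw [← borel_eq_generateFrom_Iio, ← BorelSpace.measurable_eq]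
  refine ae_eq_zero_of_isPiSystem hgen isPiSystem_Iio hF (h l ⟨hl.le, le_rfl⟩) ?_
  rintro _ ⟨c, rfl⟩
  rw [Measure.restrict_restrict measurableSet_Iio]
  have hb : Iio c ∩ Ioo 0 l = Ioo 0 (max 0 (min c l)) := by
    ext x
    simp only [mem_inter_iff, mem_Iio, mem_Ioo, lt_max_iff, lt_min_iff]
    constructor
    · rintro ⟨h1, h2, h3⟩
      exact ⟨h2, Or.inr ⟨h1, h3⟩⟩
    · rintro ⟨h1, h2 | h2⟩
      · linarith
      · exact ⟨h2.1, h1, h2.2⟩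
  rw [hb]
  exact h _ ⟨le_max_left _ _, max_le hl.le (min_le_right _ _)⟩

end Determined

/-! ### Coordinates -/

section Coordinates

variable {i k : Fin 2}

theorem pt_self (i : Fin 2) (a b : ℝ) : pt i a b i = a := by simp [pt]

theorem pt_other (h : i ≠ k) (a b : ℝ) : pt i a b k = b := by simp [pt, h.symm]

theorem forall_fin_two_of_ne (h : i ≠ k) {p : Fin 2 → Prop} : (∀ j, p j) ↔ p i ∧ p k := by
  refine ⟨fun hp => ⟨hp i, hp k⟩, fun ⟨h1, h2⟩ j => ?_⟩
  have : j = i ∨ j = k := by omega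
  rcases this with rfl | rfl <;> assumption

theorem pt_eta (h : i ≠ k) (x : Fin 2 → ℝ) : pt i (x i) (x k) = x := by
  funext j
  revert j
  rw [forall_fin_two_of_ne h]
  exact ⟨pt_self _ _ _, pt_other h _ _⟩

theorem pt_comm (h : i ≠ k) (a b : ℝ) : pt i a b = pt k b a := by
  funext j
  revert j
  rw [forall_fin_two_of_ne h]
  exact ⟨by rw [pt_self, pt_other h.symm], by rw [pt_self, pt_other h]⟩

theorem ext_of_ne (h : i ≠ k) {x y : Fin 2 → ℝ} (h1 : x i = y i) (h2 : x k = y k) : x = y := by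
  rw [← pt_eta h x, ← pt_eta h y, h1, h2]

theorem pt_sub (i : Fin 2) (a b : ℝ) (t : Fin 2 → ℝ) (h : i ≠ k) :
    pt i a b - t = pt i (a - t i) (b - t k) :=
  ext_of_ne h (by simp [pt_self]) (by simp [pt_other h])

/-- The pairs `(x i, x k)` as coordinates on the plane. -/
def ptEquiv (h : i ≠ k) : ℝ × ℝ ≃ᵐ (Fin 2 → ℝ) where
  toFun p := pt i p.1 p.2
  invFun x := (x i, x k)
  left_inv p := by ext <;> simp [pt_self, pt_other h]
  right_inv x := pt_eta h x
  measurable_toFun := by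
    refine measurable_pi_lambda _ fun j => ?_
    simp only [Equiv.coe_fn_mk, pt]
    split_ifs
    · exact measurable_fst
    · exact measurable_snd
  measurable_invFun := (measurable_pi_apply i).prodMk (measurable_pi_apply k)

theorem measurable_pt (i : Fin 2) : Measurable fun p : ℝ × ℝ => pt i p.1 p.2 := by
  refine measurable_pi_lambda _ fun j => ?_
  simp only [pt]
  split_ifs
  · exact measurable_fst
  · exact measurable_snd

theorem continuous_pt (i : Fin 2) : Continuous fun p : ℝ × ℝ => pt i p.1 p.2 := by
  refine continuous_pi fun j => ?_
  simp only [pt]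
  split_ifs
  · exact continuous_fst
  · exact continuous_snd

@[fun_prop]
theorem Measurable.pt_comp {α : Type*} [MeasurableSpace α] (i : Fin 2) {f g : α → ℝ}
    (hf : Measurable f) (hg : Measurable g) : Measurable fun x => pt i (f x) (g x) :=
  (measurable_pt i).comp (hf.prodMk hg)

@[fun_prop]
theorem Continuous.pt_comp {α : Type*} [TopologicalSpace α] (i : Fin 2) {f g : α → ℝ}
    (hf : Continuous f) (hg : Continuous g) : Continuous fun x => pt i (f x) (g x) :=
  (continuous_pt i).comp (hf.prodMk hg)

theorem measurePreserving_ptEquiv (h : i ≠ k) :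
    MeasurePreserving (ptEquiv h) (volume.prod volume) volume := by
  have h01 : MeasurePreserving (ptEquiv (show (0 : Fin 2) ≠ 1 by decide))
      (volume.prod volume) volume := by
    have e : ⇑(ptEquiv (show (0 : Fin 2) ≠ 1 by decide)) =
        ⇑(MeasurableEquiv.finTwoArrow (α := ℝ)).symm := by
      funext p j
      fin_cases j <;> rfl
    rw [e]
    exact MeasurePreserving.symm _ (volume_preserving_finTwoArrow ℝ)
  fin_cases i <;> fin_cases k
  · exact absurd rfl h
  · exact h01
  · have := h01.comp (Measure.measurePreserving_swap (μ := (volume : Measure ℝ))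
      (ν := (volume : Measure ℝ)))
    convert this using 1
    funext p
    exact pt_comm h p.1 p.2
  · exact absurd rfl h

theorem measurePreserving_pt (h : i ≠ k) :
    MeasurePreserving (fun p : ℝ × ℝ => pt i p.1 p.2) (volume.prod volume) volume :=
  measurePreserving_ptEquiv h

theorem pt_mem_box (h : i ≠ k) {a : Fin 2 → ℝ} {u v : ℝ} :
    pt i u v ∈ box a ↔ u ∈ Ioo 0 (a i) ∧ v ∈ Ioo 0 (a k) := by
  rw [box, mem_univ_pi, forall_fin_two_of_ne h, pt_self, pt_other h]

theorem mem_box (h : i ≠ k) {a x : Fin 2 → ℝ} :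
    x ∈ box a ↔ x i ∈ Ioo 0 (a i) ∧ x k ∈ Ioo 0 (a k) := by
  rw [box, mem_univ_pi, forall_fin_two_of_ne h]

theorem measurePreserving_pt_box (h : i ≠ k) (a : Fin 2 → ℝ) :
    MeasurePreserving (fun p : ℝ × ℝ => pt i p.1 p.2)
      ((volume.restrict (Ioo 0 (a i))).prod (volume.restrict (Ioo 0 (a k))))
      (volume.restrict (box a)) := by
  have := (measurePreserving_pt h).restrict_preimage (measurableSet_box a)
  rw [Measure.prod_restrict]
  convert this using 2
  ext p
  exact (pt_mem_box h).symm

theorem measurableEmbedding_pt (h : i ≠ k) :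
    MeasurableEmbedding (fun p : ℝ × ℝ => pt i p.1 p.2) :=
  (ptEquiv h).measurableEmbedding

theorem integral_box_eq (h : i ≠ k) {a : Fin 2 → ℝ} {F : (Fin 2 → ℝ) → ℂ}
    (hF : IntegrableOn F (box a)) :
    ∫ x in box a, F x = ∫ u in Ioo 0 (a i), ∫ v in Ioo 0 (a k), F (pt i u v) := by
  have hm := measurePreserving_pt_box h a
  rw [← hm.integral_comp (measurableEmbedding_pt h), integral_prod]
  exact (hm.integrable_comp_emb (measurableEmbedding_pt h)).2 hF

theorem integrable_comp_pt (h : i ≠ k) {F : (Fin 2 → ℝ) → ℂ} (hF : Integrable F) :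
    Integrable (fun p : ℝ × ℝ => F (pt i p.1 p.2)) (volume.prod volume) :=
  ((measurePreserving_pt h).integrable_comp_emb (measurableEmbedding_pt h)).2 hF

theorem setIntegral_Ioo_eq {a : ℝ} (ha : 0 ≤ a) (F : ℝ → ℂ) :
    ∫ u in Ioo 0 a, F u = ∫ u in (0 : ℝ)..a, F u := by
  rw [intervalIntegral.integral_of_le ha, integral_Ioc_eq_integral_Ioo]

theorem integral_box_eq_intervalIntegral (h : i ≠ k) {a : Fin 2 → ℝ} (ha : 0 ≤ a)
    {F : (Fin 2 → ℝ) → ℂ} (hF : IntegrableOn F (box a)) :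
    ∫ x in box a, F x = ∫ u in (0 : ℝ)..a i, ∫ v in (0 : ℝ)..a k, F (pt i u v) := by
  rw [integral_box_eq h hF, setIntegral_Ioo_eq (ha i)]
  simp_rw [setIntegral_Ioo_eq (ha k)]

end Coordinates

/-! ### The double primitive of an integrable function -/

section Primitive

theorem intervalIntegral_swap {F : ℝ × ℝ → ℂ} (hF : Integrable F (volume.prod volume))
    (a b c d : ℝ) :
    ∫ u in a..b, ∫ v in c..d, F (u, v) = ∫ v in c..d, ∫ u in a..b, F (u, v) := by
  simp only [intervalIntegral.intervalIntegral_eq_integral_uIoc, integral_smul]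
  rw [smul_comm]
  congr 2
  refine integral_integral_swap (f := fun u v => F (u, v)) ?_
  rw [Measure.prod_restrict]
  exact hF.integrableOn

variable {i k : Fin 2}

/-- The double primitive `∫_0^{v₁} ∫_0^{v₂} F` of a function on the plane. -/
def prim (F : (Fin 2 → ℝ) → ℂ) (v : Fin 2 → ℝ) : ℂ :=
  ∫ u in (0 : ℝ)..v 0, ∫ w in (0 : ℝ)..v 1, F (pt 0 u w)

theorem prim_eq (h : i ≠ k) {F : (Fin 2 → ℝ) → ℂ} (hF : Integrable F) (v : Fin 2 → ℝ) :
    prim F v = ∫ u in (0 : ℝ)..v i, ∫ w in (0 : ℝ)..v k, F (pt i u w) := by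
  fin_cases i <;> fin_cases k
  · exact absurd rfl h
  · rfl
  · rw [prim]
    refine (intervalIntegral_swap (integrable_comp_pt (show (0 : Fin 2) ≠ 1 by decide) hF)
      _ _ _ _).trans ?_
    simp only [pt_comm (show (0 : Fin 2) ≠ 1 by decide)]
    rfl
  · exact absurd rfl h

theorem integrable_section (h : i ≠ k) {F : (Fin 2 → ℝ) → ℂ} (hF : Integrable F) (c d : ℝ) :
    Integrable fun u => ∫ w in c..d, F (pt i u w) := by
  simp only [intervalIntegral.intervalIntegral_eq_integral_uIoc]
  refine Integrable.smul (if c ≤ d then (1 : ℝ) else -1) ?_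
  have : Integrable (fun p : ℝ × ℝ => F (pt i p.1 p.2))
      (volume.prod (volume.restrict (uIoc c d))) := by
    have h2 : (volume : Measure ℝ).prod (volume.restrict (uIoc c d)) =
        (volume.prod volume).restrict (univ ×ˢ uIoc c d) := by
      rw [← Measure.prod_restrict, Measure.restrict_univ]
    rw [h2]
    exact (integrable_comp_pt h hF).integrableOn
  exact this.integral_prod_left

theorem prim_sub_prim (h : i ≠ k) {F : (Fin 2 → ℝ) → ℂ} (hF : Integrable F) (a b c : ℝ) :
    prim F (pt i b c) - prim F (pt i a c) = ∫ u in a..b, ∫ w in (0 : ℝ)..c, F (pt i u w) := by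
  have hI := fun a b => (integrable_section h hF 0 c).intervalIntegrable (a := a) (b := b)
  rw [prim_eq h hF, prim_eq h hF]
  simp only [pt_self, pt_other h]
  exact intervalIntegral.integral_interval_sub_left (hI 0 b) (hI 0 a)

theorem continuous_prim_section (h : i ≠ k) {F : (Fin 2 → ℝ) → ℂ} (hF : Integrable F) (c : ℝ) :
    Continuous fun u => prim F (pt i u c) := by
  simp only [prim_eq h hF, pt_self, pt_other h]
  exact intervalIntegral.continuous_primitive
    (fun a b => (integrable_section h hF 0 c).intervalIntegrable) 0

theorem prim_zero_left (i : Fin 2) (F : (Fin 2 → ℝ) → ℂ) {v : Fin 2 → ℝ} (hv : v i = 0) :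
    prim F v = 0 := by
  fin_cases i <;> simp_all [prim]

theorem prim_pt_zero_left (i : Fin 2) (F : (Fin 2 → ℝ) → ℂ) (a : ℝ) : prim F (pt i 0 a) = 0 :=
  prim_zero_left i F (pt_self _ _ _)

theorem prim_pt_zero_right (h : i ≠ k) (F : (Fin 2 → ℝ) → ℂ) (a : ℝ) : prim F (pt i a 0) = 0 :=
  prim_zero_left k F (pt_other h _ _)

theorem continuous_prim {F : (Fin 2 → ℝ) → ℂ} (hF : Integrable F) : Continuous (prim F) := by
  have h01 : (0 : Fin 2) ≠ 1 := by decide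
  have hI := integrable_comp_pt h01 hF
  have hm : Integrable fun u => ∫ w, ‖F (pt 0 u w)‖ := hI.integral_norm_prod_left
  have hmc : Continuous fun x => ∫ u in (0 : ℝ)..x, ∫ w, ‖F (pt 0 u w)‖ :=
    intervalIntegral.continuous_primitive (fun a b => hm.intervalIntegrable) 0
  rw [continuous_iff_continuousAt]
  intro v₀
  -- Moving the first coordinate changes the primitive by at most an integral of `u ↦ ∫ |F(u, w)|
  -- dw`, uniformly in the second coordinate. Joint continuity thus reduces to continuity in each
  -- variable.
  have hkey : ∀ v : Fin 2 → ℝ, dist (prim F v) (prim F v₀) ≤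
      |(∫ u in (0 : ℝ)..v 0, ∫ w, ‖F (pt 0 u w)‖) - ∫ u in (0 : ℝ)..v₀ 0, ∫ w, ‖F (pt 0 u w)‖| +
        dist (prim F (pt 0 (v₀ 0) (v 1))) (prim F v₀) := by
    intro v
    refine (dist_triangle _ (prim F (pt 0 (v₀ 0) (v 1))) _).trans (add_le_add_left ?_ _)
    have e := prim_sub_prim h01 hF (v₀ 0) (v 0) (v 1)
    rw [pt_eta h01] at e
    rw [dist_eq_norm, e, intervalIntegral.integral_interval_sub_left
      hm.intervalIntegrable hm.intervalIntegrable]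
    refine intervalIntegral.norm_integral_le_abs_of_norm_le ?_ hm.intervalIntegrable
    refine Filter.Eventually.filter_mono (ae_mono Measure.restrict_le_self) ?_
    filter_upwards [hI.prod_right_ae] with u hu
    rw [intervalIntegral.norm_intervalIntegral_eq]
    refine (norm_integral_le_integral_norm _).trans ?_
    exact setIntegral_le_integral hu.norm (Filter.Eventually.of_forall fun _ => norm_nonneg _)
  refine tendsto_iff_dist_tendsto_zero.2 (squeeze_zero (fun _ => dist_nonneg) hkey ?_)
  rw [← add_zero (0 : ℝ)]
  refine Filter.Tendsto.add ?_ ?_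
  · have : Continuous fun v : Fin 2 → ℝ =>
        |(∫ u in (0 : ℝ)..v 0, ∫ w, ‖F (pt 0 u w)‖) -
          ∫ u in (0 : ℝ)..v₀ 0, ∫ w, ‖F (pt 0 u w)‖| :=
      ((hmc.comp (continuous_apply 0)).sub continuous_const).abs
    have := this.tendsto v₀
    simpa using this
  · have hc : Continuous fun v : Fin 2 → ℝ => prim F (pt 0 (v₀ 0) (v 1)) := by
      simp only [pt_comm h01]
      exact (continuous_prim_section h01.symm hF _).comp (continuous_apply 1)
    have := (hc.dist (continuous_const (y := prim F v₀))).tendsto v₀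
    rw [pt_eta h01] at this
    simpa using this

theorem integral_box_eq_prim {F : (Fin 2 → ℝ) → ℂ} (hF : Integrable F) {a : Fin 2 → ℝ}
    (ha : 0 ≤ a) : ∫ x in box a, F x = prim F a :=
  integral_box_eq_intervalIntegral (show (0 : Fin 2) ≠ 1 by decide) ha hF.integrableOn

/-- The integral of a translated and reflected function over a rectangle. -/
theorem integral_box_sub (h : i ≠ k) {F : (Fin 2 → ℝ) → ℂ} (hF : Integrable F) {a : Fin 2 → ℝ}
    (ha : 0 ≤ a) (x : Fin 2 → ℝ) :
    ∫ t in box a, F (x - t) = prim F x - prim F (pt i (x i - a i) (x k)) -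
      prim F (pt i (x i) (x k - a k)) + prim F (pt i (x i - a i) (x k - a k)) := by
  have hI : Integrable fun t => F (x - t) := hF.comp_sub_left x
  have hJ : ∀ c d, Integrable fun u => ∫ w in c..d, F (pt i u w) := integrable_section h hF
  rw [integral_box_eq_intervalIntegral h ha hI.integrableOn]
  have h1 : ∀ u v, x - pt i u v = pt i (x i - u) (x k - v) := fun u v =>
    ext_of_ne h (by simp [pt_self]) (by simp [pt_other h])
  simp only [h1]
  have h2 : ∀ u, ∫ v in (0 : ℝ)..a k, F (pt i (x i - u) (x k - v)) =
      ∫ v in x k - a k..x k, F (pt i (x i - u) v) := fun u => by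
    rw [intervalIntegral.integral_comp_sub_left (fun v => F (pt i (x i - u) v)), sub_zero]
  simp only [h2]
  rw [intervalIntegral.integral_comp_sub_left
    (fun u => ∫ v in x k - a k..x k, F (pt i u v)) (x i), sub_zero]
  have e1 := prim_sub_prim h hF (x i - a i) (x i) (x k)
  have e2 := prim_sub_prim h hF (x i - a i) (x i) (x k - a k)
  rw [pt_eta h] at e1
  have e3 : (∫ u in x i - a i..x i, ∫ v in (0 : ℝ)..x k, F (pt i u v)) -
      (∫ u in x i - a i..x i, ∫ v in (0 : ℝ)..x k - a k, F (pt i u v)) =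
      ∫ u in x i - a i..x i, ∫ v in x k - a k..x k, F (pt i u v) := by
    rw [← intervalIntegral.integral_sub (hJ _ _).intervalIntegrable (hJ _ _).intervalIntegrable]
    refine intervalIntegral.integral_congr_ae ?_
    filter_upwards [(integrable_comp_pt h hF).prod_right_ae] with u hu _
    exact intervalIntegral.integral_interval_sub_left hu.intervalIntegrable hu.intervalIntegrable
  rw [← e3, ← e1, ← e2]
  ring

end Primitive

/-! ### Total families in Hilbert spaces -/

section Total

variable {H H' : Type*} [NormedAddCommGroup H] [InnerProductSpace ℂ H]
  [NormedAddCommGroup H'] [InnerProductSpace ℂ H'] {ι κ : Type*}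

/-- A family of vectors is total if only the zero vector is orthogonal to all of them. -/
def IsTotal (e : ι → H) : Prop := ∀ F : H, (∀ j, inner ℂ (e j) F = 0) → F = 0

theorem IsTotal.ext {e : ι → H} (he : IsTotal e) {F F' : H}
    (h : ∀ j, inner ℂ (e j) F = inner ℂ (e j) F') : F = F' :=
  sub_eq_zero.1 (he _ fun j => by rw [inner_sub_right, h, sub_self])

theorem IsTotal.dense [CompleteSpace H] {e : ι → H} (he : IsTotal e) :
    Dense (Submodule.span ℂ (range e) : Set H) := by
  rw [Submodule.dense_iff_topologicalClosure_eq_top, Submodule.topologicalClosure_eq_top_iff,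
    Submodule.eq_bot_iff]
  intro F hF
  exact he F fun j => (Submodule.mem_orthogonal _ _).1 hF _
    (Submodule.subset_span (mem_range_self j))

theorem IsTotal.clm_ext [CompleteSpace H] {E : Type*} [NormedAddCommGroup E] [NormedSpace ℂ E]
    {e : ι → H} (he : IsTotal e) {T T' : H →L[ℂ] E} (h : ∀ j, T (e j) = T' (e j)) : T = T' :=
  ContinuousLinearMap.ext_on he.dense (by rintro _ ⟨j, rfl⟩; exact h j)

/-- Operators are determined by their matrix elements on total families. Many of the operator
identities below are checked this way, on indicator functions. -/
theorem IsTotal.clm_ext₂ [CompleteSpace H] {e : ι → H} {e' : κ → H'} (he : IsTotal e)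
    (he' : IsTotal e') {T T' : H →L[ℂ] H'}
    (h : ∀ j j', inner ℂ (e' j') (T (e j)) = inner ℂ (e' j') (T' (e j))) : T = T' :=
  he.clm_ext fun j => he'.ext fun j' => h j j'

end Total

/-! ### Indicator functions -/

section Indicators

instance isFiniteMeasure_box (a : Fin 2 → ℝ) : IsFiniteMeasure (volume.restrict (box a)) := by
  refine ⟨?_⟩
  rw [Measure.restrict_apply_univ, box, Real.volume_pi_Ioo]
  exact ENNReal.prod_lt_top fun i _ => ENNReal.ofReal_lt_top

/-- The indicator function of the rectangle `box b`. -/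
def chi (ω b : Fin 2 → ℝ) : L2Rect ω :=
  indicatorConstLp 2 (measurableSet_box b) (measure_ne_top _ _) 1

/-- The indicator function of the interval `(0, b)`. -/
def chi1 (l b : ℝ) : L2 l :=
  indicatorConstLp 2 (measurableSet_Ioo (a := 0) (b := b)) (measure_ne_top _ _) 1

variable {ω b : Fin 2 → ℝ} {l : ℝ} {i k : Fin 2}

theorem box_subset_box {a b : Fin 2 → ℝ} (h : b ≤ a) : box b ⊆ box a :=
  pi_mono fun i _ => Ioo_subset_Ioo_right (h i)

theorem inner_chi (hb : b ≤ ω) (F : L2Rect ω) : inner ℂ (chi ω b) F = ∫ x in box b, F x := by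
  rw [chi, L2.inner_indicatorConstLp_one, Measure.restrict_restrict (measurableSet_box b),
    inter_eq_left.2 (box_subset_box hb)]

theorem inner_chi1 {b : ℝ} (hb : b ≤ l) (f : L2 l) :
    inner ℂ (chi1 l b) f = ∫ x in Ioo 0 b, f x := by
  rw [chi1, L2.inner_indicatorConstLp_one, Measure.restrict_restrict measurableSet_Ioo,
    inter_eq_left.2 (Ioo_subset_Ioo_right hb)]

theorem inner_chi1_eq {b : ℝ} (hb0 : 0 ≤ b) (hb : b ≤ l) (f : L2 l) :
    inner ℂ (chi1 l b) f = ∫ x in (0 : ℝ)..b, f x := by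
  rw [inner_chi1 hb, setIntegral_Ioo_eq hb0]

theorem integrableOn_L2Rect (F : L2Rect ω) : IntegrableOn F (box ω) :=
  (Lp.memLp F).integrable one_le_two

theorem integrableOn_L2 (f : L2 l) : IntegrableOn f (Ioo 0 l) :=
  (Lp.memLp f).integrable one_le_two

theorem isTotal_chi (hω : ∀ i, 0 < ω i) : IsTotal fun b : Icc 0 ω => chi ω b := by
  intro F hF
  refine Lp.ext ((ae_eq_zero_of_integral_box hω (integrableOn_L2Rect F) fun b hb => ?_).trans
    (Lp.coeFn_zero _ _ _).symm)
  rw [← inner_chi hb.2]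
  exact hF ⟨b, hb⟩

theorem isTotal_chi1 (hl : 0 < l) : IsTotal fun b : Icc 0 l => chi1 l b := by
  intro F hF
  refine Lp.ext ((ae_eq_zero_of_integral_Ioo hl (integrableOn_L2 F) fun b hb => ?_).trans
    (Lp.coeFn_zero _ _ _).symm)
  rw [← inner_chi1 hb.2]
  exact hF ⟨b, hb⟩

/-- The extension by zero of a function on the rectangle. -/
def ext0 (F : L2Rect ω) : (Fin 2 → ℝ) → ℂ := (box ω).indicator F

theorem integrable_ext0 (F : L2Rect ω) : Integrable (ext0 F) :=
  (integrable_indicator_iff (measurableSet_box ω)).2 (integrableOn_L2Rect F)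

/-- The double primitive is continuous in the corner, so relations known for almost every corner
extend to all corners, including those on the boundary. -/
theorem inner_chi_eq_prim (hb : b ∈ Icc 0 ω) (F : L2Rect ω) :
    inner ℂ (chi ω b) F = prim (ext0 F) b := by
  rw [inner_chi hb.2, ← integral_box_eq_prim (integrable_ext0 F) hb.1]
  refine setIntegral_congr_fun (measurableSet_box b) fun x hx => ?_
  exact (indicator_of_mem (box_subset_box hb.2 hx) _).symm

theorem ext0_apply {F : L2Rect ω} {x : Fin 2 → ℝ} (hx : x ∈ box ω) : ext0 F x = F x :=
  indicator_of_mem hx _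

theorem chi_ae (ω b : Fin 2 → ℝ) :
    chi ω b =ᵐ[volume.restrict (box ω)] (box b).indicator fun _ => (1 : ℂ) :=
  indicatorConstLp_coeFn

theorem chi1_ae (l b : ℝ) :
    chi1 l b =ᵐ[volume.restrict (Ioo 0 l)] (Ioo 0 b).indicator fun _ => (1 : ℂ) :=
  indicatorConstLp_coeFn

theorem setIntegral_mul_chi {a : Fin 2 → ℝ} (ha : a ≤ ω) (K : (Fin 2 → ℝ) → ℂ) :
    ∫ t in box ω, K t * chi ω a t = ∫ t in box a, K t := by
  have : ∀ᵐ t ∂volume.restrict (box ω), K t * chi ω a t = (box a).indicator K t := by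
    filter_upwards [chi_ae ω a] with t ht
    rw [ht]
    by_cases h : t ∈ box a <;> simp [h]
  rw [integral_congr_ae this, integral_indicator (measurableSet_box a),
    Measure.restrict_restrict (measurableSet_box a), inter_eq_left.2 (box_subset_box ha)]

theorem setIntegral_mul_chi1 {a : ℝ} (ha : a ≤ l) (K : ℝ → ℂ) :
    ∫ t in Ioo 0 l, K t * chi1 l a t = ∫ t in Ioo 0 a, K t := by
  have : ∀ᵐ t ∂volume.restrict (Ioo 0 l), K t * chi1 l a t = (Ioo 0 a).indicator K t := by
    filter_upwards [chi1_ae l a] with t ht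
    rw [ht]
    by_cases h : t ∈ Ioo 0 a <;> simp [h]
  rw [integral_congr_ae this, integral_indicator measurableSet_Ioo,
    Measure.restrict_restrict measurableSet_Ioo, inter_eq_left.2 (Ioo_subset_Ioo_right ha)]

end Indicators

/-! ### Existence of the elementary operators -/

section Elementary

variable {ω : Fin 2 → ℝ} {l : ℝ} {i k : Fin 2}

theorem setIntegral_indicator_lt {x : ℝ} (hx : x ∈ Ioo 0 l) (F : ℝ → ℂ) :
    ∫ t in Ioo 0 l, ({t : ℝ | t < x}.indicator (fun _ => Complex.I) t) * F t =
      Complex.I * ∫ t in (0 : ℝ)..x, F t := by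
  have hsub : Ioo 0 x ⊆ Ioo 0 l := Ioo_subset_Ioo_right hx.2.le
  have : ∀ t ∈ Ioo 0 l, ({t : ℝ | t < x}.indicator (fun _ => Complex.I) t) * F t =
      (Ioo 0 x).indicator (fun t => Complex.I * F t) t := fun t ht => by
    by_cases h : t < x
    · simp [indicator, ht.1, h]
    · simp [indicator, h]
  rw [setIntegral_congr_fun measurableSet_Ioo this, integral_indicator measurableSet_Ioo,
    Measure.restrict_restrict measurableSet_Ioo, inter_eq_left.2 hsub,
    integral_const_mul, setIntegral_Ioo_eq hx.1.le]

theorem exists_isA (l : ℝ) : ∃ T, IsA l T := by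
  have hm : MeasurableSet {p : ℝ × ℝ | p.2 < p.1} := measurableSet_lt measurable_snd measurable_fst
  obtain ⟨T, hT⟩ := exists_hilbertSchmidt (μ := volume.restrict (Ioo 0 l))
    (ν := volume.restrict (Ioo 0 l)) (K := {p : ℝ × ℝ | p.2 < p.1}.indicator fun _ => Complex.I)
    (MemLp.of_bound ((measurable_const.indicator hm).aestronglyMeasurable) 1
      (Filter.Eventually.of_forall fun p => by
        by_cases h : p ∈ {p : ℝ × ℝ | p.2 < p.1} <;> simp [h]))
  refine ⟨T, fun f => (hT f).trans ?_⟩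
  filter_upwards [ae_restrict_mem measurableSet_Ioo] with x hx
  exact setIntegral_indicator_lt hx _

theorem map_coord_box (h : i ≠ k) :
    (volume.restrict (box ω)).map (fun x => x i) =
      (ω k).toNNReal • volume.restrict (Ioo 0 (ω i)) := by
  rw [← (measurePreserving_pt_box h ω).map_eq,
    Measure.map_map (measurable_pi_apply i) (measurable_pt i)]
  have : (fun x : Fin 2 → ℝ => x i) ∘ (fun p : ℝ × ℝ => pt i p.1 p.2) = Prod.fst := by
    funext p
    exact pt_self _ _ _
  rw [this, Measure.map_fst_prod, Measure.restrict_apply_univ, Real.volume_Ioo, sub_zero]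
  rfl

theorem exists_isM2 (h : i ≠ k) (hω : ∀ i, 0 < ω i) : ∃ T, IsM2 ω k i T := by
  obtain ⟨T, hT⟩ := exists_integralOperator_of_bounded (μ := volume.restrict (Ioo 0 (ω i)))
    (ν := volume.restrict (Ioo 0 (ω k))) (ξ := volume.restrict (box ω)) (K := fun _ => 1)
    aestronglyMeasurable_const (B := 1) (fun _ => by simp) (measurable_pt i) (c := 1)
    (by rw [(measurePreserving_pt_box h ω).map_eq, one_smul])
  refine ⟨T, fun f => (hT f).trans (Filter.Eventually.of_forall fun y => ?_)⟩
  simp only [one_mul]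
  exact setIntegral_Ioo_eq (hω k).le _

theorem exists_isM3 (h : i ≠ k) (hω : ∀ i, 0 < ω i) : ∃ T, IsM3 ω i T := by
  have hmap : ((volume.restrict (box ω)).prod (volume.restrict (Ioo 0 (ω k)))).map
      (fun p => p.1 i) = ((ω k).toNNReal * (ω k).toNNReal) • volume.restrict (Ioo 0 (ω i)) := by
    have : (fun p : (Fin 2 → ℝ) × ℝ => p.1 i) = (fun x => x i) ∘ Prod.fst := rfl
    rw [this, ← Measure.map_map (measurable_pi_apply i) measurable_fst, Measure.map_fst_prod,
      Measure.restrict_apply_univ, Real.volume_Ioo, sub_zero, Measure.map_smul,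
      map_coord_box h, mul_smul]
    rfl
  -- Averaging over a dummy variable `t ∈ (0, ω k)` presents composition with a coordinate as an
  -- integral operator with a bounded kernel.
  obtain ⟨T, hT⟩ := exists_integralOperator_of_bounded (μ := volume.restrict (box ω))
    (ν := volume.restrict (Ioo 0 (ω k))) (ξ := volume.restrict (Ioo 0 (ω i)))
    (K := fun _ => (ω k : ℂ)⁻¹) aestronglyMeasurable_const (B := ‖(ω k : ℂ)⁻¹‖₊) (fun _ => le_rfl)
    (τ := fun p => p.1 i) ((measurable_pi_apply i).comp measurable_fst) hmap
  refine ⟨T, fun f => (hT f).trans (Filter.Eventually.of_forall fun x => ?_)⟩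
  have h0 : (ω k : ℂ) ≠ 0 := by exact_mod_cast (hω k).ne'
  simp [(hω k).le, h0]

theorem exists_isK3 (hω : ∀ i, 0 < ω i) : ∃ T, IsK3 ω i k T := by
  obtain ⟨T, hT⟩ := exists_hilbertSchmidt (μ := volume.restrict (Ioo 0 (ω i)))
    (ν := volume.restrict (Ioo 0 (ω k))) (K := fun _ => 1) (memLp_const 1)
  refine ⟨T, fun f => (hT f).trans (Filter.Eventually.of_forall fun y => ?_)⟩
  simp only [one_mul]
  exact setIntegral_Ioo_eq (hω k).le _

/-- `(𝒜_k F)(x) = i ∫_0^{x_k} F dt_k` on `L²(Ω)`. -/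
def IsARect (ω : Fin 2 → ℝ) (k i : Fin 2) (T : L2Rect ω →L[ℂ] L2Rect ω) : Prop :=
  ∀ F : L2Rect ω, T F =ᵐ[volume.restrict (box ω)]
    fun x => Complex.I * ∫ t in (0 : ℝ)..x k, F (pt k t (x i))

theorem exists_isARect (h : i ≠ k) : ∃ T, IsARect ω k i T := by
  have hm : MeasurableSet {p : (Fin 2 → ℝ) × ℝ | p.2 < p.1 k} :=
    measurableSet_lt measurable_snd ((measurable_pi_apply k).comp measurable_fst)
  -- The map replaces `x k` by the integration variable; forgetting `x k` contributes the factor `ω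
  -- k`.
  have hmap : ((volume.restrict (box ω)).prod (volume.restrict (Ioo 0 (ω k)))).map
      (fun p => pt k p.2 (p.1 i)) = (ω k).toNNReal • volume.restrict (box ω) := by
    have : (fun p : (Fin 2 → ℝ) × ℝ => pt k p.2 (p.1 i)) =
        (fun q : ℝ × ℝ => pt i q.1 q.2) ∘ Prod.map (fun x => x i) id := by
      funext p
      exact pt_comm h.symm _ _
    rw [this, ← Measure.map_map (measurable_pt i)
      ((measurable_pi_apply i).prodMap measurable_id),
      ← Measure.map_prod_map _ _ (measurable_pi_apply i) measurable_id, Measure.map_id,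
      map_coord_box h, ENNReal.smul_def, Measure.prod_smul_left, Measure.map_smul,
      (measurePreserving_pt_box h ω).map_eq, ENNReal.smul_def]
  obtain ⟨T, hT⟩ := exists_integralOperator_of_bounded (μ := volume.restrict (box ω))
    (ν := volume.restrict (Ioo 0 (ω k))) (ξ := volume.restrict (box ω))
    (K := {p : (Fin 2 → ℝ) × ℝ | p.2 < p.1 k}.indicator fun _ => Complex.I)
    ((measurable_const.indicator hm).aestronglyMeasurable) (B := 1)
    (fun p => by
        by_cases h : p ∈ {p : (Fin 2 → ℝ) × ℝ | p.2 < p.1 k} <;> simp [h])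
    (τ := fun p => pt k p.2 (p.1 i)) (by fun_prop) hmap
  refine ⟨T, fun f => (hT f).trans ?_⟩
  filter_upwards [ae_restrict_mem (measurableSet_box ω)] with x hx
  have hx := ((mem_box h).1 hx).2
  exact setIntegral_indicator_lt hx _

/-- The operator `𝒜_k` on `L²(Ω)`. -/
def ARect (ω : Fin 2 → ℝ) (k i : Fin 2) : L2Rect ω →L[ℂ] L2Rect ω :=
  Classical.epsilon (IsARect ω k i)

theorem isARect_ARect (h : i ≠ k) : IsARect ω k i (ARect ω k i) :=
  Classical.epsilon_spec (exists_isARect h)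

theorem isA_opA (l : ℝ) : IsA l (opA l) := Classical.epsilon_spec (exists_isA l)

theorem isM2_M2 (h : i ≠ k) (hω : ∀ i, 0 < ω i) : IsM2 ω k i (M2 ω k i) :=
  Classical.epsilon_spec (exists_isM2 h hω)

theorem isM3_M3 (h : i ≠ k) (hω : ∀ i, 0 < ω i) : IsM3 ω i (M3 ω i) :=
  Classical.epsilon_spec (exists_isM3 h hω)

theorem isK3_K3 (hω : ∀ i, 0 < ω i) : IsK3 ω i k (K3 ω i k) :=
  Classical.epsilon_spec (exists_isK3 hω)

theorem clm_ext_ae {E : Type*} [NormedAddCommGroup E] [NormedSpace ℂ E] {α : Type*}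
    [MeasurableSpace α] {μ : Measure α} {T T' : E →L[ℂ] Lp ℂ 2 μ} {φ : E → α → ℂ}
    (h : ∀ f, T f =ᵐ[μ] φ f) (h' : ∀ f, T' f =ᵐ[μ] φ f) : T = T' :=
  ContinuousLinearMap.ext fun f => Lp.ext ((h f).trans (h' f).symm)

end Elementary

/-! ### The elementary operators on indicator functions -/

section ChiActions

variable {ω : Fin 2 → ℝ} {l : ℝ} {i k : Fin 2}

theorem pt_mem_Icc (h : i ≠ k) {u v : ℝ} (hu : u ∈ Icc 0 (ω i)) (hv : v ∈ Icc 0 (ω k)) :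
    pt i u v ∈ Icc 0 ω := by
  constructor
  · rw [Pi.le_def, forall_fin_two_of_ne h, pt_self, pt_other h]
    exact ⟨hu.1, hv.1⟩
  · rw [Pi.le_def, forall_fin_two_of_ne h, pt_self, pt_other h]
    exact ⟨hu.2, hv.2⟩

theorem mem_Icc_coord {b : Fin 2 → ℝ} (hb : b ∈ Icc 0 ω) (i : Fin 2) : b i ∈ Icc 0 (ω i) :=
  ⟨hb.1 i, hb.2 i⟩

theorem mem_Icc_full (hω : ∀ i, 0 < ω i) (i : Fin 2) : ω i ∈ Icc 0 (ω i) := ⟨(hω i).le, le_rfl⟩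

theorem quasiMeasurePreserving_coord (h : i ≠ k) :
    Measure.QuasiMeasurePreserving (fun x : Fin 2 → ℝ => x i) (volume.restrict (box ω))
      (volume.restrict (Ioo 0 (ω i))) :=
  ⟨measurable_pi_apply i, by rw [map_coord_box h]; exact Measure.smul_absolutelyContinuous⟩

theorem M3_chi1 (h : i ≠ k) (hω : ∀ i, 0 < ω i) (b : ℝ) :
    M3 ω i (chi1 (ω i) b) = chi ω (pt i b (ω k)) := by
  refine Lp.ext (((isM3_M3 h hω _).trans ?_).trans (chi_ae _ _).symm)
  filter_upwards [(quasiMeasurePreserving_coord (ω := ω) h).ae (chi1_ae (ω i) b),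
    ae_restrict_mem (measurableSet_box ω)] with x hx hxb
  rw [hx]
  have hxb := ((mem_box h).1 hxb).2
  have : x ∈ box (pt i b (ω k)) ↔ x i ∈ Ioo 0 b := by
    rw [mem_box h, pt_self, pt_other h]
    exact and_iff_left hxb
  by_cases hc : x i ∈ Ioo 0 b
  · rw [indicator_of_mem hc, indicator_of_mem (this.2 hc)]
  · rw [indicator_of_notMem hc, indicator_of_notMem (mt this.1 hc)]

theorem inner_chi1_M2 (h : i ≠ k) (hω : ∀ i, 0 < ω i) {b : ℝ} (hb : b ∈ Icc 0 (ω i))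
    (F : L2Rect ω) : ⟪chi1 (ω i) b, M2 ω k i F⟫_ℂ = ⟪chi ω (pt i b (ω k)), F⟫_ℂ := by
  have hbox := pt_mem_Icc h hb (mem_Icc_full hω k)
  rw [inner_chi1 hb.2, inner_chi hbox.2, integral_box_eq h
    ((integrableOn_L2Rect F).mono_set (box_subset_box hbox.2)), pt_self, pt_other h]
  have hM : ∀ᵐ y ∂volume.restrict (Ioo 0 b),
      M2 ω k i F y = ∫ t in (0 : ℝ)..ω k, F (pt i y t) :=
    ae_restrict_of_ae_restrict_of_subset (Ioo_subset_Ioo_right hb.2) (isM2_M2 h hω F)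
  rw [integral_congr_ae hM]
  simp only [setIntegral_Ioo_eq (hω k).le]

theorem adjoint_M3 (h : i ≠ k) (hω : ∀ i, 0 < ω i) :
    ContinuousLinearMap.adjoint (M3 ω i) = M2 ω k i := by
  refine ContinuousLinearMap.ext fun F => (isTotal_chi1 (hω i)).ext fun b => ?_
  rw [ContinuousLinearMap.adjoint_inner_right, M3_chi1 h hω, inner_chi1_M2 h hω b.2]

theorem inner_chi_chi {a b : Fin 2 → ℝ} (h : i ≠ k) (ha : a ∈ Icc 0 ω) (hb : b ∈ Icc 0 ω) :
    ⟪chi ω b, chi ω a⟫_ℂ = ((min (b i) (a i) * min (b k) (a k) : ℝ) : ℂ) := by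
  rw [chi, chi, L2.inner_indicatorConstLp_indicatorConstLp]
  have hinter : box b ∩ box a = box fun j => min (b j) (a j) := by
    simp only [box, ← pi_inter_distrib, Ioo_inter_Ioo, max_self]
  rw [hinter, measureReal_restrict_apply (measurableSet_box _), inter_eq_left.2
    (box_subset_box fun j => (min_le_left _ _).trans (hb.2 j)), measureReal_def, box,
    Real.volume_pi_Ioo]
  have hnn : ∀ j, 0 ≤ min (b j) (a j) := fun j => le_min (hb.1 j) (ha.1 j)
  have hp : ∏ j, ENNReal.ofReal (min (b j) (a j) - 0) =
      ENNReal.ofReal (min (b i) (a i)) * ENNReal.ofReal (min (b k) (a k)) := by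
    simp only [sub_zero]
    fin_cases i <;> fin_cases k <;> simp_all [mul_comm]
  rw [hp, ENNReal.toReal_mul, ENNReal.toReal_ofReal (hnn i), ENNReal.toReal_ofReal (hnn k)]
  simp

theorem inner_chi1_chi1 {a b : ℝ} (ha : a ∈ Icc 0 l) (hb : b ∈ Icc 0 l) :
    ⟪chi1 l b, chi1 l a⟫_ℂ = ((min b a : ℝ) : ℂ) := by
  rw [chi1, chi1, L2.inner_indicatorConstLp_indicatorConstLp, Ioo_inter_Ioo, max_self,
    measureReal_restrict_apply measurableSet_Ioo, inter_eq_left.2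
    (Ioo_subset_Ioo_right ((min_le_left _ _).trans hb.2)), measureReal_def, Real.volume_Ioo,
    sub_zero, ENNReal.toReal_ofReal (le_min hb.1 ha.1)]
  simp

theorem M2_chi (h : i ≠ k) (hω : ∀ i, 0 < ω i) {a : Fin 2 → ℝ} (ha : a ∈ Icc 0 ω) :
    M2 ω k i (chi ω a) = (a k : ℂ) • chi1 (ω i) (a i) := by
  refine (isTotal_chi1 (hω i)).ext fun b => ?_
  rw [inner_chi1_M2 h hω b.2, inner_chi_chi h ha (pt_mem_Icc h b.2 (mem_Icc_full hω k)),
    inner_smul_right, inner_chi1_chi1 (mem_Icc_coord ha i) b.2, pt_self, pt_other h,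
    min_eq_right (ha.2 k)]
  push_cast
  ring

theorem inner_chi1_K3 (hω : ∀ i, 0 < ω i) {b : ℝ} (hb : b ∈ Icc 0 (ω i)) (f : L2 (ω k)) :
    ⟪chi1 (ω i) b, K3 ω i k f⟫_ℂ = b * ⟪chi1 (ω k) (ω k), f⟫_ℂ := by
  rw [inner_chi1 hb.2, inner_chi1_eq (hω k).le le_rfl]
  have : ∀ᵐ x ∂volume.restrict (Ioo 0 b), K3 ω i k f x = ∫ t in (0 : ℝ)..ω k, f t :=
    ae_restrict_of_ae_restrict_of_subset (Ioo_subset_Ioo_right hb.2) (isK3_K3 hω f)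
  rw [integral_congr_ae this, setIntegral_const, measureReal_def, Real.volume_Ioo, sub_zero,
    ENNReal.toReal_ofReal hb.1]
  simp

theorem K3_eq (h : i ≠ k) (hω : ∀ i, 0 < ω i) : K3 ω i k = M2 ω k i ∘L M3 ω k := by
  refine (isTotal_chi1 (hω k)).clm_ext₂ (isTotal_chi1 (hω i)) fun a b => ?_
  rw [inner_chi1_K3 hω b.2, inner_chi1_chi1 a.2 (mem_Icc_full hω k), ContinuousLinearMap.comp_apply,
    M3_chi1 h.symm hω, inner_chi1_M2 h hω b.2, inner_chi_chi h
    (pt_mem_Icc h.symm a.2 (mem_Icc_full hω i)) (pt_mem_Icc h b.2 (mem_Icc_full hω k)),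
    pt_self, pt_self, pt_other h, pt_other h.symm, min_eq_right a.2.2, min_eq_left b.2.2]
  push_cast
  ring

theorem inner_chi1_opA {b : ℝ} (hb : b ∈ Icc 0 l) (f : L2 l) :
    ⟪chi1 l b, opA l f⟫_ℂ = Complex.I * ∫ τ in (0 : ℝ)..b, ⟪chi1 l τ, f⟫_ℂ := by
  have hA : ∀ᵐ x ∂volume.restrict (Ioo 0 b), opA l f x = Complex.I * ∫ t in (0 : ℝ)..x, f t :=
    ae_restrict_of_ae_restrict_of_subset (Ioo_subset_Ioo_right hb.2) (isA_opA l f)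
  rw [inner_chi1 hb.2, integral_congr_ae hA, integral_const_mul, ← setIntegral_Ioo_eq hb.1]
  congr 1
  refine setIntegral_congr_fun measurableSet_Ioo fun x hx => ?_
  exact (inner_chi1_eq hx.1.le (hx.2.le.trans hb.2) f).symm

/-- Integration in `x_k` commutes with forming double primitives. Hence, tested against indicators,
`𝒜_k` becomes integration over the coordinate `k` of the corner. -/
theorem inner_chi_ARect (h : i ≠ k) {b : Fin 2 → ℝ} (hb : b ∈ Icc 0 ω) (F : L2Rect ω) :
    ⟪chi ω b, ARect ω k i F⟫_ℂ = Complex.I * ∫ τ in (0 : ℝ)..b k, ⟪chi ω (pt k τ (b i)), F⟫_ℂ := by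
  have hsub := box_subset_box hb.2
  have hA : ∀ᵐ x ∂volume.restrict (box b), ARect ω k i F x =
      Complex.I * ∫ t in (0 : ℝ)..x k, F (pt k t (x i)) :=
    ae_restrict_of_ae_restrict_of_subset hsub (isARect_ARect h F)
  have hint : IntegrableOn (fun x => Complex.I * ∫ t in (0 : ℝ)..x k, F (pt k t (x i))) (box b) :=
    ((integrableOn_L2Rect (ARect ω k i F)).mono_set hsub).congr hA
  rw [inner_chi hb.2, integral_congr_ae hA, integral_box_eq h.symm hint,
    ← intervalIntegral.integral_const_mul, ← setIntegral_Ioo_eq (hb.1 k)]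
  refine setIntegral_congr_fun measurableSet_Ioo fun u hu => ?_
  have hu' : u ∈ Icc 0 (ω k) := ⟨hu.1.le, hu.2.le.trans (hb.2 k)⟩
  simp only [pt_self, pt_other h.symm]
  rw [inner_chi_eq_prim (pt_mem_Icc h.symm hu' (mem_Icc_coord hb i)), prim_eq h (integrable_ext0 F),
    pt_self, pt_other h.symm, integral_const_mul, ← setIntegral_Ioo_eq (hb.1 i)]
  congr 1
  refine setIntegral_congr_fun measurableSet_Ioo fun v hv => ?_
  simp only [← setIntegral_Ioo_eq hu.1.le]
  refine setIntegral_congr_fun measurableSet_Ioo fun t ht => ?_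
  rw [pt_comm h v t, ext0_apply]
  rw [pt_mem_box h.symm]
  exact ⟨⟨ht.1, ht.2.trans_le hu'.2⟩, ⟨hv.1, hv.2.trans_le (hb.2 i)⟩⟩

theorem continuous_inner_chi1 (f : L2 l) : ContinuousOn (fun τ => ⟪chi1 l τ, f⟫_ℂ) (Icc 0 l) := by
  have hi : Integrable ((Ioo 0 l).indicator f) :=
    (integrable_indicator_iff measurableSet_Ioo).2 (integrableOn_L2 f)
  refine (intervalIntegral.continuous_primitive (fun a b => hi.intervalIntegrable) 0).continuousOn
    |>.congr fun τ hτ => ?_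
  change _ = ∫ x in (0 : ℝ)..τ, (Ioo 0 l).indicator f x
  rw [inner_chi1 hτ.2, ← setIntegral_Ioo_eq hτ.1]
  refine setIntegral_congr_fun measurableSet_Ioo fun x hx => ?_
  have hx' : x ∈ Ioo 0 l := ⟨hx.1, hx.2.trans_le hτ.2⟩
  exact (indicator_of_mem hx' _).symm

theorem continuousOn_inner_chi (h : i ≠ k) {c : ℝ} (hc : c ∈ Icc 0 (ω i)) (F : L2Rect ω) :
    ContinuousOn (fun τ => ⟪chi ω (pt k τ c), F⟫_ℂ) (Icc 0 (ω k)) := by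
  have hcont := continuous_prim_section h.symm (integrable_ext0 F) c
  exact hcont.continuousOn.congr fun τ hτ => inner_chi_eq_prim (pt_mem_Icc h.symm hτ hc) F

/-- Weak form of `𝒜_k^* χ_a = -i ∫_0^{a_k} χ dτ`, where the corner of `χ` has `k`-th coordinate `τ`.
The operator `T` is included so that no vector valued integral is needed when `𝒜_k^*` is followed by
`S`, `M_{2k}` or `M_{4k}`. -/
theorem inner_adjoint_ARect_chi {E : Type*} [NormedAddCommGroup E] [InnerProductSpace ℂ E]
    [CompleteSpace E] (h : i ≠ k) (T : L2Rect ω →L[ℂ] E) {a : Fin 2 → ℝ} (ha : a ∈ Icc 0 ω)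
    (y : E) : ⟪y, T (ContinuousLinearMap.adjoint (ARect ω k i) (chi ω a))⟫_ℂ =
      -Complex.I * ∫ τ in (0 : ℝ)..a k, ⟪y, T (chi ω (pt k τ (a i)))⟫_ℂ := by
  rw [← ContinuousLinearMap.adjoint_inner_left, ContinuousLinearMap.adjoint_inner_right,
    ← inner_conj_symm, inner_chi_ARect h ha, map_mul, Complex.conj_I,
    ← intervalIntegral.intervalIntegral_conj]
  simp only [inner_conj_symm, ContinuousLinearMap.adjoint_inner_left]

theorem eqOn_zero_of_integral {f : ℝ → ℂ} (hl : 0 < l) (hf : ContinuousOn f (Icc 0 l))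
    (h : ∀ b ∈ Icc 0 l, ∫ x in (0 : ℝ)..b, f x = 0) : EqOn f 0 (Icc 0 l) := by
  have h1 := ae_eq_zero_of_integral_Ioo hl (hf.integrableOn_Icc.mono_set Ioo_subset_Icc_self)
    fun b hb => by rw [setIntegral_Ioo_eq hb.1]; exact h b hb
  have h2 := Measure.eqOn_open_of_ae_eq h1 isOpen_Ioo (hf.mono Ioo_subset_Icc_self)
    continuousOn_const
  rw [← closure_Ioo hl.ne] at hf ⊢
  exact h2.of_subset_closure hf continuousOn_const subset_closure le_rfl

theorem opA_injective (hl : 0 < l) : Function.Injective (opA l) := by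
  rw [injective_iff_map_eq_zero]
  intro f hf
  refine isTotal_chi1 hl f fun b => ?_
  refine eqOn_zero_of_integral hl (continuous_inner_chi1 f) (fun c hc => ?_) b.2
  have := inner_chi1_opA hc f
  rw [hf, inner_zero_right] at this
  exact (mul_eq_zero.1 this.symm).resolve_left Complex.I_ne_zero

theorem ARect_injective (h : i ≠ k) (hω : ∀ i, 0 < ω i) : Function.Injective (ARect ω k i) := by
  rw [injective_iff_map_eq_zero]
  intro F hF
  refine isTotal_chi hω F fun b => ?_
  have hbi := mem_Icc_coord b.2 i
  have := eqOn_zero_of_integral (hω k) (continuousOn_inner_chi h hbi F) (fun c hc => ?_)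
    (mem_Icc_coord b.2 k)
  · simpa [pt_eta h.symm] using this
  · have := inner_chi_ARect h (pt_mem_Icc h.symm hc hbi) F
    rw [hF, inner_zero_right, pt_self, pt_other h.symm] at this
    exact (mul_eq_zero.1 this.symm).resolve_left Complex.I_ne_zero

end ChiActions

/-! ### Second differences -/

section SecondDifference

/-- The second difference `φ(b) - φ(b-a) - φ(0) + φ(-a)`. -/
def dd (b a : ℝ) (φ : ℝ → ℂ) : ℂ := φ b - φ (b - a) - φ 0 + φ (-a)

/-- After translation and reflection of the variable, the integrals of `φ` over `(0,b)`, `(-a,b-a)`,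
`(b-a,b)` and `(-a,0)` enter with signs `+,-,-,+` and cancel, leaving only the boundary terms. This
is why the commutator of `S` with `𝒜_k` reduces to operators through functions of one variable. -/
theorem integral_dd_add_integral_dd {φ : ℝ → ℂ} (hφ : Continuous φ) (h0 : φ 0 = 0) (a b : ℝ) :
    (∫ τ in (0 : ℝ)..b, dd τ a φ) + ∫ τ in (0 : ℝ)..a, dd b τ φ = a * φ b + b * φ (-a) := by
  have hi : ∀ c d, IntervalIntegrable φ volume c d := fun c d => hφ.intervalIntegrable _ _
  have h1 : ∫ τ in (0 : ℝ)..b, dd τ a φ =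
      (∫ τ in (0 : ℝ)..b, φ τ) - (∫ τ in -a..b - a, φ τ) + b * φ (-a) := by
    simp only [dd, h0, sub_zero]
    rw [intervalIntegral.integral_add, intervalIntegral.integral_sub,
      intervalIntegral.integral_comp_sub_right φ a]
    · simp
    all_goals exact Continuous.intervalIntegrable (by fun_prop) _ _
  have h2 : ∫ τ in (0 : ℝ)..a, dd b τ φ =
      a * φ b - (∫ τ in b - a..b, φ τ) + ∫ τ in -a..0, φ τ := by
    simp only [dd, h0, sub_zero]
    rw [intervalIntegral.integral_add, intervalIntegral.integral_sub,
      intervalIntegral.integral_comp_sub_left φ b, intervalIntegral.integral_comp_neg φ]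
    · simp
    all_goals exact Continuous.intervalIntegrable (by fun_prop) _ _
  have h3 := intervalIntegral.integral_add_adjacent_intervals (hi (-a) 0) (hi 0 b)
  have h4 := intervalIntegral.integral_add_adjacent_intervals (hi (-a) (b - a)) (hi (b - a) b)
  rw [h1, h2]
  linear_combination h3 - h4

end SecondDifference

/-! ### The convolution operator on indicator functions -/

section Convolution

variable {ω : Fin 2 → ℝ} {s : (Fin 2 → ℝ) → ℂ} {i k : Fin 2}

/-- A normalized function `s` on the whole plane. -/
structure IsSymbol (ω : Fin 2 → ℝ) (s : (Fin 2 → ℝ) → ℂ) : Prop where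
  measurable : Measurable s
  memLp : MemLp s 2 volume
  integrable : Integrable s
  normalized : IsNormalized ω s

/-- The normalization says exactly that the inner integral of the primitive vanishes. This allows
`M_{1k}` to be read off from the commutator by inserting `M_{3k}`. -/
theorem IsSymbol.prim_neg_right (hs : IsSymbol ω s) (h : i ≠ k) {u : ℝ} (hu : |u| ≤ ω i) :
    prim s (pt i u (-ω k)) = 0 := by
  rw [prim_eq h hs.integrable, pt_self, pt_other h]
  have hu' := abs_le.1 hu
  have hn := hs.normalized i k h
  have h0 : ∀ᵐ y ∂volume, y ∈ uIoc 0 u → ∫ w in (0 : ℝ)..-ω k, s (pt i y w) = 0 := by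
    rw [ae_restrict_iff' measurableSet_Ioo] at hn
    -- The half-open interval of integration may contain its endpoint `ω i`, where the normalization
    -- says nothing.
    have hne : ∀ᵐ y ∂(volume : Measure ℝ), y ≠ ω i := Measure.ae_ne volume _
    filter_upwards [hn, hne] with y hy hy0 hyu
    have hmem : y ∈ Ioo (-ω i) (ω i) := by
      rcases mem_uIoc.1 hyu with h1 | h1
      · exact ⟨by linarith [h1.1, abs_nonneg u], lt_of_le_of_ne (h1.2.trans hu'.2) hy0⟩
      · exact ⟨by linarith [h1.1], lt_of_le_of_ne (by linarith [h1.2, abs_nonneg u]) hy0⟩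
    have := intervalIntegral.integral_comp_neg (a := 0) (b := ω k) (fun w => s (pt i y w))
    rw [hy hmem, neg_zero, intervalIntegral.integral_symm] at this
    exact neg_eq_zero.1 this.symm
  rw [intervalIntegral.integral_congr_ae h0, intervalIntegral.integral_zero]

/-- The kernel is `s(x - t)` with its values at `x₁ = 0` and at `x₂ = 0` removed. Each of its four
translates of `s` integrates to a mixed difference of `prim s`, and the terms on the axes vanish. -/
theorem integral_box_kernel (hs : Integrable s) {a : Fin 2 → ℝ} (ha : 0 ≤ a) (x : Fin 2 → ℝ) :
    ∫ t in box a, kernel s x t =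
      dd (x 0) (a 0) fun u => dd (x 1) (a 1) fun v => prim s (pt 0 u v) := by
  have h01 : (0 : Fin 2) ≠ 1 := by decide
  have h : kernel s x = fun t => s (x - t) - s (pt 0 (x 0) 0 - t) - s (pt 0 0 (x 1) - t) +
      s (0 - t) := by
    funext t
    simp only [kernel, pt_sub _ _ _ t h01, zero_sub]
  have hi : ∀ y, IntegrableOn (fun t => s (y - t)) (box a) := fun y =>
    (hs.comp_sub_left y).integrableOn
  have h1 : ∀ y z, IntegrableOn (fun t => s (y - t) - s (z - t)) (box a) := fun y z =>
    (hi y).sub (hi z)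
  have h2 : ∀ y z w, IntegrableOn (fun t => s (y - t) - s (z - t) - s (w - t)) (box a) :=
    fun y z w => (h1 y z).sub (hi w)
  rw [h, integral_add (h2 _ _ _) (hi _), integral_sub (h1 _ _) (hi _), integral_sub (hi _) (hi _)]
  rw [integral_box_sub h01 hs ha, integral_box_sub h01 hs ha, integral_box_sub h01 hs ha,
    integral_box_sub h01 hs ha]
  simp only [pt_self, pt_other h01, dd, prim_pt_zero_left, prim_pt_zero_right h01, pt_eta h01,
    zero_sub, Pi.zero_apply, prim_zero_left 0 s (show (0 : Fin 2 → ℝ) 0 = 0 from rfl)]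
  ring

theorem dd_dd_comm (h : i ≠ k) (F : (Fin 2 → ℝ) → ℂ) (b a d c : ℝ) :
    (dd b a fun u => dd d c fun v => F (pt k u v)) =
      dd d c fun v => dd b a fun u => F (pt i v u) := by
  simp only [dd, pt_comm h]
  ring

theorem continuous_dd_prim (hs : Integrable s) (k : Fin 2) (b a : ℝ) :
    Continuous fun u => dd b a fun v => prim s (pt k u v) := by
  have := continuous_prim hs
  unfold dd
  fun_prop

/-- The matrix elements of a convolution operator on indicator functions. -/
theorem inner_chi_convolution (hω : ∀ i, 0 < ω i) (hs : Integrable s)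
    {S : L2Rect ω →L[ℂ] L2Rect ω} (hS : IsConvolution ω s S) (h : i ≠ k) {a b : Fin 2 → ℝ}
    (ha : a ∈ Icc 0 ω) (hb : b ∈ Icc 0 ω) :
    ⟪chi ω b, S (chi ω a)⟫_ℂ =
      dd (b k) (a k) fun u => dd (b i) (a i) fun v => prim s (pt k u v) := by
  have key : ⟪chi ω b, S (chi ω a)⟫_ℂ =
      dd (b 0) (a 0) fun u => dd (b 1) (a 1) fun v => prim s (pt 0 u v) := by
    have h1 : ∀ᵐ x ∂volume.restrict (box ω), prim (ext0 (S (chi ω a))) x =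
        dd (x 0) (a 0) fun u => dd (x 1) (a 1) fun v => prim s (pt 0 u v) := by
      filter_upwards [hS (chi ω a), ae_restrict_mem (measurableSet_box ω)] with x hx hxb
      have hxI : x ∈ Icc 0 ω := ⟨fun j => (hxb j trivial).1.le, fun j => (hxb j trivial).2.le⟩
      rw [← inner_chi_eq_prim hxI, inner_chi hxI.2, hx, setIntegral_mul_chi ha.2,
        integral_box_kernel hs ha.1]
    have hopen : IsOpen (box ω) := isOpen_set_pi finite_univ fun _ _ => isOpen_Ioo
    have hc := continuous_prim hs
    have hc1 := continuous_prim (integrable_ext0 (S (chi ω a)))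
    have hc2 : Continuous fun x : Fin 2 → ℝ =>
        dd (x 0) (a 0) fun u => dd (x 1) (a 1) fun v => prim s (pt 0 u v) := by
      unfold dd
      fun_prop
    -- The defining relation of `S` holds for almost every corner; both sides are continuous in the
    -- corner, so it reaches the closed rectangle.
    have h2 := (Measure.eqOn_open_of_ae_eq h1 hopen hc1.continuousOn hc2.continuousOn).closure
      hc1 hc2
    have hcl : b ∈ closure (box ω) := by
      rw [box, closure_pi_set]
      intro j _
      change b j ∈ closure (Ioo 0 (ω j))
      rw [closure_Ioo (hω j).ne]
      exact mem_Icc_coord hb j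
    rw [inner_chi_eq_prim hb]
    exact h2 hcl
  rw [key]
  fin_cases i <;> fin_cases k
  · exact absurd rfl h
  · exact (dd_dd_comm h (prim s) _ _ _ _).symm
  · rfl
  · exact absurd rfl h

/-- `X_k = -i (𝒜_k S - S 𝒜_k^*)`. -/
def commOp (S : L2Rect ω →L[ℂ] L2Rect ω) (k i : Fin 2) : L2Rect ω →L[ℂ] L2Rect ω :=
  -Complex.I • (ARect ω k i ∘L S - S ∘L ContinuousLinearMap.adjoint (ARect ω k i))

/-- With the differences in the variable `i` frozen into one function `φ` of the variable `k`, the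
terms `𝒜_k S` and `S 𝒜_k^*` give the two integrals in `integral_dd_add_integral_dd`. -/
theorem inner_chi_commOp (hω : ∀ i, 0 < ω i) (hs : Integrable s)
    {S : L2Rect ω →L[ℂ] L2Rect ω} (hS : IsConvolution ω s S) (h : i ≠ k) {a b : Fin 2 → ℝ}
    (ha : a ∈ Icc 0 ω) (hb : b ∈ Icc 0 ω) :
    ⟪chi ω b, commOp S k i (chi ω a)⟫_ℂ =
      a k * (dd (b i) (a i) fun v => prim s (pt k (b k) v)) +
        b k * (dd (b i) (a i) fun v => prim s (pt k (-a k) v)) := by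
  set φ : ℝ → ℂ := fun u => dd (b i) (a i) fun v => prim s (pt k u v) with hφ
  have hφc : Continuous φ := continuous_dd_prim hs k _ _
  have hφ0 : φ 0 = 0 := by simp [hφ, dd, prim_pt_zero_left]
  have hbi := mem_Icc_coord hb
  have hai := mem_Icc_coord ha
  have e1 : ⟪chi ω b, ARect ω k i (S (chi ω a))⟫_ℂ =
      Complex.I * ∫ τ in (0 : ℝ)..b k, dd τ (a k) φ := by
    rw [inner_chi_ARect h hb]
    congr 1
    refine intervalIntegral.integral_congr fun τ hτ => ?_
    rw [uIcc_of_le (show (0 : ℝ) ≤ b k from hb.1 k)] at hτ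
    simp only [inner_chi_convolution hω hs hS h ha
      (pt_mem_Icc h.symm ⟨hτ.1, hτ.2.trans (hb.2 k)⟩ (hbi i)), pt_self, pt_other h.symm]
    rfl
  have e2 : ⟪chi ω b, S (ContinuousLinearMap.adjoint (ARect ω k i) (chi ω a))⟫_ℂ =
      -Complex.I * ∫ τ in (0 : ℝ)..a k, dd (b k) τ φ := by
    rw [inner_adjoint_ARect_chi h S ha]
    congr 1
    refine intervalIntegral.integral_congr fun τ hτ => ?_
    rw [uIcc_of_le (show (0 : ℝ) ≤ a k from ha.1 k)] at hτ
    simp only [inner_chi_convolution hω hs hS h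
      (pt_mem_Icc h.symm ⟨hτ.1, hτ.2.trans (ha.2 k)⟩ (hai i)) hb, pt_self, pt_other h.symm]
    rfl
  rw [commOp, smul_apply, sub_apply,
    ContinuousLinearMap.comp_apply, ContinuousLinearMap.comp_apply, inner_smul_right,
    inner_sub_right, e1, e2, ← integral_dd_add_integral_dd hφc hφ0]
  linear_combination (-(∫ τ in (0 : ℝ)..b k, dd τ (a k) φ) - ∫ τ in (0 : ℝ)..a k, dd (b k) τ φ) *
    Complex.I_mul_I

theorem IsSymbol.dd_prim_neg_left (hs : IsSymbol ω s) (h : i ≠ k) {a b : ℝ} (ha : a ∈ Icc 0 (ω i))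
    (hb : b ∈ Icc 0 (ω i)) : (dd b a fun v => prim s (pt k (-ω k) v)) = 0 := by
  have hi : 0 ≤ ω i := ha.1.trans ha.2
  simp only [dd, pt_comm h.symm]
  rw [hs.prim_neg_right h, hs.prim_neg_right h, hs.prim_neg_right h, hs.prim_neg_right h]
  · ring
  all_goals rw [abs_le]; constructor <;> linarith [ha.1, ha.2, hb.1, hb.2]

/-- The operator `M_{1k}` in terms of `S`. -/
def opM1 (S : L2Rect ω →L[ℂ] L2Rect ω) (k i : Fin 2) : L2 (ω i) →L[ℂ] L2Rect ω :=
  (ω k : ℂ)⁻¹ • (commOp S k i ∘L M3 ω i)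

/-- The operator `M_{4k}` in terms of `S`. -/
def opM4 (S : L2Rect ω →L[ℂ] L2Rect ω) (k i : Fin 2) : L2Rect ω →L[ℂ] L2 (ω i) :=
  (ω k : ℂ)⁻¹ • (M2 ω k i ∘L (commOp S k i - opM1 S k i ∘L M2 ω k i))

/-- `M_{3k}` produces a rectangle with `a_k = ω_k`. There the second term of the commutator is zero
by the normalization, and the first carries the factor `ω_k`. -/
theorem inner_chi_opM1 (hω : ∀ i, 0 < ω i) (hs : IsSymbol ω s)
    {S : L2Rect ω →L[ℂ] L2Rect ω} (hS : IsConvolution ω s S) (h : i ≠ k) {a : ℝ}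
    {b : Fin 2 → ℝ} (ha : a ∈ Icc 0 (ω i)) (hb : b ∈ Icc 0 ω) :
    ⟪chi ω b, opM1 S k i (chi1 (ω i) a)⟫_ℂ = dd (b i) a fun v => prim s (pt k (b k) v) := by
  have h0 : (ω k : ℂ) ≠ 0 := by exact_mod_cast (hω k).ne'
  rw [opM1, smul_apply, ContinuousLinearMap.comp_apply, M3_chi1 h hω,
    inner_smul_right, inner_chi_commOp hω hs.integrable hS h
    (pt_mem_Icc h ha (mem_Icc_full hω k)) hb, pt_self, pt_other h,
    hs.dd_prim_neg_left h ha (mem_Icc_coord hb i)]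
  field_simp
  ring

/-- `M_{2k}` tests with `b_k = ω_k`. Subtracting `M_{1k} M_{2k}` removes the first term of the
commutator, and the second carries the factor `ω_k`. -/
theorem inner_chi1_opM4 (hω : ∀ i, 0 < ω i) (hs : IsSymbol ω s)
    {S : L2Rect ω →L[ℂ] L2Rect ω} (hS : IsConvolution ω s S) (h : i ≠ k) {a : Fin 2 → ℝ}
    {b : ℝ} (ha : a ∈ Icc 0 ω) (hb : b ∈ Icc 0 (ω i)) :
    ⟪chi1 (ω i) b, opM4 S k i (chi ω a)⟫_ℂ = dd b (a i) fun v => prim s (pt k (-a k) v) := by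
  have h0 : (ω k : ℂ) ≠ 0 := by exact_mod_cast (hω k).ne'
  have hb' := pt_mem_Icc h hb (mem_Icc_full hω k)
  rw [opM4, smul_apply, ContinuousLinearMap.comp_apply,
    sub_apply, ContinuousLinearMap.comp_apply, M2_chi h hω ha, map_smul,
    inner_smul_right, inner_chi1_M2 h hω hb, inner_sub_right, inner_smul_right,
    inner_chi_commOp hω hs.integrable hS h ha hb',
    inner_chi_opM1 hω hs hS h (mem_Icc_coord ha i) hb', pt_self, pt_other h]
  field_simp
  ring

/-- The operator identity for convolution operators on the rectangle. -/
theorem commOp_eq (hω : ∀ i, 0 < ω i) (hs : IsSymbol ω s)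
    {S : L2Rect ω →L[ℂ] L2Rect ω} (hS : IsConvolution ω s S) (h : i ≠ k) :
    commOp S k i = opM1 S k i ∘L M2 ω k i + M3 ω i ∘L opM4 S k i := by
  refine (isTotal_chi hω).clm_ext₂ (isTotal_chi hω) fun a b => ?_
  rw [inner_chi_commOp hω hs.integrable hS h a.2 b.2, add_apply,
    ContinuousLinearMap.comp_apply, ContinuousLinearMap.comp_apply, inner_add_right,
    M2_chi h hω a.2, map_smul, inner_smul_right,
    inner_chi_opM1 hω hs hS h (mem_Icc_coord a.2 i) b.2,
    ← ContinuousLinearMap.adjoint_inner_left, adjoint_M3 h hω, M2_chi h hω b.2, inner_smul_left,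
    inner_chi1_opM4 hω hs hS h a.2 (mem_Icc_coord b.2 i), Complex.conj_ofReal]

end Convolution

/-! ### Existence and uniqueness of the operators defined by `s` -/

section WellDefined

variable {ω : Fin 2 → ℝ} {s : (Fin 2 → ℝ) → ℂ} {i k : Fin 2} {l : ℝ}

/-- The skew product `(y, z) ↦ (y, Ψ(y, z))` preserves measure. With translations for `Ψ(y, ·)`,
kernels such as `s(x - t)` are thus Hilbert–Schmidt when one variable is restricted to a set of
finite measure. -/
theorem memLp_comp_of_measurePreserving {Y Z W : Type*} [MeasurableSpace Y] [MeasurableSpace Z]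
    [MeasurableSpace W] {ν : Measure Y} [IsFiniteMeasure ν] {ξ : Measure Z} [SFinite ξ]
    {η : Measure W} [SFinite η] {s : W → ℂ} (hs : MemLp s 2 η) {Ψ : Y × Z → W}
    (hΨ : Measurable Ψ) (h : ∀ y, MeasurePreserving (fun z => Ψ (y, z)) ξ η) :
    MemLp (fun p => s (Ψ p)) 2 (ν.prod ξ) :=
  (hs.comp_snd ν).comp_measurePreserving ((MeasurePreserving.id ν).skew_product
    (g := fun y z => Ψ (y, z)) hΨ (Filter.Eventually.of_forall fun y => (h y).map_eq))

theorem inner_chi_hilbertSchmidt {K : (Fin 2 → ℝ) × ℝ → ℂ}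
    (hK : MemLp K 2 ((volume.restrict (box ω)).prod (volume.restrict (Ioo 0 l))))
    {T : L2 l →L[ℂ] L2Rect ω}
    (hT : ∀ f, T f =ᵐ[volume.restrict (box ω)] fun x => ∫ t in Ioo 0 l, K (x, t) * f t)
    {b : Fin 2 → ℝ} (hb : b ≤ ω) {a : ℝ} (ha : a ≤ l) :
    ⟪chi ω b, T (chi1 l a)⟫_ℂ = ∫ t in Ioo 0 a, ∫ x in box b, K (x, t) := by
  have hsub := box_subset_box hb
  rw [inner_chi hb, integral_congr_ae (ae_restrict_of_ae_restrict_of_subset hsub (hT _))]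
  simp only [setIntegral_mul_chi1 ha]
  refine integral_integral_swap (f := fun x t => K (x, t)) ?_
  refine (hK.integrable one_le_two).mono_measure ?_
  rw [Measure.prod_restrict, Measure.prod_restrict]
  exact Measure.restrict_mono (prod_mono hsub (Ioo_subset_Ioo_right ha)) le_rfl

theorem inner_chi1_integralOperator {K : ℝ → (Fin 2 → ℝ) → ℂ} {T : L2Rect ω →L[ℂ] L2 l}
    (hT : ∀ f, T f =ᵐ[volume.restrict (Ioo 0 l)] fun y => ∫ t in box ω, K y t * f t)
    {a : Fin 2 → ℝ} (ha : a ≤ ω) {b : ℝ} (hb : b ≤ l) :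
    ⟪chi1 l b, T (chi ω a)⟫_ℂ = ∫ y in Ioo 0 b, ∫ t in box a, K y t := by
  rw [inner_chi1 hb,
    integral_congr_ae (ae_restrict_of_ae_restrict_of_subset (Ioo_subset_Ioo_right hb) (hT _))]
  simp only [setIntegral_mul_chi ha]

theorem exists_isK1 (hω : ∀ i, 0 < ω i) (hs : IsSymbol ω s) (h : i ≠ k) :
    ∃ T, IsK1 ω s i k T := by
  have hmp : MeasurePreserving (fun p : ℝ × ℝ => pt i p.1 (-p.2)) (volume.prod volume) volume :=
    (measurePreserving_pt h).comp
      ((MeasurePreserving.id volume).prod (Measure.measurePreserving_neg (volume : Measure ℝ)))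
  have hK : MemLp (fun p : ℝ × ℝ => -s (pt i p.1 (-p.2))) 2
      ((volume.restrict (Ioo 0 (ω i))).prod (volume.restrict (Ioo 0 (ω k)))) := by
    rw [Measure.prod_restrict]
    exact (hs.memLp.comp_measurePreserving hmp).neg.restrict _
  obtain ⟨T, hT⟩ := exists_hilbertSchmidt hK
  refine ⟨T, fun f => (hT f).trans (Filter.Eventually.of_forall fun y => ?_)⟩
  simp only [neg_mul, integral_neg]
  rw [setIntegral_Ioo_eq (hω k).le]

theorem isK1_K1 (hω : ∀ i, 0 < ω i) (hs : IsSymbol ω s) (h : i ≠ k) : IsK1 ω s i k (K1 ω s i k) :=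
  Classical.epsilon_spec (exists_isK1 hω hs h)

theorem inner_chi1_K1 (hω : ∀ i, 0 < ω i) (hs : IsSymbol ω s) (h : i ≠ k) {a b : ℝ}
    (ha : a ∈ Icc 0 (ω k)) (hb : b ∈ Icc 0 (ω i)) :
    ⟪chi1 (ω i) b, K1 ω s i k (chi1 (ω k) a)⟫_ℂ = prim s (pt i b (-a)) := by
  have hT := ae_restrict_of_ae_restrict_of_subset (Ioo_subset_Ioo_right hb.2)
    (isK1_K1 hω hs h (chi1 (ω k) a))
  rw [inner_chi1 hb.2, integral_congr_ae hT, setIntegral_Ioo_eq hb.1, prim_eq h hs.integrable]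
  simp only [pt_self, pt_other h]
  refine intervalIntegral.integral_congr fun y _ => ?_
  rw [← setIntegral_Ioo_eq (hω k).le, setIntegral_mul_chi1 ha.2 fun t => s (pt i y (-t)),
    setIntegral_Ioo_eq ha.1, intervalIntegral.integral_comp_neg (fun w => s (pt i y w)), neg_zero,
    ← intervalIntegral.integral_symm]

/-- The convolution in one variable. -/
theorem exists_conv1 (hs : IsSymbol ω s) (h : i ≠ k) :
    ∃ T : L2 (ω i) →L[ℂ] L2Rect ω, (∀ f, T f =ᵐ[volume.restrict (box ω)]
        fun x => ∫ t in Ioo 0 (ω i), s (pt i (x i - t) (x k)) * f t) ∧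
      ∀ b ∈ Icc 0 ω, ∀ a ∈ Icc 0 (ω i), ⟪chi ω b, T (chi1 (ω i) a)⟫_ℂ =
        ∫ t in (0 : ℝ)..a, (prim s (pt i (b i - t) (b k)) - prim s (pt i (-t) (b k))) := by
  have hmp : ∀ t : ℝ, MeasurePreserving (fun x : Fin 2 → ℝ => pt i (x i - t) (x k))
      volume volume := fun t => by
    have := measurePreserving_sub_right (volume : Measure (Fin 2 → ℝ)) (pt i t 0)
    convert this using 2 with x
    exact ext_of_ne h (by simp [pt_self]) (by simp [pt_other h])
  have h1 : MemLp (fun p : ℝ × (Fin 2 → ℝ) => s (pt i (p.2 i - p.1) (p.2 k))) 2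
      ((volume.restrict (Ioo 0 (ω i))).prod volume) :=
    memLp_comp_of_measurePreserving hs.memLp (by fun_prop) hmp
  have hK : MemLp (fun p : (Fin 2 → ℝ) × ℝ => s (pt i (p.1 i - p.2) (p.1 k))) 2
      ((volume.restrict (box ω)).prod (volume.restrict (Ioo 0 (ω i)))) := by
    refine (h1.comp_measurePreserving Measure.measurePreserving_swap).mono_measure ?_
    exact Measure.prod_mono Measure.restrict_le_self le_rfl
  obtain ⟨T, hT⟩ := exists_hilbertSchmidt hK
  refine ⟨T, hT, fun b hb a ha => ?_⟩
  rw [inner_chi_hilbertSchmidt hK hT hb.2 ha.2, setIntegral_Ioo_eq ha.1]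
  refine intervalIntegral.integral_congr fun t _ => ?_
  have hint : IntegrableOn (fun x : Fin 2 → ℝ => s (pt i (x i - t) (x k))) (box b) :=
    ((hmp t).integrable_comp_of_integrable hs.integrable).integrableOn
  simp only
  rw [integral_box_eq_intervalIntegral h hb.1 hint, prim_sub_prim h hs.integrable]
  simp only [pt_self, pt_other h]
  rw [intervalIntegral.integral_comp_sub_right
    (fun u => ∫ w in (0 : ℝ)..b k, s (pt i u w)) t, zero_sub]

theorem integral_dd_left {φ : ℝ → ℂ} (hφ : Continuous φ) (h0 : φ 0 = 0) (a b : ℝ) :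
    ∫ τ in (0 : ℝ)..b, dd τ a φ =
      (∫ t in (0 : ℝ)..a, (φ (b - t) - φ (-t))) + b * φ (-a) := by
  have hi : ∀ c d, IntervalIntegrable φ volume c d := fun c d => hφ.intervalIntegrable _ _
  have h1 : ∫ τ in (0 : ℝ)..b, dd τ a φ =
      (∫ τ in (0 : ℝ)..b, φ τ) - (∫ τ in -a..b - a, φ τ) + b * φ (-a) := by
    simp only [dd, h0, sub_zero]
    rw [intervalIntegral.integral_add, intervalIntegral.integral_sub,
      intervalIntegral.integral_comp_sub_right φ a]
    · simp
    all_goals exact Continuous.intervalIntegrable (by fun_prop) _ _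
  rw [h1, intervalIntegral.integral_sub, intervalIntegral.integral_comp_sub_left φ b,
    intervalIntegral.integral_comp_neg φ]
  · have h3 := intervalIntegral.integral_add_adjacent_intervals (hi (-a) 0) (hi 0 b)
    have h4 := intervalIntegral.integral_add_adjacent_intervals (hi (-a) (b - a)) (hi (b - a) b)
    simp only [sub_zero, neg_zero]
    linear_combination h3 - h4
  all_goals exact Continuous.intervalIntegrable (by fun_prop) _ _

/-- The primitive of `M_{1k}`. -/
theorem exists_ARect_opM1 (hω : ∀ i, 0 < ω i) (hs : IsSymbol ω s)
    {S : L2Rect ω →L[ℂ] L2Rect ω} (hS : IsConvolution ω s S) (h : i ≠ k) :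
    ∃ R : L2 (ω i) →L[ℂ] L2Rect ω, (∀ f, R f =ᵐ[volume.restrict (box ω)] fun x =>
        (∫ t in (0 : ℝ)..ω i, s (pt i (x i - t) (x k)) * f t) -
          ∫ t in (0 : ℝ)..ω i, s (pt i (0 - t) (x k)) * f t) ∧
      ARect ω i k ∘L opM1 S k i = Complex.I • R := by
  obtain ⟨T, hT, hTin⟩ := exists_conv1 hs h
  -- `T` is the convolution, and `K1`, with its built-in minus sign, subtracts its value at `x i =
  -- 0`.
  refine ⟨T + M3 ω k ∘L K1 ω s k i, fun f => ?_, ?_⟩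
  · have hK := (quasiMeasurePreserving_coord (ω := ω) h.symm).ae_eq_comp
      (isK1_K1 hω hs h.symm f)
    filter_upwards [hT f, isM3_M3 h.symm hω (K1 ω s k i f), hK,
      Lp.coeFn_add (T f) (M3 ω k (K1 ω s k i f))] with x h1 h2 h3 h4
    simp only [Function.comp_apply] at h3
    rw [add_apply, ContinuousLinearMap.comp_apply, h4, Pi.add_apply, h1, h2, h3,
      setIntegral_Ioo_eq (hω i).le, ← sub_eq_add_neg]
    simp only [zero_sub, pt_comm h.symm]
  · refine (isTotal_chi1 (hω i)).clm_ext₂ (isTotal_chi hω) fun a b => ?_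
    have hbk := mem_Icc_coord b.2 k
    have hbi := mem_Icc_coord b.2 i
    have hφ : Continuous fun v => prim s (pt k (b.1 k) v) := by
      have := continuous_prim hs.integrable
      fun_prop
    have e1 : ∫ τ in (0 : ℝ)..b.1 i, ⟪chi ω (pt i τ (b.1 k)), opM1 S k i (chi1 (ω i) a)⟫_ℂ =
        ∫ τ in (0 : ℝ)..b.1 i, dd τ a.1 fun v => prim s (pt k (b.1 k) v) := by
      refine intervalIntegral.integral_congr fun τ hτ => ?_
      rw [uIcc_of_le hbi.1] at hτ
      rw [inner_chi_opM1 hω hs hS h a.2 (pt_mem_Icc h ⟨hτ.1, hτ.2.trans hbi.2⟩ hbk), pt_self,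
        pt_other h]
    rw [ContinuousLinearMap.comp_apply, inner_chi_ARect h.symm b.2, e1,
      integral_dd_left hφ (prim_pt_zero_right h.symm _ _), smul_apply, inner_smul_right,
      add_apply, inner_add_right, hTin _ b.2 _ a.2, ContinuousLinearMap.comp_apply,
      ← ContinuousLinearMap.adjoint_inner_left, adjoint_M3 h.symm hω, M2_chi h.symm hω b.2,
      inner_smul_left, inner_chi1_K1 hω hs h.symm a.2 hbk, Complex.conj_ofReal]
    simp only [pt_comm h]

/-- The defining formula prescribes the primitive in `x_i`, that is, `𝒜_i T` up to the factor `i`.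
Injectivity of `𝒜_i` then yields uniqueness. -/
theorem isM1_iff {R T : L2 (ω i) →L[ℂ] L2Rect ω} (h : i ≠ k)
    (hR : ∀ f, R f =ᵐ[volume.restrict (box ω)] fun x =>
        (∫ t in (0 : ℝ)..ω i, s (pt i (x i - t) (x k)) * f t) -
          ∫ t in (0 : ℝ)..ω i, s (pt i (0 - t) (x k)) * f t) :
    IsM1 ω s k i T ↔ ARect ω i k ∘L T = Complex.I • R := by
  constructor
  · intro hT
    refine ContinuousLinearMap.ext fun f => Lp.ext ?_
    filter_upwards [isARect_ARect h.symm (T f), hT f, hR f, Lp.coeFn_smul Complex.I (R f)]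
      with x h1 h2 h3 h4
    rw [ContinuousLinearMap.comp_apply, h1, h2, smul_apply, h4, Pi.smul_apply, h3, smul_eq_mul]
  · intro hT f
    have hTf : ARect ω i k (T f) = Complex.I • R f := congrArg (· f) hT
    filter_upwards [isARect_ARect h.symm (T f), hR f, Lp.coeFn_smul Complex.I (R f)]
      with x h1 h3 h4
    rw [hTf, h4, Pi.smul_apply, h3, smul_eq_mul] at h1
    exact (mul_left_cancel₀ Complex.I_ne_zero h1).symm

/-- The primitive of `M_{4k}`. -/
theorem exists_opA_opM4 (hω : ∀ i, 0 < ω i) (hs : IsSymbol ω s)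
    {S : L2Rect ω →L[ℂ] L2Rect ω} (hS : IsConvolution ω s S) (h : i ≠ k) :
    ∃ R : L2Rect ω →L[ℂ] L2 (ω i), (∀ f, R f =ᵐ[volume.restrict (Ioo 0 (ω i))] fun y =>
        -((∫ t in box ω, s (pt i (y - t i) (-t k)) * f t) -
          ∫ t in box ω, s (pt i (0 - t i) (-t k)) * f t)) ∧
      opA (ω i) ∘L opM4 S k i = Complex.I • R := by
  have hpt : ∀ (y : ℝ) (t : Fin 2 → ℝ), pt i (y - t i) (-t k) = pt i y 0 - t := fun y t =>
    ext_of_ne h (by simp [pt_self]) (by simp [pt_other h])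
  have hm : ∀ g : ℝ → ℝ, Measurable g →
      MemLp (fun p : ℝ × (Fin 2 → ℝ) => s (pt i (g p.1) 0 - p.2)) 2
        ((volume.restrict (Ioo 0 (ω i))).prod (volume.restrict (box ω))) := fun g hg =>
    (memLp_comp_of_measurePreserving (Ψ := fun p : ℝ × (Fin 2 → ℝ) => pt i (g p.1) 0 - p.2)
      hs.memLp (by fun_prop) fun y =>
        Measure.measurePreserving_sub_left volume (pt i (g y) 0)).mono_measure
      (Measure.prod_mono le_rfl Measure.restrict_le_self)
  obtain ⟨T, hT⟩ := exists_hilbertSchmidt (hm (fun y => y) measurable_id)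
  obtain ⟨T₀, hT₀⟩ := exists_hilbertSchmidt (hm (fun _ => 0) measurable_const)
  refine ⟨-(T - T₀), fun f => ?_, ?_⟩
  · filter_upwards [hT f, hT₀ f, Lp.coeFn_neg ((T - T₀) f), Lp.coeFn_sub (T f) (T₀ f)]
      with y h1 h2 h3 h4
    rw [neg_apply, h3, Pi.neg_apply, sub_apply, h4, Pi.sub_apply, h1, h2]
    simp only [hpt]
  · refine (isTotal_chi hω).clm_ext₂ (isTotal_chi1 (hω i)) fun a b => ?_
    have hak := mem_Icc_coord a.2 k
    have hai := mem_Icc_coord a.2 i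
    have e1 : ∫ τ in (0 : ℝ)..b.1, ⟪chi1 (ω i) τ, opM4 S k i (chi ω a)⟫_ℂ =
        ∫ τ in (0 : ℝ)..b.1, dd τ (a.1 i) fun v => prim s (pt k (-a.1 k) v) := by
      refine intervalIntegral.integral_congr fun τ hτ => ?_
      rw [uIcc_of_le b.2.1] at hτ
      exact inner_chi1_opM4 hω hs hS h a.2 ⟨hτ.1, hτ.2.trans b.2.2⟩
    have hφ := continuous_prim hs.integrable
    rw [ContinuousLinearMap.comp_apply, inner_chi1_opA b.2, e1, smul_apply, inner_smul_right,
      neg_apply, inner_neg_right, sub_apply, inner_sub_right,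
      inner_chi1_integralOperator (K := fun y t => s (pt i y 0 - t)) hT a.2.2 b.2.2,
      inner_chi1_integralOperator (K := fun _ t => s (pt i 0 0 - t)) hT₀ a.2.2 b.2.2,
      setIntegral_Ioo_eq b.2.1, setIntegral_Ioo_eq b.2.1]
    simp only [integral_box_sub h hs.integrable a.2.1, pt_self, pt_other h]
    rw [← intervalIntegral.integral_sub, ← intervalIntegral.integral_neg]
    · congr 1
      refine intervalIntegral.integral_congr fun τ _ => ?_
      simp only [dd, prim_pt_zero_right h, pt_comm h.symm, prim_pt_zero_left, zero_sub]
      ring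
    all_goals exact Continuous.intervalIntegrable (by fun_prop) _ _

theorem isM4_iff {R T : L2Rect ω →L[ℂ] L2 (ω i)}
    (hR : ∀ f, R f =ᵐ[volume.restrict (Ioo 0 (ω i))] fun y =>
        -((∫ t in box ω, s (pt i (y - t i) (-t k)) * f t) -
          ∫ t in box ω, s (pt i (0 - t i) (-t k)) * f t)) :
    IsM4 ω s k i T ↔ opA (ω i) ∘L T = Complex.I • R := by
  constructor
  · intro hT
    refine ContinuousLinearMap.ext fun f => Lp.ext ?_
    filter_upwards [isA_opA (ω i) (T f), hT f, hR f, Lp.coeFn_smul Complex.I (R f)]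
      with x h1 h2 h3 h4
    rw [ContinuousLinearMap.comp_apply, h1, h2, smul_apply, h4, Pi.smul_apply, h3, smul_eq_mul]
  · intro hT f
    have hTf : opA (ω i) (T f) = Complex.I • R f := congrArg (· f) hT
    filter_upwards [isA_opA (ω i) (T f), hR f, Lp.coeFn_smul Complex.I (R f)]
      with x h1 h3 h4
    rw [hTf, h4, Pi.smul_apply, h3, smul_eq_mul] at h1
    exact (mul_left_cancel₀ Complex.I_ne_zero h1).symm

theorem existsUnique_isM1 (hω : ∀ i, 0 < ω i) (hs : IsSymbol ω s)
    {S : L2Rect ω →L[ℂ] L2Rect ω} (hS : IsConvolution ω s S) (h : i ≠ k) :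
    IsM1 ω s k i (opM1 S k i) ∧ ∀ T, IsM1 ω s k i T → T = opM1 S k i := by
  obtain ⟨R, hR, hA⟩ := exists_ARect_opM1 hω hs hS h
  refine ⟨(isM1_iff h hR).2 hA, fun T hT => ContinuousLinearMap.ext fun f => ?_⟩
  exact ARect_injective h.symm hω (congrArg (· f) (((isM1_iff h hR).1 hT).trans hA.symm))

theorem existsUnique_isM4 (hω : ∀ i, 0 < ω i) (hs : IsSymbol ω s)
    {S : L2Rect ω →L[ℂ] L2Rect ω} (hS : IsConvolution ω s S) (h : i ≠ k) :
    IsM4 ω s k i (opM4 S k i) ∧ ∀ T, IsM4 ω s k i T → T = opM4 S k i := by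
  obtain ⟨R, hR, hA⟩ := exists_opA_opM4 hω hs hS h
  refine ⟨(isM4_iff hR).2 hA, fun T hT => ContinuousLinearMap.ext fun f => ?_⟩
  exact opA_injective (hω i) (congrArg (· f) (((isM4_iff hR).1 hT).trans hA.symm))

theorem M1_eq (hω : ∀ i, 0 < ω i) (hs : IsSymbol ω s)
    {S : L2Rect ω →L[ℂ] L2Rect ω} (hS : IsConvolution ω s S) (h : i ≠ k) :
    M1 ω s k i = opM1 S k i :=
  (existsUnique_isM1 hω hs hS h).2 _ (Classical.epsilon_spec ⟨_, (existsUnique_isM1 hω hs hS h).1⟩)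

theorem M4_eq (hω : ∀ i, 0 < ω i) (hs : IsSymbol ω s)
    {S : L2Rect ω →L[ℂ] L2Rect ω} (hS : IsConvolution ω s S) (h : i ≠ k) :
    M4 ω s k i = opM4 S k i :=
  (existsUnique_isM4 hω hs hS h).2 _ (Classical.epsilon_spec ⟨_, (existsUnique_isM4 hω hs hS h).1⟩)

theorem operatorsWellDefined (hω : ∀ i, 0 < ω i) (hs : IsSymbol ω s)
    {S : L2Rect ω →L[ℂ] L2Rect ω} (hS : IsConvolution ω s S) : OperatorsWellDefined ω s :=
  ⟨fun _ => ⟨_, isA_opA _, fun _ hT => clm_ext_ae hT (isA_opA _)⟩, fun _ _ h =>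
    ⟨⟨_, (existsUnique_isM1 hω hs hS h).1, (existsUnique_isM1 hω hs hS h).2⟩,
      ⟨_, isM2_M2 h hω, fun _ hT => clm_ext_ae hT (isM2_M2 h hω)⟩,
      ⟨_, isM3_M3 h hω, fun _ hT => clm_ext_ae hT (isM3_M3 h hω)⟩,
      ⟨_, (existsUnique_isM4 hω hs hS h).1, (existsUnique_isM4 hω hs hS h).2⟩,
      ⟨_, isK1_K1 hω hs h, fun _ hT => clm_ext_ae hT (isK1_K1 hω hs h)⟩,
      ⟨_, isK3_K3 hω, fun _ hT => clm_ext_ae hT (isK3_K3 hω)⟩⟩⟩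

end WellDefined

/-! ### The bilinear form of a measure preserving involution -/

section Reflection

variable {X : Type*} [MeasurableSpace X] {μ : Measure X} {r : X → X}

theorem memLp_conj_comp (hr : MeasurePreserving r μ μ) (F : Lp ℂ 2 μ) :
    MemLp (fun x => (starRingEnd ℂ) (F (r x))) 2 μ :=
  ((Lp.memLp F).comp_measurePreserving hr).star

/-- `F ↦ conj (F ∘ r)`. -/
def conjRefl (hr : MeasurePreserving r μ μ) (F : Lp ℂ 2 μ) : Lp ℂ 2 μ :=
  (memLp_conj_comp hr F).toLp _

variable (hr : MeasurePreserving r μ μ)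

theorem conjRefl_ae (F : Lp ℂ 2 μ) :
    conjRefl hr F =ᵐ[μ] fun x => (starRingEnd ℂ) (F (r x)) := MemLp.coeFn_toLp _

theorem conjRefl_add (F F' : Lp ℂ 2 μ) :
    conjRefl hr (F + F') = conjRefl hr F + conjRefl hr F' := by
  refine Lp.ext ?_
  filter_upwards [conjRefl_ae hr (F + F'), conjRefl_ae hr F, conjRefl_ae hr F',
    Lp.coeFn_add (conjRefl hr F) (conjRefl hr F'),
    hr.quasiMeasurePreserving.ae_eq_comp (Lp.coeFn_add F F')] with x h1 h2 h3 h4 h5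
  simp only [Function.comp_apply, Pi.add_apply] at h5
  rw [h1, h4, Pi.add_apply, h2, h3, h5, map_add]

theorem conjRefl_smul (c : ℂ) (F : Lp ℂ 2 μ) :
    conjRefl hr (c • F) = (starRingEnd ℂ) c • conjRefl hr F := by
  refine Lp.ext ?_
  filter_upwards [conjRefl_ae hr (c • F), conjRefl_ae hr F,
    Lp.coeFn_smul ((starRingEnd ℂ) c) (conjRefl hr F),
    hr.quasiMeasurePreserving.ae_eq_comp (Lp.coeFn_smul c F)] with x h1 h2 h4 h5
  simp only [Function.comp_apply, Pi.smul_apply] at h5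
  rw [h1, h4, Pi.smul_apply, h2, h5, smul_eq_mul, smul_eq_mul, map_mul]

theorem norm_conjRefl (F : Lp ℂ 2 μ) : ‖conjRefl hr F‖ = ‖F‖ := by
  rw [Lp.norm_def, Lp.norm_def, eLpNorm_congr_ae (conjRefl_ae hr F),
    ← eLpNorm_comp_measurePreserving (Lp.aestronglyMeasurable F) hr]
  congr 1
  exact eLpNorm_congr_norm_ae (Filter.Eventually.of_forall fun x => by simp)

theorem conjRefl_conjRefl (hr2 : Function.Involutive r) (F : Lp ℂ 2 μ) :
    conjRefl hr (conjRefl hr F) = F := by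
  refine Lp.ext ?_
  filter_upwards [conjRefl_ae hr (conjRefl hr F),
    hr.quasiMeasurePreserving.ae_eq_comp (conjRefl_ae hr F)] with x h1 h2
  simp only [Function.comp_apply] at h2
  rw [h1, h2, hr2 x, Complex.conj_conj]

/-- The bilinear form `∫ F (r x) F' x`. -/
def reflForm : Lp ℂ 2 μ →L[ℂ] Lp ℂ 2 μ →L[ℂ] ℂ :=
  LinearMap.mkContinuous₂ (LinearMap.mk₂ ℂ (fun F F' => inner ℂ (conjRefl hr F) F')
    (fun F F' G => by simp only [conjRefl_add, inner_add_left])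
    (fun c F G => by simp only [conjRefl_smul, inner_smul_left, Complex.conj_conj, smul_eq_mul])
    (fun F G G' => by simp only [inner_add_right])
    (fun c F G => by simp only [inner_smul_right, smul_eq_mul])) 1
    (fun F G => by
      rw [one_mul, ← norm_conjRefl hr F]
      exact norm_inner_le_norm (𝕜 := ℂ) (conjRefl hr F) G)

theorem reflForm_apply (F F' : Lp ℂ 2 μ) : reflForm hr F F' = inner ℂ (conjRefl hr F) F' := rfl

theorem reflForm_eq_integral (F F' : Lp ℂ 2 μ) :
    reflForm hr F F' = ∫ x, F (r x) * F' x ∂μ := by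
  rw [reflForm_apply, L2.inner_def]
  refine integral_congr_ae ?_
  filter_upwards [conjRefl_ae hr F] with x h1
  rw [h1, RCLike.inner_apply, starRingEnd_self_apply, mul_comm]

theorem reflForm_comm (hr2 : Function.Involutive r) (F F' : Lp ℂ 2 μ) :
    reflForm hr F F' = reflForm hr F' F := by
  have he : MeasurableEmbedding r :=
    (MeasurableEquiv.ofInvolutive r hr2 hr.measurable).measurableEmbedding
  rw [reflForm_eq_integral, reflForm_eq_integral,
    ← hr.integral_comp he fun x => F (r x) * F' x]
  simp only [hr2 _, mul_comm]

end Reflection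

/-! ### Transposed operators -/

section Transpose

variable {H₁ H₂ H₃ : Type*} [NormedAddCommGroup H₁] [InnerProductSpace ℂ H₁]
  [NormedAddCommGroup H₂] [InnerProductSpace ℂ H₂] [NormedAddCommGroup H₃]
  [InnerProductSpace ℂ H₃] {B₁ : H₁ →L[ℂ] H₁ →L[ℂ] ℂ} {B₂ : H₂ →L[ℂ] H₂ →L[ℂ] ℂ}
  {B₃ : H₃ →L[ℂ] H₃ →L[ℂ] ℂ}

/-- `T'` is the transpose of `T` with respect to the bilinear forms `B₁` and `B₂`. -/
def IsTranspose (B₁ : H₁ →L[ℂ] H₁ →L[ℂ] ℂ) (B₂ : H₂ →L[ℂ] H₂ →L[ℂ] ℂ) (T : H₁ →L[ℂ] H₂)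
    (T' : H₂ →L[ℂ] H₁) : Prop :=
  ∀ F G, B₂ (T F) G = B₁ F (T' G)

theorem IsTranspose.symm {T : H₁ →L[ℂ] H₂} {T' : H₂ →L[ℂ] H₁} (h : IsTranspose B₁ B₂ T T')
    (h₁ : ∀ x y, B₁ x y = B₁ y x) (h₂ : ∀ x y, B₂ x y = B₂ y x) : IsTranspose B₂ B₁ T' T :=
  fun F G => by rw [h₁, ← h, h₂]

theorem IsTranspose.comp {T : H₁ →L[ℂ] H₂} {T' : H₂ →L[ℂ] H₁} {R : H₂ →L[ℂ] H₃}
    {R' : H₃ →L[ℂ] H₂} (hR : IsTranspose B₂ B₃ R R') (hT : IsTranspose B₁ B₂ T T') :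
    IsTranspose B₁ B₃ (R ∘L T) (T' ∘L R') :=
  fun F G => by
    rw [ContinuousLinearMap.comp_apply, hR, hT, ContinuousLinearMap.comp_apply]

theorem IsTranspose.add {T R : H₁ →L[ℂ] H₂} {T' R' : H₂ →L[ℂ] H₁} (hT : IsTranspose B₁ B₂ T T')
    (hR : IsTranspose B₁ B₂ R R') : IsTranspose B₁ B₂ (T + R) (T' + R') :=
  fun F G => by simp only [add_apply, map_add, hT F G, hR F G]

theorem IsTranspose.sub {T R : H₁ →L[ℂ] H₂} {T' R' : H₂ →L[ℂ] H₁} (hT : IsTranspose B₁ B₂ T T')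
    (hR : IsTranspose B₁ B₂ R R') : IsTranspose B₁ B₂ (T - R) (T' - R') :=
  fun F G => by simp only [sub_apply, map_sub, hT F G, hR F G]

theorem IsTranspose.neg {T : H₁ →L[ℂ] H₂} {T' : H₂ →L[ℂ] H₁} (hT : IsTranspose B₁ B₂ T T') :
    IsTranspose B₁ B₂ (-T) (-T') :=
  fun F G => by simp only [neg_apply, map_neg, hT F G]

theorem IsTranspose.equiv_symm {S : H₁ ≃L[ℂ] H₁}
    (h : IsTranspose B₁ B₁ (S : H₁ →L[ℂ] H₁) (S : H₁ →L[ℂ] H₁)) :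
    IsTranspose B₁ B₁ (S.symm : H₁ →L[ℂ] H₁) (S.symm : H₁ →L[ℂ] H₁) := fun F G => by
  have := h (S.symm F) (S.symm G)
  simp only [ContinuousLinearEquiv.coe_coe, ContinuousLinearEquiv.apply_symm_apply] at this ⊢
  exact this.symm

theorem IsTotal.isTranspose {ι κ : Type*} [CompleteSpace H₁] [CompleteSpace H₂] {e : ι → H₁}
    {e' : κ → H₂} (he : IsTotal e) (he' : IsTotal e') {T : H₁ →L[ℂ] H₂} {T' : H₂ →L[ℂ] H₁}
    (h : ∀ j j', B₂ (T (e j)) (e' j') = B₁ (e j) (T' (e' j'))) : IsTranspose B₁ B₂ T T' := by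
  have : B₂.bilinearComp T (ContinuousLinearMap.id ℂ H₂) =
      B₁.bilinearComp (ContinuousLinearMap.id ℂ H₁) T' :=
    he.clm_ext fun j => he'.clm_ext fun j' => by
      simpa only [ContinuousLinearMap.bilinearComp_apply, ContinuousLinearMap.id_apply] using h j j'
  intro F G
  have := congrArg (fun Φ : H₁ →L[ℂ] H₂ →L[ℂ] ℂ => Φ F G) this
  simpa only [ContinuousLinearMap.bilinearComp_apply, ContinuousLinearMap.id_apply] using this

end Transpose

/-! ### The bilinear forms on the rectangle and on its sides -/

section Forms

variable {ω : Fin 2 → ℝ} {s : (Fin 2 → ℝ) → ℂ} {i k : Fin 2} {l : ℝ}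

theorem measurePreserving_sub_Ioo (l : ℝ) : MeasurePreserving (fun x : ℝ => l - x)
    (volume.restrict (Ioo (0 : ℝ) l)) (volume.restrict (Ioo (0 : ℝ) l)) := by
  have h0 := (Measure.measurePreserving_sub_left (volume : Measure ℝ) l).restrict_preimage
    (measurableSet_Ioo (a := (0 : ℝ)) (b := l))
  have h1 : (fun x : ℝ => l - x) ⁻¹' Ioo 0 l = Ioo 0 l := by
    ext x
    simp only [mem_preimage, mem_Ioo]
    constructor <;> rintro ⟨h1, h2⟩ <;> constructor <;> linarith
  rwa [h1] at h0

theorem sub_mem_box {x : Fin 2 → ℝ} : ω - x ∈ box ω ↔ x ∈ box ω := by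
  simp only [box, mem_univ_pi, Pi.sub_apply, mem_Ioo]
  refine forall_congr' fun j => ?_
  constructor <;> rintro ⟨h1, h2⟩ <;> constructor <;> linarith

theorem measurePreserving_sub_box (ω : Fin 2 → ℝ) : MeasurePreserving (fun x => ω - x)
    (volume.restrict (box ω)) (volume.restrict (box ω)) := by
  have h0 := (Measure.measurePreserving_sub_left (volume : Measure (Fin 2 → ℝ)) ω).restrict_preimage
    (measurableSet_box ω)
  have h1 : (fun x : Fin 2 → ℝ => ω - x) ⁻¹' box ω = box ω := Set.ext fun x => sub_mem_box
  rwa [h1] at h0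

/-- The bilinear form `∫ f (l - x) g x` on `L²(0, l)`. -/
def form1 (l : ℝ) : L2 l →L[ℂ] L2 l →L[ℂ] ℂ := reflForm (measurePreserving_sub_Ioo l)

/-- The bilinear form `∫ F (ω - x) G x` on `L²(Ω)`. -/
def form (ω : Fin 2 → ℝ) : L2Rect ω →L[ℂ] L2Rect ω →L[ℂ] ℂ :=
  reflForm (measurePreserving_sub_box ω)

theorem form_comm (F G : L2Rect ω) : form ω F G = form ω G F :=
  reflForm_comm _ (fun x => sub_sub_cancel ω x) F G

theorem form1_comm (f g : L2 l) : form1 l f g = form1 l g f :=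
  reflForm_comm _ (fun x => sub_sub_cancel l x) f g

/-- `U` is by definition the conjugated reflection from which the form is built; this links the
bilinear form with adjoints. -/
theorem form1_apply (f g : L2 l) : form1 l f g = ⟪U f, g⟫_ℂ := rfl

theorem U_U (f : L2 l) : U (U f) = f :=
  conjRefl_conjRefl (measurePreserving_sub_Ioo l) (fun x => sub_sub_cancel l x) f

theorem form_eq_integral (F G : L2Rect ω) : form ω F G = ∫ x in box ω, F (ω - x) * G x :=
  reflForm_eq_integral _ F G

theorem form1_eq_integral (f g : L2 l) : form1 l f g = ∫ x in Ioo 0 l, f (l - x) * g x :=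
  reflForm_eq_integral _ f g

/-- Reflection carries the rectangle at the corner 0 to the one at the opposite corner `ω`, and
inclusion–exclusion returns to rectangles at 0. -/
theorem form_chi (h : i ≠ k) {a : Fin 2 → ℝ} (ha : a ∈ Icc 0 ω) (F : L2Rect ω) :
    form ω (chi ω a) F = ⟪chi ω ω, F⟫_ℂ - ⟪chi ω (pt i (ω i - a i) (ω k)), F⟫_ℂ -
      ⟪chi ω (pt i (ω i) (ω k - a k)), F⟫_ℂ + ⟪chi ω (pt i (ω i - a i) (ω k - a k)), F⟫_ℂ := by
  have hω : 0 ≤ ω := ha.1.trans ha.2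
  have h1 : ∀ j, ω j - a j ∈ Icc 0 (ω j) := fun j =>
    ⟨sub_nonneg.2 (ha.2 j), sub_le_self _ (ha.1 j)⟩
  have h2 : ∀ j, ω j ∈ Icc 0 (ω j) := fun j => ⟨hω j, le_rfl⟩
  rw [form_comm, form_eq_integral, setIntegral_mul_chi ha.2,
    inner_chi_eq_prim (⟨hω, le_rfl⟩ : ω ∈ Icc 0 ω), inner_chi_eq_prim (pt_mem_Icc h (h1 i) (h2 k)),
    inner_chi_eq_prim (pt_mem_Icc h (h2 i) (h1 k)), inner_chi_eq_prim (pt_mem_Icc h (h1 i) (h1 k)),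
    ← integral_box_sub h (integrable_ext0 F) ha.1]
  refine setIntegral_congr_fun (measurableSet_box a) fun x hx => ?_
  exact (ext0_apply (sub_mem_box.2 (box_subset_box ha.2 hx))).symm

theorem form1_chi1 {a : ℝ} (ha : a ∈ Icc 0 l) (f : L2 l) :
    form1 l (chi1 l a) f = ⟪chi1 l l, f⟫_ℂ - ⟪chi1 l (l - a), f⟫_ℂ := by
  have hl : 0 ≤ l := ha.1.trans ha.2
  have hi : ∀ c ∈ Icc 0 l, IntervalIntegrable f volume 0 c := fun c hc =>
    (intervalIntegrable_iff_integrableOn_Ioo_of_le hc.1).2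
      ((integrableOn_L2 f).mono_set (Ioo_subset_Ioo_right hc.2))
  have hla : l - a ∈ Icc 0 l := ⟨sub_nonneg.2 ha.2, sub_le_self _ ha.1⟩
  rw [form1_comm, form1_eq_integral, setIntegral_mul_chi1 ha.2, setIntegral_Ioo_eq ha.1,
    inner_chi1_eq hl le_rfl, inner_chi1_eq hla.1 hla.2,
    intervalIntegral.integral_comp_sub_left (fun x => f x), sub_zero,
    intervalIntegral.integral_interval_sub_left (hi l ⟨hl, le_rfl⟩) (hi _ hla)]

theorem isTranspose_M3_M2 (h : i ≠ k) (hω : ∀ i, 0 < ω i) :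
    IsTranspose (form1 (ω i)) (form ω) (M3 ω i) (M2 ω k i) := by
  refine (isTotal_chi1 (hω i)).isTranspose (isTotal_chi hω) fun a b => ?_
  have h1 : ω i - a.1 ∈ Icc 0 (ω i) := ⟨sub_nonneg.2 a.2.2, sub_le_self _ a.2.1⟩
  rw [M3_chi1 h hω, form_chi h (pt_mem_Icc h a.2 (mem_Icc_full hω k)), form1_chi1 a.2,
    inner_chi1_M2 h hω (mem_Icc_full hω i), inner_chi1_M2 h hω h1, pt_self, pt_other h, sub_self,
    pt_eta h]
  -- Here `a_k = ω_k`, so two of the four rectangles are empty.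
  have h0 : ∀ u (F : L2Rect ω), ⟪chi ω (pt i u 0), F⟫_ℂ = 0 := fun u F => by
    have : box (pt i u 0) = ∅ := by
      refine Set.eq_empty_of_forall_notMem fun x hx => ?_
      have := ((mem_box h).1 hx).2
      rw [pt_other h] at this
      exact lt_irrefl _ (this.1.trans this.2)
    have : chi ω (pt i u 0) = 0 := by
      refine Lp.ext ?_
      filter_upwards [chi_ae ω (pt i u 0), Lp.coeFn_zero ℂ 2 (volume.restrict (box ω))] with x h1 h2
      rw [h1, h2, this, indicator_empty]
      rfl
    rw [this, inner_zero_left]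
  rw [h0, h0]
  ring

theorem sub_mem_Icc_coord {c : Fin 2 → ℝ} (hc : c ∈ Icc 0 ω) (j : Fin 2) :
    ω j - c j ∈ Icc 0 (ω j) := ⟨sub_nonneg.2 (hc.2 j), sub_le_self _ (hc.1 j)⟩

theorem form_chi_convolution (hω : ∀ i, 0 < ω i) (hs : Integrable s)
    {S : L2Rect ω →L[ℂ] L2Rect ω} (hS : IsConvolution ω s S) (h : i ≠ k) {a b : Fin 2 → ℝ}
    (ha : a ∈ Icc 0 ω) (hb : b ∈ Icc 0 ω) : form ω (chi ω a) (S (chi ω b)) =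
      (dd (ω k) (b k) fun u => dd (ω i) (b i) fun v => prim s (pt k u v)) -
      (dd (ω k) (b k) fun u => dd (ω i - a i) (b i) fun v => prim s (pt k u v)) -
      (dd (ω k - a k) (b k) fun u => dd (ω i) (b i) fun v => prim s (pt k u v)) +
      (dd (ω k - a k) (b k) fun u => dd (ω i - a i) (b i) fun v => prim s (pt k u v)) := by
  have h1 := fun j => sub_mem_Icc_coord ha j
  have h2 := mem_Icc_full hω
  have e1 := inner_chi_convolution hω hs hS h hb ⟨fun j => (h2 j).1, le_rfl⟩
  have e2 := inner_chi_convolution hω hs hS h hb (pt_mem_Icc h (h1 i) (h2 k))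
  have e3 := inner_chi_convolution hω hs hS h hb (pt_mem_Icc h (h2 i) (h1 k))
  have e4 := inner_chi_convolution hω hs hS h hb (pt_mem_Icc h (h1 i) (h1 k))
  simp only [pt_self, pt_other h] at e2 e3 e4
  rw [form_chi h ha, e1, e2, e3, e4]

/-- After the reflection `x ↦ ω - x` the difference kernel depends on `x + t` only. On indicators
this is the symmetry of the iterated differences in `a` and `b`. -/
theorem isTranspose_convolution (hω : ∀ i, 0 < ω i) (hs : Integrable s)
    {S : L2Rect ω →L[ℂ] L2Rect ω} (hS : IsConvolution ω s S) :
    IsTranspose (form ω) (form ω) S S := by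
  refine (isTotal_chi hω).isTranspose (isTotal_chi hω) fun a b => ?_
  have h : (0 : Fin 2) ≠ 1 := by decide
  have e1 := form_chi_convolution hω hs hS h a.2 b.2
  have e2 := form_chi_convolution hω hs hS h b.2 a.2
  rw [form_comm, e1, e2]
  simp only [dd]
  simp only [sub_right_comm _ (b.1 _) (a.1 _)]
  ring

/-- In the variable `k`, `M_{1k}` contributes `φ(ω_k) - φ(ω_k - c_k)`, while `M_{2k} S` contributes
the second difference, with the extra term `φ(-c_k)` since `φ(0) = 0`. This extra term is `M_{4k}`.
-/
theorem isTranspose_opM1 (hω : ∀ i, 0 < ω i) (hs : IsSymbol ω s)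
    {S : L2Rect ω →L[ℂ] L2Rect ω} (hS : IsConvolution ω s S) (h : i ≠ k) :
    IsTranspose (form1 (ω i)) (form ω) (opM1 S k i) (M2 ω k i ∘L S - opM4 S k i) := by
  refine (isTotal_chi1 (hω i)).isTranspose (isTotal_chi hω) fun a c => ?_
  have h1 := fun j => sub_mem_Icc_coord c.2 j
  have h1a : ω i - a.1 ∈ Icc 0 (ω i) := ⟨sub_nonneg.2 a.2.2, sub_le_self _ a.2.1⟩
  have h2 := mem_Icc_full hω
  have e1 := inner_chi_opM1 hω hs hS h a.2 ⟨fun j => (h2 j).1, le_rfl⟩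
  have e2 := inner_chi_opM1 hω hs hS h a.2 (pt_mem_Icc h (h1 i) (h2 k))
  have e3 := inner_chi_opM1 hω hs hS h a.2 (pt_mem_Icc h (h2 i) (h1 k))
  have e4 := inner_chi_opM1 hω hs hS h a.2 (pt_mem_Icc h (h1 i) (h1 k))
  have e5 := inner_chi_convolution hω hs.integrable hS h c.2 (pt_mem_Icc h (h2 i) (h2 k))
  have e6 := inner_chi_convolution hω hs.integrable hS h c.2 (pt_mem_Icc h h1a (h2 k))
  have e7 := inner_chi1_opM4 hω hs hS h c.2 (h2 i)
  have e8 := inner_chi1_opM4 hω hs hS h c.2 h1a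
  simp only [pt_self, pt_other h] at e2 e3 e4 e5 e6
  rw [form_comm, form_chi h c.2, e1, e2, e3, e4, form1_chi1 a.2, sub_apply,
    inner_sub_right, inner_sub_right, ContinuousLinearMap.comp_apply, inner_chi1_M2 h hω (h2 i),
    inner_chi1_M2 h hω h1a, e5, e6, e7, e8]
  simp only [dd, prim_pt_zero_left]
  simp only [sub_right_comm _ a.1 (c.1 _), sub_self]
  ring

/-- The values of `prim s` with second argument `-a` occur in both terms and cancel; what remains in
`key` is invariant under exchanging `(i, b)` and `(k, a)`. -/
theorem isTranspose_K1_sub (hω : ∀ i, 0 < ω i) (hs : IsSymbol ω s)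
    {S : L2Rect ω →L[ℂ] L2Rect ω} (hS : IsConvolution ω s S) (h : i ≠ k) :
    IsTranspose (form1 (ω k)) (form1 (ω i)) (K1 ω s i k - M2 ω k i ∘L opM1 S i k)
      (K1 ω s k i - M2 ω i k ∘L opM1 S k i) := by
  refine (isTotal_chi1 (hω k)).isTranspose (isTotal_chi1 (hω i)) fun a b => ?_
  have key : ∀ {i k : Fin 2}, i ≠ k → ∀ a ∈ Icc 0 (ω k), ∀ b ∈ Icc 0 (ω i),
      form1 (ω i) (chi1 (ω i) b) ((K1 ω s i k - M2 ω k i ∘L opM1 S i k) (chi1 (ω k) a)) =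
        -prim s (pt i (ω i) (ω k)) + prim s (pt i (ω i) (ω k - a)) +
          prim s (pt i (ω i - b) (ω k)) - prim s (pt i (ω i - b) (ω k - a)) := by
    intro i k h a ha b hb
    have h2 := mem_Icc_full hω
    have h1 : ω i - b ∈ Icc 0 (ω i) := ⟨sub_nonneg.2 hb.2, sub_le_self _ hb.1⟩
    rw [form1_chi1 hb, sub_apply, inner_sub_right, inner_sub_right,
      inner_chi1_K1 hω hs h ha (h2 i), inner_chi1_K1 hω hs h ha h1, ContinuousLinearMap.comp_apply,
      inner_chi1_M2 h hω (h2 i), inner_chi1_M2 h hω h1,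
      inner_chi_opM1 hω hs hS h.symm ha (pt_mem_Icc h (h2 i) (h2 k)),
      inner_chi_opM1 hω hs hS h.symm ha (pt_mem_Icc h h1 (h2 k))]
    simp only [pt_self, pt_other h, dd, prim_pt_zero_right h]
    ring
  rw [form1_comm, key h _ a.2 _ b.2, key h.symm _ b.2 _ a.2]
  simp only [pt_comm h]
  ring

end Forms

/-! ### Exponential functions -/

section Exponentials

variable {ω : Fin 2 → ℝ} {i k : Fin 2} {l : ℝ}

theorem expFun_ae (ω : Fin 2 → ℝ) (lam : Fin 2 → ℂ) : expFun ω lam =ᵐ[volume.restrict (box ω)]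
    fun x => Complex.exp (Complex.I * dot lam x) := MemLp.coeFn_toLp _

theorem dot_eq (h : i ≠ k) (lam : Fin 2 → ℂ) (x : Fin 2 → ℝ) :
    dot lam x = lam i * x i + lam k * x k := by
  fin_cases i <;> fin_cases k
  · exact absurd rfl h
  · exact Fin.sum_univ_two _
  · exact (Fin.sum_univ_two _).trans (add_comm _ _)
  · exact absurd rfl h

theorem dot_update (h : i ≠ k) (lam : Fin 2 → ℂ) (x : Fin 2 → ℝ) :
    dot (Function.update lam k 0) x = lam i * x i := by
  rw [dot_eq h, Function.update_self, Function.update_of_ne h, zero_mul, add_zero]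

theorem memLp_exp1 (l : ℝ) (z : ℂ) :
    MemLp (fun x : ℝ => Complex.exp (Complex.I * (z * x))) 2 (volume.restrict (Ioo 0 l)) := by
  refine MemLp.of_bound (Continuous.aestronglyMeasurable (by fun_prop)) (Real.exp (‖z‖ * l)) ?_
  filter_upwards [ae_restrict_mem measurableSet_Ioo] with x hx
  refine (Complex.norm_exp_le_exp_norm _).trans (Real.exp_le_exp.2 ?_)
  rw [norm_mul, Complex.norm_I, one_mul, norm_mul, Complex.norm_real, Real.norm_of_nonneg hx.1.le]
  exact mul_le_mul_of_nonneg_left hx.2.le (norm_nonneg _)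

/-- The function `e^{izx}` as an element of `L²(0, l)`. -/
def expFun1 (l : ℝ) (z : ℂ) : L2 l := (memLp_exp1 l z).toLp _

theorem expFun1_ae (l : ℝ) (z : ℂ) : expFun1 l z =ᵐ[volume.restrict (Ioo 0 l)]
    fun x => Complex.exp (Complex.I * (z * x)) := MemLp.coeFn_toLp _

theorem mul_integral_exp (z : ℂ) (x : ℝ) :
    z * (Complex.I * ∫ t in (0 : ℝ)..x, Complex.exp (Complex.I * (z * t))) =
      Complex.exp (Complex.I * (z * x)) - 1 := by
  have hd : ∀ t ∈ uIcc 0 x, HasDerivAt (fun t : ℝ => Complex.exp (Complex.I * (z * t)))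
      (z * Complex.I * Complex.exp (Complex.I * (z * t))) t := fun t _ => by
    have h1 : HasDerivAt (fun t : ℝ => Complex.I * (z * (t : ℂ))) (Complex.I * (z * 1)) t :=
      ((Complex.ofRealCLM.hasDerivAt (x := t)).const_mul z).const_mul _
    convert h1.cexp using 1
    ring
  have := intervalIntegral.integral_eq_sub_of_hasDerivAt hd
    (Continuous.intervalIntegrable (by fun_prop) _ _)
  rw [intervalIntegral.integral_const_mul] at this
  rw [← mul_assoc, this]
  simp

theorem intervalIntegral_congr_Ioo {F G : ℝ → ℂ} {x : ℝ} (hx : x ∈ Icc 0 l)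
    (h : F =ᵐ[volume.restrict (Ioo 0 l)] G) :
    ∫ t in (0 : ℝ)..x, F t = ∫ t in (0 : ℝ)..x, G t := by
  rw [← setIntegral_Ioo_eq hx.1, ← setIntegral_Ioo_eq hx.1]
  exact integral_congr_ae (ae_restrict_of_ae_restrict_of_subset (Ioo_subset_Ioo_right hx.2) h)

theorem opA_expFun1 (l : ℝ) (z : ℂ) :
    z • opA l (expFun1 l z) = expFun1 l z - Lp.const 2 _ 1 := by
  refine Lp.ext ?_
  filter_upwards [isA_opA l (expFun1 l z), Lp.coeFn_smul z (opA l (expFun1 l z)),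
    Lp.coeFn_sub (expFun1 l z) (Lp.const 2 _ 1), expFun1_ae l z,
    Lp.coeFn_const 2 (volume.restrict (Ioo 0 l)) (1 : ℂ), ae_restrict_mem measurableSet_Ioo]
    with x h1 h2 h3 h4 h5 hx
  rw [h2, h3, Pi.smul_apply, Pi.sub_apply, h1, h4, h5,
    intervalIntegral_congr_Ioo ⟨hx.1.le, hx.2.le⟩ (expFun1_ae l z), smul_eq_mul, mul_integral_exp]
  rfl

theorem ae_section (h : i ≠ k) {F G : (Fin 2 → ℝ) → ℂ} (hFG : F =ᵐ[volume.restrict (box ω)] G) :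
    ∀ᵐ v ∂volume.restrict (Ioo 0 (ω i)), (fun t => F (pt i v t)) =ᵐ[volume.restrict (Ioo 0 (ω k))]
      fun t => G (pt i v t) :=
  Measure.ae_ae_of_ae_prod ((measurePreserving_pt_box h ω).quasiMeasurePreserving.ae hFG)

theorem ARect_expFun (h : i ≠ k) (lam : Fin 2 → ℂ) :
    lam k • ARect ω k i (expFun ω lam) = expFun ω lam - expFun ω (Function.update lam k 0) := by
  refine Lp.ext ?_
  filter_upwards [isARect_ARect h (expFun ω lam),
    Lp.coeFn_smul (lam k) (ARect ω k i (expFun ω lam)),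
    Lp.coeFn_sub (expFun ω lam) (expFun ω (Function.update lam k 0)), expFun_ae ω lam,
    expFun_ae ω (Function.update lam k 0),
    (quasiMeasurePreserving_coord h).ae (ae_section h (expFun_ae ω lam)),
    ae_restrict_mem (measurableSet_box ω)]
    with x h1 h2 h3 h4 h5 h6 hx
  have hxk := ((mem_box h).1 hx).2
  simp only [← pt_comm h.symm] at h6
  rw [h2, h3, Pi.smul_apply, Pi.sub_apply, h1, h4, h5, dot_update h, dot_eq h,
    intervalIntegral_congr_Ioo ⟨hxk.1.le, hxk.2.le⟩ h6, smul_eq_mul]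
  simp only [dot_eq h, pt_self, pt_other h.symm, mul_add, Complex.exp_add]
  rw [intervalIntegral.integral_const_mul]
  linear_combination Complex.exp (Complex.I * (lam i * x i)) * mul_integral_exp (lam k) (x k)

theorem M3_expFun1 (h : i ≠ k) (hω : ∀ i, 0 < ω i) (lam : Fin 2 → ℂ) :
    M3 ω i (expFun1 (ω i) (lam i)) = expFun ω (Function.update lam k 0) := by
  refine Lp.ext ?_
  filter_upwards [isM3_M3 h hω (expFun1 (ω i) (lam i)), expFun_ae ω (Function.update lam k 0),
    (quasiMeasurePreserving_coord h).ae (expFun1_ae (ω i) (lam i))] with x h1 h2 h3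
  rw [h1, h2, h3, dot_update h]

theorem M2_expFun (h : i ≠ k) (hω : ∀ i, 0 < ω i) (lam : Fin 2 → ℂ) :
    lam k • Complex.I • M2 ω k i (expFun ω lam) =
      (Complex.exp (Complex.I * (lam k * ω k)) - 1) • expFun1 (ω i) (lam i) := by
  refine Lp.ext ?_
  filter_upwards [isM2_M2 h hω (expFun ω lam), ae_section h (expFun_ae ω lam),
    Lp.coeFn_smul (lam k) (Complex.I • M2 ω k i (expFun ω lam)),
    Lp.coeFn_smul Complex.I (M2 ω k i (expFun ω lam)),
    Lp.coeFn_smul (Complex.exp (Complex.I * (lam k * ω k)) - 1) (expFun1 (ω i) (lam i)),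
    expFun1_ae (ω i) (lam i)] with y h1 h2 h3 h4 h5 h6
  rw [h3, h5, Pi.smul_apply, Pi.smul_apply, h4, Pi.smul_apply, h1, h6,
    intervalIntegral_congr_Ioo ⟨(hω k).le, le_rfl⟩ h2]
  simp only [dot_eq h, pt_self, pt_other h, mul_add, Complex.exp_add, smul_eq_mul]
  rw [intervalIntegral.integral_const_mul]
  linear_combination Complex.exp (Complex.I * (lam i * y)) * mul_integral_exp (lam k) (ω k)

theorem M2_M3 (h : i ≠ k) (hω : ∀ i, 0 < ω i) (f : L2 (ω i)) :
    M2 ω k i (M3 ω i f) = (ω k : ℂ) • f := by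
  have : M2 ω k i ∘L M3 ω i = (ω k : ℂ) • ContinuousLinearMap.id ℂ _ := by
    refine (isTotal_chi1 (hω i)).clm_ext fun a => ?_
    rw [ContinuousLinearMap.comp_apply, M3_chi1 h hω,
      M2_chi h hω (pt_mem_Icc h a.2 (mem_Icc_full hω k)), pt_self, pt_other h]
    rfl
  exact congrArg (fun T : L2 (ω i) →L[ℂ] L2 (ω i) => T f) this

theorem conjRefl_expFun (lam : Fin 2 → ℂ) :
    conjRefl (measurePreserving_sub_box ω) (expFun ω lam) =
      Complex.exp (-Complex.I * dot (star lam) ω) • expFun ω (star lam) := by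
  refine Lp.ext ?_
  filter_upwards [conjRefl_ae (measurePreserving_sub_box ω) (expFun ω lam),
    (measurePreserving_sub_box ω).quasiMeasurePreserving.ae (expFun_ae ω lam),
    expFun_ae ω (star lam),
    Lp.coeFn_smul (Complex.exp (-Complex.I * dot (star lam) ω)) (expFun ω (star lam))]
    with x h1 h2 h3 h4
  rw [h1, h2, h4, Pi.smul_apply, h3, ← Complex.exp_conj, smul_eq_mul, ← Complex.exp_add]
  congr 1
  simp only [dot, Fin.sum_univ_two, map_mul, map_add, Complex.conj_I, Complex.conj_ofReal,
    Pi.star_apply, Pi.sub_apply, Complex.ofReal_sub, ← starRingEnd_apply, map_sub]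
  ring

theorem star_update_zero (lam : Fin 2 → ℂ) (k : Fin 2) :
    star (Function.update lam k 0) = Function.update (star lam) k 0 := by
  funext j
  by_cases hj : j = k
  · subst hj; simp
  · simp [Function.update_of_ne hj]

/-- Reflection and conjugation map `e_μ` to a multiple of the exponential with parameter `star mu`,
to which `ARect_expFun` applies. The multiples for `μ` and for `μ` with `μ_k = 0` differ by the
factor `e^{iμ_kω_k}`. -/
theorem form_expFun_adjoint_ARect (h : i ≠ k) (mu : Fin 2 → ℂ) (F : L2Rect ω) :
    mu k * form ω (expFun ω mu) (ContinuousLinearMap.adjoint (ARect ω k i) F) =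
      form ω (expFun ω mu) F -
        Complex.exp (Complex.I * (mu k * ω k)) * form ω (expFun ω (Function.update mu k 0)) F := by
  have hA := ARect_expFun (ω := ω) h (star mu)
  have h1 : mu k * ⟪ARect ω k i (expFun ω (star mu)), F⟫_ℂ =
      ⟪expFun ω (star mu), F⟫_ℂ - ⟪expFun ω (Function.update (star mu) k 0), F⟫_ℂ := by
    rw [← inner_sub_left, ← hA, inner_smul_left]
    simp
  rw [form, reflForm_apply, reflForm_apply, reflForm_apply, conjRefl_expFun, conjRefl_expFun,
    star_update_zero, ContinuousLinearMap.adjoint_inner_right, map_smul, inner_smul_left,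
    inner_smul_left, inner_smul_left, dot_update h, dot_eq h]
  have hst : ∀ j, (starRingEnd ℂ) (star mu j) = mu j := fun j => Complex.conj_conj _
  simp only [← Complex.exp_conj, map_mul, map_neg, map_add, Complex.conj_I, Complex.conj_ofReal,
    hst, neg_neg]
  rw [mul_left_comm, h1, ← mul_assoc, ← Complex.exp_add]
  ring_nf

/-- A coordinate, cut off outside the rectangle, as a bounded function. -/
def cutCoord (ω : Fin 2 → ℝ) (j : Fin 2) : BoundedContinuousFunction (Fin 2 → ℝ) ℂ :=
  BoundedContinuousFunction.ofNormedAddCommGroup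
    (fun x => ((max 0 (min (x j) (ω j)) : ℝ) : ℂ)) (by fun_prop) |ω j| fun x => by
      rw [Complex.norm_real, Real.norm_of_nonneg (le_max_left _ _)]
      exact max_le (abs_nonneg _) ((min_le_right _ _).trans (le_abs_self _))

/-- A bounded function that equals `e^{iλx}` on the rectangle. -/
def expBdd (ω : Fin 2 → ℝ) (lam : Fin 2 → ℂ) : BoundedContinuousFunction (Fin 2 → ℝ) ℂ :=
  NormedSpace.exp (Complex.I • ∑ j, lam j • cutCoord ω j)

theorem expBdd_apply {x : Fin 2 → ℝ} (hx : x ∈ box ω) (lam : Fin 2 → ℂ) :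
    expBdd ω lam x = Complex.exp (Complex.I * dot lam x) := by
  have hev : Continuous fun f : BoundedContinuousFunction (Fin 2 → ℝ) ℂ => f x := by fun_prop
  let ev : BoundedContinuousFunction (Fin 2 → ℝ) ℂ →+* ℂ :=
    { toFun := fun f => f x
      map_one' := rfl
      map_mul' := fun _ _ => rfl
      map_zero' := rfl
      map_add' := fun _ _ => rfl }
  have := NormedSpace.map_exp ev hev (Complex.I • ∑ j, lam j • cutCoord ω j)
  rw [Complex.exp_eq_exp_ℂ]
  refine this.trans (congrArg _ ?_)
  have hc : ∀ j, cutCoord ω j x = x j := fun j => by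
    have hj := hx j trivial
    change ((max 0 (min (x j) (ω j)) : ℝ) : ℂ) = x j
    rw [min_eq_left hj.2.le, max_eq_right hj.1.le]
  change Complex.I * (∑ j, lam j • cutCoord ω j) x = _
  simp [dot, Fin.sum_univ_two, hc]

theorem expFun_eq_toLp (lam : Fin 2 → ℂ) : expFun ω lam =
    BoundedContinuousFunction.toLp 2 (volume.restrict (box ω)) ℂ (expBdd ω lam) := by
  refine Lp.ext ?_
  filter_upwards [expFun_ae ω lam, BoundedContinuousFunction.coeFn_toLp 2
    (volume.restrict (box ω)) ℂ (expBdd ω lam), ae_restrict_mem (measurableSet_box ω)]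
    with x h1 h2 hx
  rw [h1, h2, expBdd_apply hx]

/-- In the Banach algebra of bounded continuous functions `exp` is analytic and the exponent is
linear in `λ`; the passage to `L²` is a bounded linear map. -/
theorem differentiable_expFun (ω : Fin 2 → ℝ) : Differentiable ℂ (expFun ω) := by
  have h1 : Differentiable ℂ (expBdd ω) := fun lam => by
    have : Differentiable ℂ fun lam : Fin 2 → ℂ => Complex.I • ∑ j, lam j • cutCoord ω j := by
      fun_prop
    exact (NormedSpace.exp_analytic (𝕂 := ℂ) _).differentiableAt.comp lam this.differentiableAt
  rw [funext (expFun_eq_toLp (ω := ω))]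
  exact (ContinuousLinearMap.differentiable _).comp h1

theorem norm_expFun_le (ω : Fin 2 → ℝ) : ∃ C B : ℝ, 0 ≤ C ∧ 0 ≤ B ∧
    ∀ lam, ‖expFun ω lam‖ ≤ C * Real.exp (B * ‖lam‖) := by
  refine ⟨(measureUnivNNReal (volume.restrict (box ω)) : ℝ) ^ (2 : ENNReal).toReal⁻¹,
    ∑ j, |ω j|, by positivity, by positivity, fun lam => ?_⟩
  refine (Lp.norm_le_of_ae_bound (by positivity) (f := expFun ω lam)
    (C := Real.exp ((∑ j, |ω j|) * ‖lam‖)) ?_)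
  filter_upwards [expFun_ae ω lam, ae_restrict_mem (measurableSet_box ω)] with x h1 hx
  rw [h1]
  refine (Complex.norm_exp_le_exp_norm _).trans (Real.exp_le_exp.2 ?_)
  rw [norm_mul, Complex.norm_I, one_mul, Finset.sum_mul]
  refine (norm_sum_le _ _).trans (Finset.sum_le_sum fun j _ => ?_)
  have hj := hx j trivial
  rw [norm_mul, mul_comm, Complex.norm_real, Real.norm_of_nonneg hj.1.le]
  gcongr
  · exact hj.2.le.trans (le_abs_self _)
  · exact norm_le_pi_norm lam j

/-- The positive and the negative part of `F` are densities of finite measures with the same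
characteristic function, so the two measures coincide. -/
theorem ae_eq_zero_of_charFun_real {μ : Measure (Fin 2 → ℝ)} [IsFiniteMeasure μ]
    {F : (Fin 2 → ℝ) → ℝ} (hF : Integrable F μ)
    (h : ∀ c : Fin 2 → ℝ,
      ∫ x, (F x : ℂ) * Complex.exp (Complex.I * dot (fun j => (c j : ℂ)) x) ∂μ = 0) :
    F =ᵐ[μ] 0 := by
  have hfin : ∀ G : (Fin 2 → ℝ) → ℝ, Integrable G μ →
      IsFiniteMeasure (μ.withDensity fun x => ENNReal.ofReal (G x)) := fun G hG =>
    isFiniteMeasure_withDensity_ofReal hG.2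
  have hFn : Integrable (fun x => -F x) μ := hF.neg
  have := hfin F hF
  have := hfin _ hFn
  have key : μ.withDensity (fun x => ENNReal.ofReal (F x)) =
      μ.withDensity fun x => ENNReal.ofReal (-F x) := by
    refine Measure.ext_of_charFunDual (funext fun L => ?_)
    have hL : ∀ x : Fin 2 → ℝ, Complex.exp (L x * Complex.I) =
        Complex.exp (Complex.I * dot (fun j => ((L (Pi.single j 1) : ℝ) : ℂ)) x) := fun x => by
      congr 1
      have : L x = ∑ j, L (Pi.single j 1) * x j := by
        conv_lhs => rw [pi_eq_sum_univ' x, map_sum]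
        refine Finset.sum_congr rfl fun j _ => ?_
        rw [map_smul, smul_eq_mul, mul_comm]
      rw [this, dot, mul_comm]
      push_cast
      rfl
    have hw : ∀ G : (Fin 2 → ℝ) → ℝ, Integrable G μ →
        charFunDual (μ.withDensity fun x => ENNReal.ofReal (G x)) L =
          ∫ x, ((max (G x) 0 : ℝ) : ℂ) *
            Complex.exp (Complex.I * dot (fun j => ((L (Pi.single j 1) : ℝ) : ℂ)) x) ∂μ := by
      intro G hG
      rw [charFunDual_apply, integral_withDensity_eq_integral_toReal_smul₀
        hG.1.aemeasurable.ennreal_ofReal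
        (Filter.Eventually.of_forall fun _ => ENNReal.ofReal_lt_top)]
      refine integral_congr_ae (Filter.Eventually.of_forall fun x => ?_)
      simp only [hL, ENNReal.toReal_ofReal']
      exact Complex.real_smul
    have hint : ∀ G : (Fin 2 → ℝ) → ℝ, Integrable G μ →
        Integrable (fun x => ((max (G x) 0 : ℝ) : ℂ) *
        Complex.exp (Complex.I * dot (fun j => ((L (Pi.single j 1) : ℝ) : ℂ)) x)) μ := by
      intro G hG
      refine hG.pos_part.ofReal.mul_bdd (c := 1)
        (Continuous.aestronglyMeasurable (by unfold dot; fun_prop))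
        (Filter.Eventually.of_forall fun x => ?_)
      rw [← hL, Complex.norm_exp_ofReal_mul_I]
    rw [hw F hF, hw _ hFn, ← sub_eq_zero, ← integral_sub (hint F hF) (hint _ hFn),
      ← h fun j => L (Pi.single j 1)]
    refine integral_congr_ae (Filter.Eventually.of_forall fun x => ?_)
    simp only [← sub_mul, ← Complex.ofReal_sub]
    congr 2
    rcases le_total 0 (F x) with hx | hx
    · rw [max_eq_left hx, max_eq_right (neg_nonpos.2 hx), sub_zero]
    · rw [max_eq_right hx, max_eq_left (neg_nonneg.2 hx), zero_sub, neg_neg]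
  rw [withDensity_eq_iff hF.1.aemeasurable.ennreal_ofReal hFn.1.aemeasurable.ennreal_ofReal
    hF.lintegral_lt_top.ne] at key
  filter_upwards [key] with x hx
  have := congrArg ENNReal.toReal hx
  rw [ENNReal.toReal_ofReal', ENNReal.toReal_ofReal'] at this
  rcases le_total 0 (F x) with h0 | h0
  · rwa [max_eq_left h0, max_eq_right (neg_nonpos.2 h0)] at this
  · rw [max_eq_right h0, max_eq_left (neg_nonneg.2 h0)] at this
    exact neg_eq_zero.1 this.symm

/-- The exponential functions are total. -/
theorem isTotal_expFun (ω : Fin 2 → ℝ) : IsTotal (expFun ω) := by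
  intro F hF
  have hFi : Integrable F (volume.restrict (box ω)) := integrableOn_L2Rect F
  have h1 : ∀ c : Fin 2 → ℝ,
      ∫ x in box ω, F x * Complex.exp (Complex.I * dot (fun j => (c j : ℂ)) x) = 0 := by
    intro c
    rw [← hF fun j => ((-c j : ℝ) : ℂ), L2.inner_def]
    refine integral_congr_ae ?_
    filter_upwards [expFun_ae ω fun j => ((-c j : ℝ) : ℂ)] with x hx
    rw [hx, RCLike.inner_apply, ← Complex.exp_conj]
    congr 2
    simp [dot, Fin.sum_univ_two]
    ring
  have hb : ∀ (c : Fin 2 → ℝ) {G : (Fin 2 → ℝ) → ℂ}, Integrable G (volume.restrict (box ω)) →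
      Integrable (fun x => G x * Complex.exp (Complex.I * dot (fun j => (c j : ℂ)) x))
        (volume.restrict (box ω)) := fun c G hG =>
    hG.mul_bdd (c := 1) (Continuous.aestronglyMeasurable (by unfold dot; fun_prop))
      (Filter.Eventually.of_forall fun x => by
        have : Complex.I * dot (fun j => (c j : ℂ)) x = ((∑ j, c j * x j : ℝ) : ℂ) * Complex.I := by
          simp only [dot]; push_cast; ring
        rw [this, Complex.norm_exp_ofReal_mul_I])
  -- The real frequencies are symmetric under `c ↦ -c`, so `conj F` is orthogonal to them too. This
  -- separates real and imaginary parts.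
  have h2 : ∀ c : Fin 2 → ℝ, ∫ x in box ω, (starRingEnd ℂ) (F x) *
      Complex.exp (Complex.I * dot (fun j => (c j : ℂ)) x) = 0 := by
    intro c
    have := congrArg (starRingEnd ℂ) (h1 fun j => -c j)
    rw [map_zero, ← integral_conj] at this
    rw [← this]
    refine integral_congr_ae (Filter.Eventually.of_forall fun x => ?_)
    simp only [map_mul, ← Complex.exp_conj]
    congr 2
    simp [dot, Fin.sum_univ_two]
    ring
  have hFc : Integrable (fun x => (starRingEnd ℂ) (F x)) (volume.restrict (box ω)) :=
    (Complex.conjCLE : ℂ →L[ℝ] ℂ).integrable_comp hFi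
  have hre := ae_eq_zero_of_charFun_real hFi.re fun c => by
    have e : ∀ x,
        ((RCLike.re (F x) : ℝ) : ℂ) * Complex.exp (Complex.I * dot (fun j => (c j : ℂ)) x) =
        (F x * Complex.exp (Complex.I * dot (fun j => (c j : ℂ)) x) + (starRingEnd ℂ) (F x) *
          Complex.exp (Complex.I * dot (fun j => (c j : ℂ)) x)) / 2 := fun x => by
      rw [RCLike.re_eq_complex_re, Complex.re_eq_add_conj]; ring
    simp only [e]
    rw [integral_div, integral_add (hb c hFi) (hb c hFc), h1, h2, add_zero, zero_div]
  have him := ae_eq_zero_of_charFun_real hFi.im fun c => by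
    have e : ∀ x,
        ((RCLike.im (F x) : ℝ) : ℂ) * Complex.exp (Complex.I * dot (fun j => (c j : ℂ)) x) =
        (F x * Complex.exp (Complex.I * dot (fun j => (c j : ℂ)) x) - (starRingEnd ℂ) (F x) *
          Complex.exp (Complex.I * dot (fun j => (c j : ℂ)) x)) / (2 * Complex.I) := fun x => by
      rw [RCLike.im_eq_complex_im, Complex.im_eq_sub_conj]; ring
    simp only [e]
    rw [integral_div, integral_sub (hb c hFi) (hb c hFc), h1, h2, sub_zero, zero_div]
  refine Lp.ext ?_
  filter_upwards [hre, him, Lp.coeFn_zero ℂ 2 (volume.restrict (box ω))] with x h3 h4 h5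
  rw [h5]
  exact Complex.ext h3 h4

theorem eq_zero_of_form_expFun {F : L2Rect ω} (h : ∀ mu, form ω (expFun ω mu) F = 0) : F = 0 := by
  refine isTotal_expFun ω F fun mu => ?_
  have := h (star mu)
  rw [form, reflForm_apply, conjRefl_expFun, star_star, inner_smul_left] at this
  exact (mul_eq_zero.1 this).resolve_left
    ((map_ne_zero _).2 (Complex.exp_ne_zero _))

theorem expFun_ne_zero (hω : ∀ i, 0 < ω i) (lam : Fin 2 → ℂ) : expFun ω lam ≠ 0 := by
  intro h0
  have h1 : ∀ᵐ x ∂volume.restrict (box ω), False := by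
    filter_upwards [expFun_ae ω lam, Lp.coeFn_zero ℂ 2 (volume.restrict (box ω))] with x h1 h2
    rw [h0, h2] at h1
    exact Complex.exp_ne_zero _ h1.symm
  rw [Filter.eventually_false_iff_eq_bot, ae_eq_bot, Measure.restrict_eq_zero, box,
    Real.volume_pi_Ioo, Finset.prod_eq_zero_iff] at h1
  obtain ⟨j, -, hj⟩ := h1
  rw [sub_zero, ENNReal.ofReal_eq_zero] at hj
  exact absurd (hω j) (not_lt.2 hj)

end Exponentials

/-! ### Operator identities with the exponential functions -/

section Identities

variable {ω : Fin 2 → ℝ} {s : (Fin 2 → ℝ) → ℂ} {i k : Fin 2} {l : ℝ}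
  {S : L2Rect ω ≃L[ℂ] L2Rect ω}

open ContinuousLinearMap (adjoint)

theorem IsSymbol.memLp_sub (hs : IsSymbol ω s) :
    MemLp (fun x => s (x - ω)) 2 (volume.restrict (box ω)) :=
  (hs.memLp.comp_measurePreserving (measurePreserving_sub_right volume ω)).restrict _

/-- The function `x ↦ s (x - ω)` as an element of `L²(Ω)`. -/
def IsSymbol.shift (hs : IsSymbol ω s) : L2Rect ω := hs.memLp_sub.toLp _

theorem IsSymbol.shift_ae (hs : IsSymbol ω s) :
    hs.shift =ᵐ[volume.restrict (box ω)] fun x => s (x - ω) := MemLp.coeFn_toLp _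

theorem IsSymbol.form_shift_chi (hs : IsSymbol ω s) (h : i ≠ k) {a : Fin 2 → ℝ}
    (ha : a ∈ Icc 0 ω) : form ω hs.shift (chi ω a) = prim s (pt i (-a i) (-a k)) := by
  have h1 : ∀ᵐ x ∂volume.restrict (box ω), hs.shift (ω - x) * chi ω a x =
      s (0 - x) * chi ω a x := by
    filter_upwards [(measurePreserving_sub_box ω).quasiMeasurePreserving.ae hs.shift_ae] with x hx
    rw [hx]
    congr 2
    abel
  rw [form_eq_integral, integral_congr_ae h1, setIntegral_mul_chi ha.2 fun x => s (0 - x),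
    integral_box_sub h hs.integrable ha.1]
  simp only [Pi.zero_apply, zero_sub, prim_pt_zero_left, prim_pt_zero_right h,
    prim_zero_left 0 s (show (0 : Fin 2 → ℝ) 0 = 0 from rfl)]
  ring

theorem const_eq_chi1 (l : ℝ) : (Lp.const 2 _ (1 : ℂ) : L2 l) = chi1 l l := by
  refine Lp.ext ?_
  filter_upwards [Lp.coeFn_const 2 (volume.restrict (Ioo 0 l)) (1 : ℂ), chi1_ae l l,
    ae_restrict_mem measurableSet_Ioo] with x h1 h2 hx
  rw [h1, h2, indicator_of_mem hx]
  rfl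

/-- Again `integral_dd_add_integral_dd`, now in the variable `i`. Its boundary term `a_i φ(b)` is
`K_{1i} M_{2i}`, and `b φ(-a_i)` is the rank one term, the origin of `θ` and of `h = S⁻¹y`. -/
theorem opA_M4 (hω : ∀ i, 0 < ω i) (hs : IsSymbol ω s) {S : L2Rect ω →L[ℂ] L2Rect ω}
    (hS : IsConvolution ω s S) (h : i ≠ k) (F : L2Rect ω) :
    opA (ω i) (opM4 S k i F) = opM4 S k i (adjoint (ARect ω i k) F) +
      Complex.I • K1 ω s i k (M2 ω i k F) +
        (Complex.I * form ω hs.shift F) • Lp.const 2 _ (1 : ℂ) := by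
  have key : opA (ω i) ∘L opM4 S k i = opM4 S k i ∘L adjoint (ARect ω i k) +
      Complex.I • (K1 ω s i k ∘L M2 ω i k) +
        Complex.I • (form ω hs.shift).smulRight (Lp.const 2 _ (1 : ℂ)) := by
    refine (isTotal_chi hω).clm_ext₂ (isTotal_chi1 (hω i)) fun a b => ?_
    have hai := mem_Icc_coord a.2 i
    have hak := mem_Icc_coord a.2 k
    set φ : ℝ → ℂ := fun v => prim s (pt k (-a.1 k) v) with hφ
    have hφc : Continuous φ := by
      have := continuous_prim hs.integrable
      fun_prop
    have hφ0 : φ 0 = 0 := prim_pt_zero_right h.symm _ _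
    have e1 : ∫ τ in (0 : ℝ)..b.1, ⟪chi1 (ω i) τ, opM4 S k i (chi ω a)⟫_ℂ =
        ∫ τ in (0 : ℝ)..b.1, dd τ (a.1 i) φ := by
      refine intervalIntegral.integral_congr fun τ hτ => ?_
      rw [uIcc_of_le b.2.1] at hτ
      exact inner_chi1_opM4 hω hs hS h a.2 ⟨hτ.1, hτ.2.trans b.2.2⟩
    have e2 : ∫ τ in (0 : ℝ)..a.1 i, ⟪chi1 (ω i) b, opM4 S k i (chi ω (pt i τ (a.1 k)))⟫_ℂ =
        ∫ τ in (0 : ℝ)..a.1 i, dd b τ φ := by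
      refine intervalIntegral.integral_congr fun τ hτ => ?_
      rw [uIcc_of_le hai.1] at hτ
      have := inner_chi1_opM4 hω hs hS h (pt_mem_Icc h ⟨hτ.1, hτ.2.trans hai.2⟩ hak) b.2
      rw [pt_self, pt_other h] at this
      exact this
    have e3 := integral_dd_add_integral_dd hφc hφ0 (a.1 i) b
    have e4 : prim s (pt i (b : ℝ) (-a.1 k)) = φ b := by rw [hφ, pt_comm h]
    have e5 : prim s (pt i (-a.1 i) (-a.1 k)) = φ (-a.1 i) := by rw [hφ, pt_comm h]
    simp only [ContinuousLinearMap.comp_apply, add_apply, smul_apply,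
      ContinuousLinearMap.smulRight_apply, inner_add_right, inner_smul_right,
      inner_adjoint_ARect_chi h.symm _ a.2, inner_chi1_opA b.2, M2_chi h.symm hω a.2, map_smul,
      inner_chi1_K1 hω hs h hak b.2, hs.form_shift_chi h a.2, const_eq_chi1,
      inner_chi1_chi1 (⟨(hω i).le, le_rfl⟩ : ω i ∈ Icc 0 (ω i)) b.2, min_eq_left b.2.2,
      e1, e2, e4, e5]
    linear_combination Complex.I * e3
  have := congrArg (fun T : L2Rect ω →L[ℂ] L2 (ω i) => T F) key
  simpa only [ContinuousLinearMap.comp_apply, add_apply, smul_apply,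
    ContinuousLinearMap.smulRight_apply, smul_smul] using this

theorem opA_M2 (hω : ∀ i, 0 < ω i) (h : i ≠ k) (F : L2Rect ω) :
    opA (ω i) (M2 ω k i F) = M2 ω k i (adjoint (ARect ω i k) F) +
      Complex.I • K3 ω i k (M2 ω i k F) := by
  have key : opA (ω i) ∘L M2 ω k i = M2 ω k i ∘L adjoint (ARect ω i k) +
      Complex.I • (K3 ω i k ∘L M2 ω i k) := by
    refine (isTotal_chi hω).clm_ext₂ (isTotal_chi1 (hω i)) fun a b => ?_
    have hai := mem_Icc_coord a.2 i
    have hak := mem_Icc_coord a.2 k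
    -- As half a second difference of `|x|`, the minimum becomes accessible to
    -- `integral_dd_add_integral_dd`.
    have hmin : ∀ u v : ℝ, 0 ≤ u → 0 ≤ v →
        ((min u v : ℝ) : ℂ) = dd u v (fun x => ((|x| : ℝ) : ℂ)) / 2 := fun u v hu hv => by
      rw [dd, abs_neg, abs_of_nonneg hu, abs_of_nonneg hv, abs_zero]
      rcases le_total u v with huv | huv
      · rw [min_eq_left huv, abs_of_nonpos (sub_nonpos.2 huv)]
        push_cast
        ring
      · rw [min_eq_right huv, abs_of_nonneg (sub_nonneg.2 huv)]
        push_cast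
        ring
    have e1 : ∫ τ in (0 : ℝ)..b.1, ⟪chi1 (ω i) τ, M2 ω k i (chi ω a)⟫_ℂ =
        ∫ τ in (0 : ℝ)..b.1, (a.1 k / 2 : ℂ) * dd τ (a.1 i) (fun x => ((|x| : ℝ) : ℂ)) := by
      refine intervalIntegral.integral_congr fun τ hτ => ?_
      rw [uIcc_of_le b.2.1] at hτ
      rw [M2_chi h hω a.2, inner_smul_right, inner_chi1_chi1 hai ⟨hτ.1, hτ.2.trans b.2.2⟩,
        hmin _ _ hτ.1 hai.1]
      ring
    have e2 : ∫ τ in (0 : ℝ)..a.1 i, ⟪chi1 (ω i) b, M2 ω k i (chi ω (pt i τ (a.1 k)))⟫_ℂ =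
        ∫ τ in (0 : ℝ)..a.1 i, (a.1 k / 2 : ℂ) * dd b τ (fun x => ((|x| : ℝ) : ℂ)) := by
      refine intervalIntegral.integral_congr fun τ hτ => ?_
      rw [uIcc_of_le hai.1] at hτ
      have hτ' : τ ∈ Icc 0 (ω i) := ⟨hτ.1, hτ.2.trans hai.2⟩
      rw [M2_chi h hω (pt_mem_Icc h hτ' hak), inner_smul_right, pt_self, pt_other h,
        inner_chi1_chi1 hτ' b.2, hmin _ _ b.2.1 hτ.1]
      ring
    have e3 := integral_dd_add_integral_dd (φ := fun x => ((|x| : ℝ) : ℂ)) (by fun_prop)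
      (by simp) (a.1 i) b
    rw [abs_neg, abs_of_nonneg hai.1, abs_of_nonneg b.2.1] at e3
    simp only [ContinuousLinearMap.comp_apply, add_apply, smul_apply, inner_add_right,
      inner_smul_right, inner_adjoint_ARect_chi h.symm _ a.2, inner_chi1_opA b.2,
      M2_chi h.symm hω a.2, map_smul, e1, e2, intervalIntegral.integral_const_mul,
      inner_chi1_K3 hω b.2]
    rw [inner_chi1_chi1 hak (mem_Icc_full hω k), min_eq_right hak.2]
    linear_combination Complex.I * (a.1 k / 2 : ℂ) * e3
  have := congrArg (fun T : L2Rect ω →L[ℂ] L2 (ω i) => T F) key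
  simpa only [ContinuousLinearMap.comp_apply, add_apply, smul_apply] using this

/-- The components of `ψ(λ)`. -/
def psi (ω : Fin 2 → ℝ) (s : (Fin 2 → ℝ) → ℂ) (S : L2Rect ω ≃L[ℂ] L2Rect ω) (lam : Fin 2 → ℂ) :
    L2Sum ω := fun i =>
  WithLp.toLp 2 ((Complex.I * lam (1 - i)) • M2 ω (1 - i) i (S.symm (expFun ω lam)),
    expFun1 (ω i) (lam i) + (Complex.I * lam (1 - i)) • M4 ω s (1 - i) i (S.symm (expFun ω lam)))

theorem one_sub_eq (h : i ≠ k) : 1 - i = k := by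
  revert i k
  decide

theorem psi_fst (h : i ≠ k) (lam : Fin 2 → ℂ) : (psi ω s S lam i).fst =
    (Complex.I * lam k) • M2 ω k i (S.symm (expFun ω lam)) := by
  rw [← one_sub_eq h]
  rfl

theorem psi_snd (h : i ≠ k) (lam : Fin 2 → ℂ) : (psi ω s S lam i).snd =
    expFun1 (ω i) (lam i) + (Complex.I * lam k) • M4 ω s k i (S.symm (expFun ω lam)) := by
  rw [← one_sub_eq h]
  rfl

theorem commOp_apply_symm (h : i ≠ k) (lam : Fin 2 → ℂ) :
    lam k • commOp (S : L2Rect ω →L[ℂ] L2Rect ω) k i (S.symm (expFun ω lam)) =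
      -Complex.I • (expFun ω lam - expFun ω (Function.update lam k 0) -
        lam k • S (adjoint (ARect ω k i) (S.symm (expFun ω lam)))) := by
  rw [← ARect_expFun h]
  simp only [commOp, smul_apply, sub_apply, ContinuousLinearMap.comp_apply,
    ContinuousLinearEquiv.coe_coe, ContinuousLinearEquiv.apply_symm_apply]
  module

/-- Apply `X_k = M_{1k} M_{2k} + M_{3k} M_{4k}` to `S⁻¹e_λ`. The summand `e^{iλ_i x_i}` in `ψ_i`
cancels the function `𝒜_k` leaves when it acts on `e_λ`. -/
theorem PiOp_psi (hω : ∀ i, 0 < ω i) (hs : IsSymbol ω s)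
    (hS : IsConvolution ω s (S : L2Rect ω →L[ℂ] L2Rect ω)) (h : i ≠ k) (lam : Fin 2 → ℂ) :
    PiOp ω s k i (psi ω s S lam i) =
      expFun ω lam - lam k • S (adjoint (ARect ω k i) (S.symm (expFun ω lam))) := by
  have e1 := congrArg (fun T : L2Rect ω →L[ℂ] L2Rect ω => T (S.symm (expFun ω lam)))
    (commOp_eq hω hs hS h)
  have e2 := commOp_apply_symm (S := S) h lam
  simp only [add_apply, ContinuousLinearMap.comp_apply] at e1
  rw [e1] at e2
  change M1 ω s k i (psi ω s S lam i).fst + M3 ω i (psi ω s S lam i).snd = _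
  rw [psi_fst h, psi_snd h, M1_eq hω hs hS h, M4_eq hω hs hS h, map_smul, map_add, map_smul,
    M3_expFun1 h hω]
  have e3 := congrArg (fun x => Complex.I • x) e2
  simp only [smul_smul, smul_add, mul_neg, Complex.I_mul_I, neg_neg, one_smul] at e3
  rw [add_left_comm, e3]
  abel

theorem form_symm (hω : ∀ i, 0 < ω i) (hs : IsSymbol ω s)
    (hS : IsConvolution ω s (S : L2Rect ω →L[ℂ] L2Rect ω)) (F F' : L2Rect ω) :
    form ω (S.symm F) F' = form ω F (S.symm F') :=
  (isTranspose_convolution hω hs.integrable hS).equiv_symm F F'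

theorem mul_eq_of_ne (h : i ≠ k) (lam : Fin 2 → ℂ) : lam 0 * lam 1 = lam i * lam k := by
  fin_cases i <;> fin_cases k
  · exact absurd rfl h
  · rfl
  · exact mul_comm _ _
  · exact absurd rfl h

/-- Put `F = S⁻¹e_λ`. By `PiOp_psi` the off-diagonal term contains `F - λ_i 𝒜_i^* F`, so the
intertwining relations `opA_M2` and `opA_M4` cancel everything in row `i` except the constant
function and the rank one term. -/
theorem G_psi (hω : ∀ i, 0 < ω i) (hs : IsSymbol ω s)
    (hS : IsConvolution ω s (S : L2Rect ω →L[ℂ] L2Rect ω)) (lam : Fin 2 → ℂ) :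
    G ω s S lam (psi ω s S lam) =
      (1 + lam 0 * lam 1 * form ω hs.shift (S.symm (expFun ω lam))) • col0101 ω := by
  funext i
  obtain ⟨k, h⟩ : ∃ k, i ≠ k := ⟨1 - i, by revert i; decide⟩
  have e0 : G ω s S lam (psi ω s S lam) i = diagBlock (ω i) (lam i) (psi ω s S lam i) +
      (Complex.I * lam k) • g ω s S i k (psi ω s S lam k) := by
    rw [← one_sub_eq h]
    rfl
  have e1 : S.symm (PiOp ω s i k (psi ω s S lam k)) = S.symm (expFun ω lam) -
      lam i • adjoint (ARect ω i k) (S.symm (expFun ω lam)) := by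
    rw [PiOp_psi hω hs hS h.symm, map_sub, map_smul, ContinuousLinearEquiv.symm_apply_apply]
  have hp : ∀ x y : L2Two (ω i), x.fst = y.fst → x.snd = y.snd → x = y := fun x y h1 h2 =>
    WithLp.ofLp_injective 2 (Prod.ext h1 h2)
  have hA2 := opA_M2 hω h (S.symm (expFun ω lam))
  have hA4 := opA_M4 hω hs hS h (S.symm (expFun ω lam))
  have hA1 := opA_expFun1 (ω i) (lam i)
  rw [e0, mul_eq_of_ne h]
  refine hp _ _ ?_ ?_
  · change ((psi ω s S lam i).fst - lam i • opA (ω i) (psi ω s S lam i).fst) +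
      (Complex.I * lam k) • (K3 ω i k (psi ω s S lam k).fst -
        M2 ω k i (S.symm (PiOp ω s i k (psi ω s S lam k)))) = _ • (0 : L2 (ω i))
    rw [psi_fst h, psi_fst h.symm, e1]
    simp only [map_smul, map_sub, hA2]
    match_scalars <;> (ring_nf; try simp)
  · change ((psi ω s S lam i).snd - lam i • opA (ω i) (psi ω s S lam i).snd) +
      (Complex.I * lam k) • (K1 ω s i k (psi ω s S lam k).fst -
        M4 ω s k i (S.symm (PiOp ω s i k (psi ω s S lam k)))) = _ • (Lp.const 2 _ (1 : ℂ))
    rw [psi_snd h, psi_fst h.symm, e1, M4_eq hω hs hS h]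
    simp only [map_smul, map_sub, map_add, smul_add, hA1, hA4]
    match_scalars <;> (ring_nf; try simp only [Complex.I_sq]; ring_nf)

/-- Compute the form of `S⁻¹e_μ` with `X_k S⁻¹e_λ` twice: from the definition of `X_k`, and from its
factorization after moving `M_{1k}` and `M_{3k}` to the left by their transposes. The terms with
`𝒜_k^*` are eliminated by `form_expFun_adjoint_ARect`. -/
theorem mul_form_expFun (hω : ∀ i, 0 < ω i) (hs : IsSymbol ω s)
    (hS : IsConvolution ω s (S : L2Rect ω →L[ℂ] L2Rect ω)) (h : i ≠ k) (lam mu : Fin 2 → ℂ) :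
    (mu k - lam k) * form ω (expFun ω mu) (S.symm (expFun ω lam)) =
      mu k * form1 (ω i) (M2 ω k i (S.symm (expFun ω mu))) (psi ω s S lam i).snd -
        lam k * form1 (ω i) (psi ω s S mu i).snd (M2 ω k i (S.symm (expFun ω lam))) := by
  rw [psi_snd h, psi_snd h, M4_eq hω hs hS h]
  set F := S.symm (expFun ω lam) with hF
  set F' := S.symm (expFun ω mu) with hF'
  have hSF' : S F' = expFun ω mu := S.apply_symm_apply _
  set R := form ω (expFun ω mu) F with hR
  have e1 := congrArg (fun T : L2Rect ω →L[ℂ] L2Rect ω => form ω F' (T F)) (commOp_eq hω hs hS h)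
  simp only [add_apply, ContinuousLinearMap.comp_apply, map_add] at e1
  have hM1 : form ω F' (opM1 (S : L2Rect ω →L[ℂ] L2Rect ω) k i (M2 ω k i F)) =
      form1 (ω i) (M2 ω k i F) (M2 ω k i (expFun ω mu)) -
        form1 (ω i) (M2 ω k i F) (opM4 (S : L2Rect ω →L[ℂ] L2Rect ω) k i F') := by
    rw [form_comm, isTranspose_opM1 hω hs hS h, sub_apply, ContinuousLinearMap.comp_apply, map_sub,
      ContinuousLinearEquiv.coe_coe, hSF']
  have hM3 : ∀ f F, form ω F (M3 ω i f) = form1 (ω i) f (M2 ω k i F) := fun f F => by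
    rw [form_comm, isTranspose_M3_M2 h hω]
  have e2 := congrArg (form ω F') (commOp_apply_symm (S := S) h lam)
  rw [← hF] at e2
  simp only [map_smul, map_sub, smul_eq_mul] at e2
  have e3 : form ω F' (expFun ω lam) = R := form_symm hω hs hS _ _
  have e4 : form ω F' (S (adjoint (ARect ω k i) F)) =
      form ω (expFun ω mu) (adjoint (ARect ω k i) F) := by
    have := isTranspose_convolution hω hs.integrable hS F' (adjoint (ARect ω k i) F)
    simp only [ContinuousLinearEquiv.coe_coe, hSF'] at this
    exact this.symm
  have e5 := form_expFun_adjoint_ARect h mu F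
  have e6 := congrArg (form1 (ω i) (M2 ω k i F)) (M2_expFun h hω mu)
  simp only [map_smul, smul_eq_mul] at e6
  rw [← M3_expFun1 h hω mu, form_comm (M3 ω i _), hM3] at e5
  rw [e3, e4, ← M3_expFun1 h hω lam, hM3] at e2
  rw [hM1, hM3] at e1
  simp only [map_add, map_smul, smul_eq_mul, add_apply, smul_apply]
  rw [form1_comm (M2 ω k i F) (expFun1 _ _)] at e6
  rw [form1_comm (M2 ω k i F) (opM4 _ _ _ _)] at e1
  rw [form1_comm (opM4 _ _ _ _) (M2 ω k i F')] at e1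
  rw [form1_comm (expFun1 (ω i) (lam i))] at e2
  rw [← hR] at e5
  linear_combination (-Complex.I * mu k) * e2 + (Complex.I * mu k * lam k) * e1 + lam k * e5 +
    lam k * e6 + mu k * (R - form1 (ω i) (M2 ω k i F') (expFun1 (ω i) (lam i)) -
      lam k * form ω (expFun ω mu) (adjoint (ARect ω k i) F)) * Complex.I_mul_I

end Identities

/-! ### The relation between the two operators `g` -/

section Relation

variable {ω : Fin 2 → ℝ} {s : (Fin 2 → ℝ) → ℂ} {i k : Fin 2} {l : ℝ}
  {S : L2Rect ω ≃L[ℂ] L2Rect ω}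

theorem isTranspose_M2_M3 (h : i ≠ k) (hω : ∀ i, 0 < ω i) :
    IsTranspose (form ω) (form1 (ω i)) (M2 ω k i) (M3 ω i) :=
  (isTranspose_M3_M2 h hω).symm form1_comm form_comm

theorem isTranspose_K3 (h : i ≠ k) (hω : ∀ i, 0 < ω i) :
    IsTranspose (form1 (ω k)) (form1 (ω i)) (K3 ω i k) (K3 ω k i) := by
  rw [K3_eq h hω, K3_eq h.symm hω]
  exact (isTranspose_M2_M3 h hω).comp (isTranspose_M3_M2 h.symm hω)

/-- The first block in the first row of `g_{ik}`. -/
def blockA (S : L2Rect ω ≃L[ℂ] L2Rect ω) (i k : Fin 2) : L2 (ω k) →L[ℂ] L2 (ω i) :=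
  K3 ω i k - M2 ω k i ∘L (S.symm : L2Rect ω →L[ℂ] L2Rect ω) ∘L
    opM1 (S : L2Rect ω →L[ℂ] L2Rect ω) i k

/-- The second block in the first row of `g_{ik}`. -/
def blockB (S : L2Rect ω ≃L[ℂ] L2Rect ω) (i k : Fin 2) : L2 (ω k) →L[ℂ] L2 (ω i) :=
  -(M2 ω k i ∘L (S.symm : L2Rect ω →L[ℂ] L2Rect ω) ∘L M3 ω k)

/-- The first block in the second row of `g_{ik}`. -/
def blockC (s : (Fin 2 → ℝ) → ℂ) (S : L2Rect ω ≃L[ℂ] L2Rect ω) (i k : Fin 2) :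
    L2 (ω k) →L[ℂ] L2 (ω i) :=
  K1 ω s i k - opM4 (S : L2Rect ω →L[ℂ] L2Rect ω) k i ∘L
    (S.symm : L2Rect ω →L[ℂ] L2Rect ω) ∘L opM1 (S : L2Rect ω →L[ℂ] L2Rect ω) i k

/-- The second block in the second row of `g_{ik}`. -/
def blockD (S : L2Rect ω ≃L[ℂ] L2Rect ω) (i k : Fin 2) : L2 (ω k) →L[ℂ] L2 (ω i) :=
  -(opM4 (S : L2Rect ω →L[ℂ] L2Rect ω) k i ∘L (S.symm : L2Rect ω →L[ℂ] L2Rect ω) ∘L M3 ω k)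

theorem g_fst (hω : ∀ i, 0 < ω i) (hs : IsSymbol ω s)
    (hS : IsConvolution ω s (S : L2Rect ω →L[ℂ] L2Rect ω)) (h : i ≠ k) (f : L2Two (ω k)) :
    (g ω s S i k f).fst = blockA S i k f.fst + blockB S i k f.snd := by
  change K3 ω i k f.fst - M2 ω k i (S.symm (M1 ω s i k f.fst + M3 ω k f.snd)) =
    (K3 ω i k f.fst - M2 ω k i (S.symm (opM1 (S : L2Rect ω →L[ℂ] L2Rect ω) i k f.fst))) +
      -(M2 ω k i (S.symm (M3 ω k f.snd)))
  rw [M1_eq hω hs hS h.symm, map_add, map_add]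
  abel

theorem g_snd (hω : ∀ i, 0 < ω i) (hs : IsSymbol ω s)
    (hS : IsConvolution ω s (S : L2Rect ω →L[ℂ] L2Rect ω)) (h : i ≠ k) (f : L2Two (ω k)) :
    (g ω s S i k f).snd = blockC s S i k f.fst + blockD S i k f.snd := by
  change K1 ω s i k f.fst - M4 ω s k i (S.symm (M1 ω s i k f.fst + M3 ω k f.snd)) =
    (K1 ω s i k f.fst - opM4 (S : L2Rect ω →L[ℂ] L2Rect ω) k i
      (S.symm (opM1 (S : L2Rect ω →L[ℂ] L2Rect ω) i k f.fst))) +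
      -(opM4 (S : L2Rect ω →L[ℂ] L2Rect ω) k i (S.symm (M3 ω k f.snd)))
  rw [M1_eq hω hs hS h.symm, M4_eq hω hs hS h, map_add, map_add]
  abel

theorem isTranspose_symm (hω : ∀ i, 0 < ω i) (hs : IsSymbol ω s)
    (hS : IsConvolution ω s (S : L2Rect ω →L[ℂ] L2Rect ω)) :
    IsTranspose (form ω) (form ω) (S.symm : L2Rect ω →L[ℂ] L2Rect ω) S.symm :=
  (isTranspose_convolution hω hs.integrable hS).equiv_symm

theorem isTranspose_blockB (hω : ∀ i, 0 < ω i) (hs : IsSymbol ω s)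
    (hS : IsConvolution ω s (S : L2Rect ω →L[ℂ] L2Rect ω)) (h : i ≠ k) :
    IsTranspose (form1 (ω k)) (form1 (ω i)) (blockB S i k) (blockB S k i) :=
  ((isTranspose_M2_M3 h hω).comp
    ((isTranspose_symm hω hs hS).comp (isTranspose_M3_M2 h.symm hω))).neg

theorem opM4_symm (S : L2Rect ω ≃L[ℂ] L2Rect ω) (F : L2Rect ω) :
    opM4 (S : L2Rect ω →L[ℂ] L2Rect ω) k i (S.symm F) =
      M2 ω k i F - (M2 ω k i ∘L (S : L2Rect ω →L[ℂ] L2Rect ω) -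
        opM4 (S : L2Rect ω →L[ℂ] L2Rect ω) k i) (S.symm F) := by
  simp only [sub_apply, ContinuousLinearMap.comp_apply, ContinuousLinearEquiv.coe_coe,
    ContinuousLinearEquiv.apply_symm_apply]
  abel

/-- The transpose of `M_{1k}` applied to `S⁻¹M_{3i}` is `M_{2k}M_{3i} - M_{4k}S⁻¹M_{3i}`, whose
first term is `K_{3i}`; so only the block with `M_{4k}` remains. -/
theorem isTranspose_blockA (hω : ∀ i, 0 < ω i) (hs : IsSymbol ω s)
    (hS : IsConvolution ω s (S : L2Rect ω →L[ℂ] L2Rect ω)) (h : i ≠ k) :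
    IsTranspose (form1 (ω i)) (form1 (ω k)) (blockA S k i) (-blockD S i k) := by
  have h1 := (isTranspose_K3 h.symm hω).sub ((isTranspose_M2_M3 h.symm hω).comp
    ((isTranspose_symm hω hs hS).comp (isTranspose_opM1 hω hs hS h)))
  have h2 : -blockD S i k = K3 ω i k - ((M2 ω k i ∘L (S : L2Rect ω →L[ℂ] L2Rect ω) -
      opM4 (S : L2Rect ω →L[ℂ] L2Rect ω) k i) ∘L (S.symm : L2Rect ω →L[ℂ] L2Rect ω)) ∘L M3 ω k := by
    ext1 f
    change - -opM4 (S : L2Rect ω →L[ℂ] L2Rect ω) k i (S.symm (M3 ω k f)) = _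
    rw [neg_neg, opM4_symm, K3_eq h hω]
    rfl
  rw [h2]
  exact h1

/-- Adding and subtracting `M_{2i}M_{1k}` splits the block of `g_{ki}` into two summands, each of
which transposes into its counterpart with the indices exchanged. -/
theorem isTranspose_blockC (hω : ∀ i, 0 < ω i) (hs : IsSymbol ω s)
    (hS : IsConvolution ω s (S : L2Rect ω →L[ℂ] L2Rect ω)) (h : i ≠ k) :
    IsTranspose (form1 (ω i)) (form1 (ω k)) (blockC s S k i) (blockC s S i k) := by
  have h1 := (isTranspose_K1_sub hω hs hS h.symm).add
    (((isTranspose_opM1 hω hs hS h.symm).symm form1_comm form_comm).comp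
      ((isTranspose_symm hω hs hS).comp (isTranspose_opM1 hω hs hS h)))
  have h2 : ∀ {i k : Fin 2}, blockC s S k i = (K1 ω s k i - M2 ω i k ∘L
      opM1 (S : L2Rect ω →L[ℂ] L2Rect ω) k i) + (M2 ω i k ∘L (S : L2Rect ω →L[ℂ] L2Rect ω) -
        opM4 (S : L2Rect ω →L[ℂ] L2Rect ω) i k) ∘L ((S.symm : L2Rect ω →L[ℂ] L2Rect ω) ∘L
          opM1 (S : L2Rect ω →L[ℂ] L2Rect ω) k i) := fun {i k} => by
    ext1 f
    simp only [blockC, ContinuousLinearMap.comp_apply, sub_apply, add_apply,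
      ContinuousLinearEquiv.coe_coe, ContinuousLinearEquiv.apply_symm_apply]
    abel
  rw [h2, h2]
  exact h1

theorem inner_U2 (f w : L2Two l) : ⟪U2 w, f⟫_ℂ = form1 l w.fst f.fst + form1 l w.snd f.snd := by
  rw [WithLp.prod_inner_apply]
  rfl

theorem U2_U2 (f : L2Two l) : U2 (U2 f) = f := by
  refine WithLp.ofLp_injective 2 (Prod.ext ?_ ?_)
  · exact U_U f.fst
  · exact U_U f.snd

theorem inner_U2_U2 (f w : L2Two l) : ⟪U2 w, U2 f⟫_ℂ = ⟪f, w⟫_ℂ := by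
  rw [inner_U2, form1_comm, form1_comm w.snd, ← inner_U2, U2_U2]

theorem inner_J_left (f w : L2Two l) : ⟪J f, w⟫_ℂ = ⟪f, J w⟫_ℂ := by
  rw [WithLp.prod_inner_apply, WithLp.prod_inner_apply]
  change ⟪-(Complex.I • f.snd), w.fst⟫_ℂ + ⟪Complex.I • f.fst, w.snd⟫_ℂ =
    ⟪f.fst, -(Complex.I • w.snd)⟫_ℂ + ⟪f.snd, Complex.I • w.fst⟫_ℂ
  simp only [inner_neg_left, inner_neg_right, inner_smul_left, inner_smul_right, Complex.conj_I]
  ring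

theorem inner_J_U2 (f w : L2Two l) : ⟪J (U2 f), w⟫_ℂ =
    Complex.I * form1 l f.snd w.fst - Complex.I * form1 l f.fst w.snd := by
  rw [WithLp.prod_inner_apply]
  change ⟪-(Complex.I • U f.snd), w.fst⟫_ℂ + ⟪Complex.I • U f.fst, w.snd⟫_ℂ = _
  rw [inner_neg_left, inner_smul_left, inner_smul_left, Complex.conj_I, form1_apply, form1_apply]
  ring

/-- `U` turns inner products into bilinear forms, and `J` exchanges the components with a sign. The
relation becomes: `B` and `C` transpose into their counterparts, and `A` into `-D`. -/
theorem g_relation (hω : ∀ i, 0 < ω i) (hs : IsSymbol ω s)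
    (hS : IsConvolution ω s (S : L2Rect ω →L[ℂ] L2Rect ω)) (h : i ≠ k) (f : L2Two (ω i)) :
    g ω s S k i f = -U2 (J (ContinuousLinearMap.adjoint (g ω s S i k) (J (U2 f)))) := by
  refine ext_inner_left ℂ fun w => ?_
  rw [← U2_U2 w]
  generalize U2 w = w
  rw [inner_neg_right, inner_U2_U2, inner_J_left, ContinuousLinearMap.adjoint_inner_left,
    inner_U2, inner_J_U2, g_fst hω hs hS h, g_snd hω hs hS h, g_fst hω hs hS h.symm,
    g_snd hω hs hS h.symm]
  have e1 : (J w).fst = -(Complex.I • w.snd) := rfl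
  have e2 : (J w).snd = Complex.I • w.fst := rfl
  simp only [e1, e2, map_add, map_neg, map_smul, smul_eq_mul]
  have hA := isTranspose_blockA hω hs hS h f.fst w.fst
  have hA' := isTranspose_blockA hω hs hS h.symm w.snd f.snd
  have hB := isTranspose_blockB hω hs hS h.symm f.snd w.fst
  have hC := isTranspose_blockC hω hs hS h f.fst w.snd
  simp only [neg_apply, map_neg] at hA hA'
  rw [form1_comm w.fst (blockA S k i _), form1_comm w.fst (blockB S k i _),
    form1_comm w.snd (blockC s S k i _), hA, hB, hC, form1_comm f.snd (blockA S i k _), hA']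
  linear_combination (-form1 (ω i) f.fst (blockD S i k w.fst) +
    form1 (ω i) f.snd (blockB S i k w.fst) +
    form1 (ω i) f.fst (blockC s S i k w.snd) + form1 (ω k) w.snd (blockD S k i f.snd)) *
      Complex.I_mul_I

end Relation

/-! ### The functions `ψ` and `ρ` -/

section Representation

variable {ω : Fin 2 → ℝ} {s : (Fin 2 → ℝ) → ℂ} {i k : Fin 2} {l : ℝ}
  {S : L2Rect ω ≃L[ℂ] L2Rect ω}

theorem form_expFun_eq_integral (F : L2Rect ω) (lam : Fin 2 → ℂ) : form ω (expFun ω lam) F =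
    ∫ x in box ω, Complex.exp (Complex.I * dot lam (ω - x)) * F x := by
  rw [form_eq_integral]
  refine integral_congr_ae ?_
  filter_upwards [(measurePreserving_sub_box ω).quasiMeasurePreserving.ae (expFun_ae ω lam)]
    with x hx
  rw [hx]

theorem theta_eq (h : L2Rect ω) (lam : Fin 2 → ℂ) :
    theta ω h lam = 1 + lam 0 * lam 1 * form ω (expFun ω lam) h := by
  rw [theta, form_expFun_eq_integral]

theorem rho_eq (S : L2Rect ω ≃L[ℂ] L2Rect ω) (lam mu : Fin 2 → ℂ) : rho ω S lam mu =
    Complex.exp (-Complex.I * dot mu ω) * form ω (expFun ω mu) (S.symm (expFun ω lam)) := by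
  rw [rho, form_expFun_eq_integral, ← integral_const_mul]
  refine integral_congr_ae (Filter.Eventually.of_forall fun x => ?_)
  simp only
  rw [← mul_assoc, ← Complex.exp_add]
  congr 2
  simp only [dot, Fin.sum_univ_two, Pi.sub_apply, Complex.ofReal_sub]
  ring

theorem pairing_eq (hl : 0 ≤ l) (c : ℂ) (v w : L2Two l) : pairing c v w = c * ⟪v, w⟫_ℂ := by
  have hi : ∀ f g : L2 l, Integrable (fun x => (starRingEnd ℂ) (f x) * g x)
      (volume.restrict (Ioo 0 l)) := fun f g => by
    refine (L2.integrable_inner (𝕜 := ℂ) f g).congr (Filter.Eventually.of_forall fun x => ?_)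
    simp only [RCLike.inner_apply, mul_comm]
  have he : ∀ f g : L2 l, ∫ x in Ioo 0 l, (starRingEnd ℂ) (f x) * g x = ⟪f, g⟫_ℂ := fun f g => by
    rw [L2.inner_def]
    refine integral_congr_ae (Filter.Eventually.of_forall fun x => ?_)
    simp only [RCLike.inner_apply, mul_comm]
  rw [pairing, ← setIntegral_Ioo_eq hl, integral_const_mul, integral_add (hi _ _) (hi _ _), he, he,
    WithLp.prod_inner_apply]
  rfl

theorem rho_eq_pairing (hω : ∀ i, 0 < ω i) (hs : IsSymbol ω s)
    (hS : IsConvolution ω s (S : L2Rect ω →L[ℂ] L2Rect ω)) (h : i ≠ k) {lam mu : Fin 2 → ℂ}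
    (hne : mu k ≠ lam k) : rho ω S lam mu = 1 / (mu k - lam k) *
      pairing (Complex.exp (-Complex.I * dot mu ω)) (J (U2 (psi ω s S mu i)))
        (psi ω s S lam i) := by
  have h0 : mu k - lam k ≠ 0 := sub_ne_zero.2 hne
  rw [rho_eq, pairing_eq (hω i).le, inner_J_U2, psi_fst h, psi_fst h, map_smul, map_smul,
    smul_apply]
  have := mul_form_expFun hω hs hS h lam mu
  rw [one_div, eq_inv_mul_iff_mul_eq₀ h0]
  simp only [smul_eq_mul]
  linear_combination Complex.exp (-Complex.I * dot mu ω) * this +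
    Complex.exp (-Complex.I * dot mu ω) *
    (mu k * form1 (ω i) (M2 ω k i (S.symm (expFun ω mu))) (psi ω s S lam i).snd -
        lam k * form1 (ω i) (psi ω s S mu i).snd (M2 ω k i (S.symm (expFun ω lam)))) *
      Complex.I_mul_I

theorem continuous_form_expFun (F : L2Rect ω) : Continuous fun mu => form ω (expFun ω mu) F := by
  have := (differentiable_expFun ω).continuous
  fun_prop

/-- The form is continuous in `μ`, so the hyperplane excluded by the division by `μ_k - λ_k` does no
harm. -/
theorem eq_zero_of_form_expFun_of_ne {F : L2Rect ω} (k : Fin 2) (c : ℂ)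
    (h : ∀ mu : Fin 2 → ℂ, mu k ≠ c → form ω (expFun ω mu) F = 0) : F = 0 := by
  have hd : Dense {mu : Fin 2 → ℂ | mu k ≠ c} :=
    (dense_compl_singleton c).preimage (isOpenMap_eval k)
  have := Continuous.ext_on hd (continuous_form_expFun F) (continuous_const (y := (0 : ℂ)))
    fun mu hmu => h mu hmu
  exact eq_zero_of_form_expFun fun mu => congrFun this mu

/-- If `ψ(λ)` vanished, so would the right side of `mul_form_expFun` for every `μ`. Totality of
exponentials would give `S⁻¹e_λ = 0`. -/
theorem psi_ne_zero (hω : ∀ i, 0 < ω i) (hs : IsSymbol ω s)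
    (hS : IsConvolution ω s (S : L2Rect ω →L[ℂ] L2Rect ω)) (lam : Fin 2 → ℂ) :
    psi ω s S lam ≠ 0 := by
  intro h0
  have h : (0 : Fin 2) ≠ 1 := by decide
  have h1 : (psi ω s S lam 0).snd = 0 := by rw [h0]; rfl
  have h2 : (Complex.I * lam 1) • M2 ω 1 0 (S.symm (expFun ω lam)) = 0 := by
    rw [← psi_fst (s := s) h, h0]; rfl
  have h3 : S.symm (expFun ω lam) = 0 := by
    refine eq_zero_of_form_expFun_of_ne 1 (lam 1) fun mu hmu => ?_
    have e1 := mul_form_expFun hω hs hS h lam mu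
    have e2 := congrArg (form1 (ω 0) (psi ω s S mu 0).snd) h2
    rw [map_smul, map_zero, smul_eq_mul, mul_assoc] at e2
    rw [h1, map_zero, (mul_eq_zero.1 e2).resolve_left Complex.I_ne_zero, mul_zero, sub_zero] at e1
    exact (mul_eq_zero.1 e1).resolve_left (sub_ne_zero.2 hmu)
  exact expFun_ne_zero hω lam (S.symm.map_eq_zero_iff.1 h3)

theorem differentiable_psi (hω : ∀ i, 0 < ω i) (s : (Fin 2 → ℝ) → ℂ) (S : L2Rect ω ≃L[ℂ] L2Rect ω) :
    Differentiable ℂ (psi ω s S) := by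
  have hE := differentiable_expFun ω
  refine differentiable_pi.2 fun i => ?_
  obtain ⟨k, h⟩ : ∃ k, i ≠ k := ⟨1 - i, by revert i; decide⟩
  -- An exponential in one variable is the mean over `x_k` of `e_λ` with `λ_k = 0`, so it inherits
  -- holomorphy.
  have h1 : (fun lam : Fin 2 → ℂ => expFun1 (ω i) (lam i)) = fun lam =>
      (ω k : ℂ)⁻¹ • M2 ω k i (expFun ω (Function.update lam k 0)) := by
    funext lam
    rw [← M3_expFun1 h hω, M2_M3 h hω, inv_smul_smul₀]
    exact_mod_cast (hω k).ne'
  have h2 : Differentiable ℂ fun lam : Fin 2 → ℂ => Function.update lam k (0 : ℂ) := by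
    refine differentiable_pi.2 fun j => ?_
    by_cases hj : j = k
    · subst hj; simp
    · simp only [Function.update_of_ne hj]; fun_prop
  have h3 : Differentiable ℂ fun lam : Fin 2 → ℂ => expFun1 (ω i) (lam i) := by
    rw [h1]
    exact ((M2 ω k i).differentiable.comp (hE.comp h2)).const_smul ((ω k : ℂ)⁻¹)
  have h4 : Differentiable ℂ fun lam => S.symm (expFun ω lam) := S.symm.differentiable.comp hE
  have h5 : ∀ T : L2Rect ω →L[ℂ] L2 (ω i), Differentiable ℂ fun lam : Fin 2 → ℂ =>
      (Complex.I * lam (1 - i)) • T (S.symm (expFun ω lam)) := fun T => by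
    have h6 : Differentiable ℂ fun lam : Fin 2 → ℂ => Complex.I * lam (1 - i) := by fun_prop
    exact h6.smul (T.differentiable.comp h4)
  exact (WithLp.prodContinuousLinearEquiv 2 ℂ (L2 (ω i)) (L2 (ω i))).symm.differentiable.comp
    ((h5 _).prodMk (h3.add (h5 _)))

theorem represents_psi (hω : ∀ i, 0 < ω i) (hs : IsSymbol ω s)
    (hS : IsConvolution ω s (S : L2Rect ω →L[ℂ] L2Rect ω)) :
    RepresentsWithoutPolesOrZeros ω s S (theta ω (S.symm hs.shift)) (psi ω s S) := by
  refine ⟨differentiable_psi hω s S, psi_ne_zero hω hs hS, fun lam hu => ?_⟩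
  have h1 := G_psi hω hs hS lam
  -- Symmetry moves `S⁻¹` from `e_λ` to `y`, which turns the scalar into `θ_h` with `h = S⁻¹y`.
  rw [← form_symm hω hs hS, form_comm, ← theta_eq] at h1
  rw [← map_smul, ← h1, ← mul_apply_eq_comp, Ring.inverse_mul_cancel _ hu]
  rfl

end Representation

/-! ### Uniqueness -/

section Uniqueness

variable {ω : Fin 2 → ℝ} {s : (Fin 2 → ℝ) → ℂ} {S : L2Rect ω ≃L[ℂ] L2Rect ω}

theorem G_smul (z : ℂ) (lam : Fin 2 → ℂ) :
    G ω s S (z • lam) = 1 + z • (G ω s S lam - 1) := by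
  refine ContinuousLinearMap.ext fun v => funext fun i => ?_
  change (v i - (z * lam i) • col (opA (ω i) ∘L pr1 (ω i)) (opA (ω i) ∘L pr2 (ω i)) (v i)) +
      (Complex.I * (z * lam (1 - i))) • g ω s S i (1 - i) (v (1 - i)) =
    v i + z • ((v i - lam i • col (opA (ω i) ∘L pr1 (ω i)) (opA (ω i) ∘L pr2 (ω i)) (v i)) +
      (Complex.I * lam (1 - i)) • g ω s S i (1 - i) (v (1 - i)) - v i)
  module

/-- `G` is affine in `λ` with `G(0) = I`, and invertibility is an open condition. Hence a
representation fixes `ψ` near 0 on each line through 0. -/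
theorem eventually_isUnit_G (lam : Fin 2 → ℂ) : ∀ᶠ z : ℂ in nhds 0, IsUnit (G ω s S (z • lam)) := by
  have hc : Continuous fun z : ℂ => 1 + z • (G ω s S lam - 1) := by fun_prop
  have h0 : IsUnit (1 + (0 : ℂ) • (G ω s S lam - 1)) := by
    have h1 : 1 + (0 : ℂ) • (G ω s S lam - 1) = 1 := ContinuousLinearMap.ext fun v => by
      change v + (0 : ℂ) • (G ω s S lam - 1) v = v
      rw [zero_smul, add_zero]
    rw [h1]
    exact isUnit_one
  filter_upwards [hc.continuousAt.eventually (Units.isOpen.mem_nhds h0)] with z hz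
  rw [G_smul]
  exact hz

theorem differentiable_theta (h : L2Rect ω) : Differentiable ℂ (theta ω h) := by
  have := differentiable_expFun ω
  simp only [funext (theta_eq h)]
  fun_prop

theorem theta_smul_zero (h : L2Rect ω) (lam : Fin 2 → ℂ) : theta ω h ((0 : ℂ) • lam) = 1 := by
  simp [theta_eq]

/-- The factor `λ₁λ₂` makes `θ - 1` of second order at 0; this excludes a factor `e^{cz}` in the
uniqueness argument. -/
theorem deriv_theta_smul (h : L2Rect ω) (lam : Fin 2 → ℂ) :
    deriv (fun z : ℂ => theta ω h (z • lam)) 0 = 0 := by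
  have hE := differentiable_expFun ω
  set φ : ℂ → ℂ := fun z => lam 0 * lam 1 * form ω (expFun ω (z • lam)) h
  have hφ : Differentiable ℂ φ := by fun_prop
  have h1 : (fun z : ℂ => theta ω h (z • lam)) = fun z => 1 + z ^ 2 * φ z := by
    funext z
    simp only [theta_eq, Pi.smul_apply, smul_eq_mul, φ]
    ring
  have h2 : HasDerivAt (fun z => 1 + z ^ 2 * φ z)
      ((2 : ℕ) * (0 : ℂ) ^ (2 - 1) * φ 0 + 0 ^ 2 * deriv φ 0) 0 :=
    ((hasDerivAt_pow 2 (0 : ℂ)).mul (hφ 0).hasDerivAt).const_add 1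
  rw [h1, h2.deriv]
  simp

theorem log_norm_theta_le (h : L2Rect ω) (lam : Fin 2 → ℂ) :
    ∃ B : ℝ, 0 ≤ B ∧ ∀ z : ℂ, Real.log ‖theta ω h (z • lam)‖ ≤ B * (1 + ‖z‖) := by
  obtain ⟨C, b, hC, hb, hE⟩ := norm_expFun_le ω
  set K : ℝ := ‖lam 0 * lam 1‖ * (‖form ω‖ * C * ‖h‖) with hK
  have hK0 : 0 ≤ K := by positivity
  -- The summands absorb, in turn, the factor 2 from `1 + X ≤ 2X ≤ eX`, the constant `K ≤ e^K`, the
  -- square `|z|² ≤ e^{2|z|}`, and the growth of the exponential.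
  refine ⟨1 + K + 2 + b * ‖lam‖, by positivity, fun z => ?_⟩
  have hle : ‖theta ω h (z • lam)‖ ≤ Real.exp ((1 + K + 2 + b * ‖lam‖) * (1 + ‖z‖)) := by
    have h1 : ‖theta ω h (z • lam)‖ ≤ 1 + ‖z‖ ^ 2 * K * Real.exp (b * ‖lam‖ * ‖z‖) := by
      have h2 : ‖form ω (expFun ω (z • lam)) h‖ ≤
          ‖form ω‖ * (C * Real.exp (b * (‖z‖ * ‖lam‖))) * ‖h‖ := by
        refine ((form ω).le_opNorm₂ _ _).trans ?_
        have := hE (z • lam)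
        rw [norm_smul] at this
        gcongr
      rw [theta_eq]
      refine (norm_add_le _ _).trans ?_
      rw [norm_one]
      gcongr
      simp only [Pi.smul_apply, smul_eq_mul]
      rw [norm_mul, show z * lam 0 * (z * lam 1) = z ^ 2 * (lam 0 * lam 1) by ring, norm_mul,
        norm_pow]
      refine (mul_le_mul_of_nonneg_left h2 (by positivity)).trans (le_of_eq ?_)
      rw [hK, show b * (‖z‖ * ‖lam‖) = b * ‖lam‖ * ‖z‖ by ring]
      ring
    refine h1.trans ?_
    have hz : ‖z‖ ≤ Real.exp ‖z‖ := (by linarith [Real.add_one_le_exp ‖z‖])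
    have hKe : K ≤ Real.exp K := (by linarith [Real.add_one_le_exp K])
    have h3 : ‖z‖ ^ 2 * K * Real.exp (b * ‖lam‖ * ‖z‖) ≤
        Real.exp (K + 2 * ‖z‖ + b * ‖lam‖ * ‖z‖) := by
      rw [Real.exp_add, Real.exp_add, show 2 * ‖z‖ = ‖z‖ + ‖z‖ by ring, Real.exp_add, sq,
        mul_comm (Real.exp K)]
      gcongr
    have h4 : 1 ≤ Real.exp (K + 2 * ‖z‖ + b * ‖lam‖ * ‖z‖) := Real.one_le_exp (by positivity)
    have h5 : (2 : ℝ) ≤ Real.exp 1 := (by linarith [Real.add_one_le_exp (1 : ℝ)])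
    calc 1 + ‖z‖ ^ 2 * K * Real.exp (b * ‖lam‖ * ‖z‖)
        ≤ 2 * Real.exp (K + 2 * ‖z‖ + b * ‖lam‖ * ‖z‖) := by linarith
      _ ≤ Real.exp 1 * Real.exp (K + 2 * ‖z‖ + b * ‖lam‖ * ‖z‖) := by gcongr
      _ ≤ Real.exp ((1 + K + 2 + b * ‖lam‖) * (1 + ‖z‖)) := by
        rw [← Real.exp_add]
        refine Real.exp_le_exp.2 ?_
        have : 0 ≤ (1 + K) * ‖z‖ := by positivity
        have : 0 ≤ b * ‖lam‖ := by positivity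
        nlinarith
  -- At a zero of `θ` the bound holds because `Real.log 0 = 0`.
  rcases eq_or_ne ‖theta ω h (z • lam)‖ 0 with h0 | h0
  · rw [h0, Real.log_zero]
    positivity
  · rw [← Real.log_exp ((1 + K + 2 + b * ‖lam‖) * (1 + ‖z‖))]
    exact Real.log_le_log (lt_of_le_of_ne (norm_nonneg _) h0.symm) hle

theorem eq_on_line {E : Type*} [NormedAddCommGroup E] [NormedSpace ℂ E] [CompleteSpace E]
    {f g : ℂ → E} (hf : Differentiable ℂ f) (hg : Differentiable ℂ g) (h : f =ᶠ[nhds 0] g) :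
    f = g :=
  AnalyticOnNhd.eq_of_eventuallyEq (fun z _ => hf.analyticAt z) (fun z _ => hg.analyticAt z) h

theorem representation_unique {h h' : L2Rect ω} {ψ ψ' : (Fin 2 → ℂ) → L2Sum ω}
    (hr : RepresentsWithoutPolesOrZeros ω s S (theta ω h) ψ)
    (hr' : RepresentsWithoutPolesOrZeros ω s S (theta ω h') ψ') : h' = h ∧ ψ' = ψ := by
  have hlin : ∀ lam : Fin 2 → ℂ, Differentiable ℂ fun z : ℂ => z • lam := fun lam => by fun_prop
  have hθ : theta ω h' = theta ω h := by
    funext lam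
    obtain ⟨B, hB, hb⟩ := log_norm_theta_le h lam
    obtain ⟨B', hB', hb'⟩ := log_norm_theta_le h' lam
    have hd := (differentiable_theta h).comp (hlin lam)
    have hd' := (differentiable_theta h').comp (hlin lam)
    have hψ := hr.1.comp (hlin lam)
    have hψ' := hr'.1.comp (hlin lam)
    -- Near 0 both sides are `θθ'G⁻¹col[0,1,0,1]`; the identity theorem extends this to the line. It
    -- says that `θ` and `θ'` have the same zeros there.
    have heq : (fun z : ℂ => theta ω h' (z • lam) • ψ (z • lam)) =
        fun z : ℂ => theta ω h (z • lam) • ψ' (z • lam) := by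
      refine eq_on_line (hd'.smul hψ) (hd.smul hψ') ?_
      filter_upwards [eventually_isUnit_G (s := s) (S := S) lam] with z hz
      rw [hr.2.2 _ hz, hr'.2.2 _ hz, smul_comm]
    have := eq_of_exponential_type_of_same_zeros hd' hd hψ hψ' (fun z => hr.2.1 _)
      (fun z => hr'.2.1 _) (theta_smul_zero h' lam) (theta_smul_zero h lam)
      ((deriv_theta_smul h' lam).trans (deriv_theta_smul h lam).symm)
      (B := max B B') (le_max_of_le_left hB)
      (fun z => (hb' z).trans (by gcongr; exact le_max_right _ _))
      (fun z => (hb z).trans (by gcongr; exact le_max_left _ _)) (congrFun heq)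
    simpa using congrFun this 1
  refine ⟨?_, funext fun lam => ?_⟩
  · rw [← sub_eq_zero]
    -- The factor `λ₁λ₂` in `θ` can be cancelled only off the coordinate hyperplanes.
    have hd : Dense {mu : Fin 2 → ℂ | mu 0 ≠ 0 ∧ mu 1 ≠ 0} := by
      have h0 : Dense {mu : Fin 2 → ℂ | mu 0 ≠ 0} :=
        (dense_compl_singleton 0).preimage (isOpenMap_eval 0)
      have h1 : Dense {mu : Fin 2 → ℂ | mu 1 ≠ 0} :=
        (dense_compl_singleton 0).preimage (isOpenMap_eval 1)
      exact h0.inter_of_isOpen_left h1 (isOpen_ne_fun (continuous_apply 0) continuous_const)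
    have := Continuous.ext_on hd (continuous_form_expFun (h' - h)) (continuous_const (y := (0 : ℂ)))
      fun mu hmu => by
        have := congrFun hθ mu
        rw [theta_eq, theta_eq, add_right_inj] at this
        rw [map_sub, sub_eq_zero]
        exact mul_left_cancel₀ (mul_ne_zero hmu.1 hmu.2) this
    exact eq_zero_of_form_expFun fun mu => congrFun this mu
  · have heq : (fun z : ℂ => ψ' (z • lam)) = fun z : ℂ => ψ (z • lam) := by
      refine eq_on_line (hr'.1.comp (hlin lam)) (hr.1.comp (hlin lam)) ?_
      filter_upwards [eventually_isUnit_G (s := s) (S := S) lam] with z hz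
      rw [hr.2.2 _ hz, hr'.2.2 _ hz, hθ]
    simpa using congrFun heq 1

end Uniqueness

/-! ### Independence of the representative of `s` -/

section Congruence

variable {ω : Fin 2 → ℝ} {s s' : (Fin 2 → ℝ) → ℂ} {i k : Fin 2}

theorem measurableSet_symBox (ω : Fin 2 → ℝ) : MeasurableSet (symBox ω) :=
  MeasurableSet.univ_pi fun _ => measurableSet_Ioo

theorem ae_sub_of_ae_symBox (hss : s =ᵐ[volume.restrict (symBox ω)] s') {x : Fin 2 → ℝ}
    (hx : ∀ j, x j ∈ Ico 0 (ω j)) : ∀ᵐ t, t ∈ box ω → s (x - t) = s' (x - t) := by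
  rw [Filter.EventuallyEq, ae_restrict_iff' (measurableSet_symBox ω)] at hss
  filter_upwards [(Measure.measurePreserving_sub_left volume x).quasiMeasurePreserving.ae hss]
    with t ht htb
  refine ht fun j _ => ?_
  have h1 := hx j
  have h2 := htb j trivial
  simp only [Pi.sub_apply]
  constructor <;> linarith [h1.1, h1.2, h2.1, h2.2]

theorem ae_section_symBox (h : i ≠ k) (hss : s =ᵐ[volume.restrict (symBox ω)] s') :
    ∀ᵐ y, y ∈ Ioo (-ω i) (ω i) → ∀ᵐ v, v ∈ Ioo (-ω k) (ω k) → s (pt i y v) = s' (pt i y v) := by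
  rw [Filter.EventuallyEq, ae_restrict_iff' (measurableSet_symBox ω)] at hss
  filter_upwards [Measure.ae_ae_of_ae_prod
    ((measurePreserving_pt h).quasiMeasurePreserving.ae hss)] with y hy hyi
  filter_upwards [hy] with v hv hvk
  refine hv ?_
  rw [symBox, mem_univ_pi, forall_fin_two_of_ne h, pt_self, pt_other h]
  exact ⟨hyi, hvk⟩

/-- The quantifiers over `c` and `f` stand inside the almost everywhere statement: the exceptional
set of `y` depends on neither, so `c` may later be the other coordinate of the same point. -/
theorem ae_integral_section (hω : ∀ i, 0 < ω i) (h : i ≠ k)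
    (hss : s =ᵐ[volume.restrict (symBox ω)] s') :
    ∀ᵐ y, y ∈ Ioo (-ω i) (ω i) → ∀ c ∈ Ico 0 (ω k), ∀ f : ℝ → ℂ,
      ∫ t in (0 : ℝ)..ω k, s (pt i y (c - t)) * f t =
        ∫ t in (0 : ℝ)..ω k, s' (pt i y (c - t)) * f t := by
  filter_upwards [ae_section_symBox h hss] with y hy hyi c hc f
  rw [← setIntegral_Ioo_eq (hω k).le, ← setIntegral_Ioo_eq (hω k).le]
  refine setIntegral_congr_ae measurableSet_Ioo ?_
  filter_upwards [(Measure.measurePreserving_sub_left volume c).quasiMeasurePreserving.ae (hy hyi)]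
    with t ht hti
  rw [ht]
  constructor <;> linarith [hc.1, hc.2, hti.1, hti.2]

theorem ae_integral_section_Ioo (hω : ∀ i, 0 < ω i) (h : i ≠ k)
    (hss : s =ᵐ[volume.restrict (symBox ω)] s') :
    ∀ᵐ y ∂volume.restrict (Ioo 0 (ω i)), ∀ c ∈ Ico 0 (ω k), ∀ f : ℝ → ℂ,
      ∫ t in (0 : ℝ)..ω k, s (pt i y (c - t)) * f t =
        ∫ t in (0 : ℝ)..ω k, s' (pt i y (c - t)) * f t := by
  rw [ae_restrict_iff' measurableSet_Ioo]
  filter_upwards [ae_integral_section hω h hss] with y hy hyi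
  exact hy ⟨by linarith [hyi.1, hω i], hyi.2⟩

theorem IsNormalized.congr (hω : ∀ i, 0 < ω i) (hss : s =ᵐ[volume.restrict (symBox ω)] s')
    (hs : IsNormalized ω s) : IsNormalized ω s' := by
  intro i k h
  have h1 := hs i k h
  rw [ae_restrict_iff' measurableSet_Ioo] at h1 ⊢
  filter_upwards [h1, ae_integral_section hω h hss] with y h2 h3 hy
  have := h3 hy 0 ⟨le_rfl, hω k⟩ fun _ => 1
  simp only [zero_sub, mul_one] at this
  rw [← this, h2 hy]

theorem IsConvolution.congr (hω : ∀ i, 0 < ω i) (hss : s =ᵐ[volume.restrict (symBox ω)] s')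
    {S : L2Rect ω →L[ℂ] L2Rect ω} (hS : IsConvolution ω s S) : IsConvolution ω s' S := by
  have h01 : (0 : Fin 2) ≠ 1 := by decide
  intro f
  filter_upwards [hS f, ae_restrict_mem (measurableSet_box ω)] with x hx hxb
  rw [hx]
  refine setIntegral_congr_ae (measurableSet_box ω) ?_
  have hx0 : ∀ j, x j ∈ Ico 0 (ω j) := fun j => ⟨(hxb j trivial).1.le, (hxb j trivial).2⟩
  have h0 : ∀ j, (0 : ℝ) ∈ Ico 0 (ω j) := fun j => ⟨le_rfl, hω j⟩
  have hp : ∀ u ∈ Ico 0 (ω 0), ∀ v ∈ Ico 0 (ω 1), ∀ j, pt 0 u v j ∈ Ico 0 (ω j) :=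
    fun u hu v hv => (forall_fin_two_of_ne h01).2 ⟨by rwa [pt_self], by rwa [pt_other h01]⟩
  filter_upwards [ae_sub_of_ae_symBox hss hx0,
    ae_sub_of_ae_symBox hss (hp _ (hx0 0) _ (h0 1)),
    ae_sub_of_ae_symBox hss (hp _ (h0 0) _ (hx0 1)),
    ae_sub_of_ae_symBox hss (x := 0) h0] with t h1 h2 h3 h4 ht
  have e : ∀ s : (Fin 2 → ℝ) → ℂ, kernel s x t = s (x - t) - s (pt 0 (x 0) 0 - t) -
      s (pt 0 0 (x 1) - t) + s (0 - t) := fun s => by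
    simp only [kernel, pt_sub _ _ _ t h01, zero_sub]
  rw [e, e, h1 ht, h2 ht, h3 ht, h4 ht]

theorem isM1_congr (hω : ∀ i, 0 < ω i) (hss : s =ᵐ[volume.restrict (symBox ω)] s') (h : i ≠ k) :
    IsM1 ω s k i = IsM1 ω s' k i := by
  funext T
  refine propext (forall_congr' fun f => Filter.eventually_congr ?_)
  filter_upwards [(quasiMeasurePreserving_coord h.symm).ae (ae_integral_section_Ioo hω h.symm hss),
    ae_restrict_mem (measurableSet_box ω)] with x hx hxb
  have hxi := ((mem_box h).1 hxb).1
  simp only [pt_comm h]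
  rw [hx (x i) ⟨hxi.1.le, hxi.2⟩, hx 0 ⟨le_rfl, hω i⟩]

theorem isM4_congr (hω : ∀ i, 0 < ω i) (hss : s =ᵐ[volume.restrict (symBox ω)] s') (h : i ≠ k) :
    IsM4 ω s k i = IsM4 ω s' k i := by
  funext T
  refine propext (forall_congr' fun f => Filter.eventually_congr ?_)
  have key : ∀ y ∈ Ico 0 (ω i), ∫ t in box ω, s (pt i (y - t i) (-t k)) * f t =
      ∫ t in box ω, s' (pt i (y - t i) (-t k)) * f t := by
    intro y hy
    refine setIntegral_congr_ae (measurableSet_box ω) ?_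
    have hp : ∀ j, pt i y 0 j ∈ Ico 0 (ω j) :=
      (forall_fin_two_of_ne h).2 ⟨by rwa [pt_self], by rw [pt_other h]; exact ⟨le_rfl, hω k⟩⟩
    filter_upwards [ae_sub_of_ae_symBox hss hp] with t ht htb
    have e : pt i (y - t i) (-t k) = pt i y 0 - t :=
      ext_of_ne h (by simp [pt_self]) (by simp [pt_other h])
    rw [e, ht htb]
  filter_upwards [ae_restrict_mem measurableSet_Ioo] with y hy
  rw [key y ⟨hy.1.le, hy.2⟩, key 0 ⟨le_rfl, hω i⟩]

theorem isK1_congr (hω : ∀ i, 0 < ω i) (hss : s =ᵐ[volume.restrict (symBox ω)] s') (h : i ≠ k) :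
    IsK1 ω s i k = IsK1 ω s' i k := by
  funext T
  refine propext (forall_congr' fun f => Filter.eventually_congr ?_)
  filter_upwards [ae_integral_section_Ioo hω h hss] with y hy
  have := hy 0 ⟨le_rfl, hω k⟩ f
  simp only [zero_sub] at this
  rw [this]

/-- `s` enters only through the predicates that characterize `M_{1k}`, `M_{4k}` and `K_{1i}`. These
do not see a null set of the symmetric rectangle, and equal predicates give the same chosen
operator. -/
theorem g_congr (hω : ∀ i, 0 < ω i) (hss : s =ᵐ[volume.restrict (symBox ω)] s')
    (S : L2Rect ω ≃L[ℂ] L2Rect ω) (h : i ≠ k) : g ω s S i k = g ω s' S i k := by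
  simp only [g, PiHat, PiOp, M1, M4, K1, isM1_congr hω hss h.symm, isM4_congr hω hss h,
    isK1_congr hω hss h]

theorem operatorsWellDefined_congr (hω : ∀ i, 0 < ω i)
    (hss : s =ᵐ[volume.restrict (symBox ω)] s') (h : OperatorsWellDefined ω s') :
    OperatorsWellDefined ω s := by
  refine ⟨h.1, fun i k hik => ?_⟩
  rw [isM1_congr hω hss hik, isM4_congr hω hss hik, isK1_congr hω hss hik]
  exact h.2 i k hik

theorem G_eq_of_g_eq {S S' : L2Rect ω ≃L[ℂ] L2Rect ω}
    (h : ∀ i k : Fin 2, i ≠ k → g ω s S i k = g ω s' S' i k) : G ω s S = G ω s' S' := by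
  funext lam
  have h1 : ∀ i : Fin 2, g ω s S i (1 - i) = g ω s' S' i (1 - i) := fun i =>
    h i (1 - i) (by revert i; decide)
  simp only [G, h1]

theorem represents_of_G_eq {S S' : L2Rect ω ≃L[ℂ] L2Rect ω} (h : G ω s S = G ω s' S')
    {θ : (Fin 2 → ℂ) → ℂ} {ψ : (Fin 2 → ℂ) → L2Sum ω}
    (hr : RepresentsWithoutPolesOrZeros ω s S θ ψ) :
    RepresentsWithoutPolesOrZeros ω s' S' θ ψ := by
  unfold RepresentsWithoutPolesOrZeros at hr ⊢
  rwa [← h]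

/-- A square integrable function on the rectangle `|x i| < ω i` agrees with a symbol on it. -/
theorem exists_isSymbol (hω : ∀ i, 0 < ω i) (hs : MemLp s 2 (volume.restrict (symBox ω)))
    (hs0 : IsNormalized ω s) :
    ∃ s', IsSymbol ω s' ∧ s =ᵐ[volume.restrict (symBox ω)] s' := by
  have hss : s =ᵐ[volume.restrict (symBox ω)] (symBox ω).indicator (hs.1.mk s) := by
    filter_upwards [hs.1.ae_eq_mk, ae_restrict_mem (measurableSet_symBox ω)] with x h1 h2
    rw [indicator_of_mem h2, h1]
  have hmk := (memLp_congr_ae hs.1.ae_eq_mk).1 hs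
  have : IsFiniteMeasure (volume.restrict (symBox ω)) := by
    refine ⟨?_⟩
    rw [Measure.restrict_apply_univ, symBox, Real.volume_pi_Ioo]
    exact ENNReal.prod_lt_top fun i _ => ENNReal.ofReal_lt_top
  exact ⟨_, ⟨hs.1.stronglyMeasurable_mk.measurable.indicator (measurableSet_symBox ω),
    (memLp_indicator_iff_restrict (measurableSet_symBox ω)).2 hmk,
    (integrable_indicator_iff (measurableSet_symBox ω)).2 (hmk.integrable one_le_two),
    hs0.congr hω hss⟩, hss⟩

/-- `ψ` determines `ρ` off a hyperplane, hence the forms of `S⁻¹e_λ` against all exponentials.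
Totality is used twice: in `μ` to get `S⁻¹e_λ`, in `λ` to get `S⁻¹`. -/
theorem symm_eq_of_psi_eq (hω : ∀ i, 0 < ω i) (hs : IsSymbol ω s) (hs' : IsSymbol ω s')
    {S S' : L2Rect ω ≃L[ℂ] L2Rect ω} (hS : IsConvolution ω s (S : L2Rect ω →L[ℂ] L2Rect ω))
    (hS' : IsConvolution ω s' (S' : L2Rect ω →L[ℂ] L2Rect ω))
    (h : psi ω s S = psi ω s' S') : S.symm = S'.symm := by
  have h01 : (0 : Fin 2) ≠ 1 := by decide
  have h1 : ∀ lam, S.symm (expFun ω lam) = S'.symm (expFun ω lam) := fun lam => by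
    rw [← sub_eq_zero]
    refine eq_zero_of_form_expFun_of_ne 1 (lam 1) fun mu hmu => ?_
    have e1 := rho_eq_pairing hω hs hS h01 hmu
    rw [h, ← rho_eq_pairing hω hs' hS' h01 hmu, rho_eq, rho_eq] at e1
    rw [map_sub, mul_left_cancel₀ (Complex.exp_ne_zero _) e1, sub_self]
  have h2 : (S.symm : L2Rect ω →L[ℂ] L2Rect ω) = S'.symm := (isTotal_expFun ω).clm_ext h1
  exact ContinuousLinearEquiv.ext (funext fun F =>
    congrArg (fun T : L2Rect ω →L[ℂ] L2Rect ω => T F) h2)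

theorem shift_ae_of_ae {s' : (Fin 2 → ℝ) → ℂ} (hss : s =ᵐ[volume.restrict (symBox ω)] s') :
    (fun x => s' (x - ω)) =ᵐ[volume.restrict (box ω)] fun x => s (x - ω) := by
  rw [Filter.EventuallyEq, ae_restrict_iff' (measurableSet_symBox ω)] at hss
  rw [Filter.EventuallyEq, ae_restrict_iff' (measurableSet_box ω)]
  filter_upwards [(measurePreserving_sub_right volume ω).quasiMeasurePreserving.ae hss]
    with x hx hxb
  refine (hx fun j _ => ?_).symm
  have h2 := hxb j trivial
  simp only [Pi.sub_apply]
  constructor <;> linarith [h2.1, h2.2]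

end Congruence

end RectConv

end

/-! ### Assembly of the four statements -/

theorem theorem2p3 (ω : Fin 2 → ℝ) (hω : ∀ i, 0 < ω i) (s : (Fin 2 → ℝ) → ℂ)
    (hs : MemLp s 2 (volume.restrict (symBox ω))) (hs0 : IsNormalized ω s)
    (S : L2Rect ω ≃L[ℂ] L2Rect ω) (hS : IsConvolution ω s (S : L2Rect ω →L[ℂ] L2Rect ω)) :
    -- the operators that enter the definitions of `g` and `G` exist
    OperatorsWellDefined ω s ∧
    -- the relation between the two operators `g`
    (∀ i k : Fin 2, i ≠ k → ∀ f : L2Two (ω i),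
      g ω s S k i f = -U2 (J (ContinuousLinearMap.adjoint (g ω s S i k) (J (U2 f))))) ∧
    -- the functions `θ` and `ψ`, the uniqueness, and the representations of `ρ`
    (∃ (h : L2Rect ω) (ψ : (Fin 2 → ℂ) → L2Sum ω),
      (S h =ᵐ[volume.restrict (box ω)] fun x => s (x - ω)) ∧
      RepresentsWithoutPolesOrZeros ω s S (theta ω h) ψ ∧
      (∀ (h' : L2Rect ω) (ψ' : (Fin 2 → ℂ) → L2Sum ω),
        RepresentsWithoutPolesOrZeros ω s S (theta ω h') ψ' → h' = h ∧ ψ' = ψ) ∧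
      ∀ i k : Fin 2, i ≠ k → ∀ lam mu : Fin 2 → ℂ, mu k ≠ lam k →
        rho ω S lam mu = 1 / (mu k - lam k) *
          pairing (Complex.exp (-Complex.I * dot mu ω)) (J (U2 (ψ mu i))) (ψ lam i)) ∧
    -- one operator `g` determines the other one, `ρ` and the inverse operator
    (∀ (s' : (Fin 2 → ℝ) → ℂ) (S' : L2Rect ω ≃L[ℂ] L2Rect ω),
      MemLp s' 2 (volume.restrict (symBox ω)) → IsNormalized ω s' →
      IsConvolution ω s' (S' : L2Rect ω →L[ℂ] L2Rect ω) →
      ∀ i k : Fin 2, i ≠ k → g ω s S i k = g ω s' S' i k →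
        g ω s S k i = g ω s' S' k i ∧ rho ω S = rho ω S' ∧ S.symm = S'.symm) := by
  have hg_rel : ∀ (s : (Fin 2 → ℝ) → ℂ) (S : L2Rect ω ≃L[ℂ] L2Rect ω),
      MemLp s 2 (volume.restrict (symBox ω)) → IsNormalized ω s →
      IsConvolution ω s (S : L2Rect ω →L[ℂ] L2Rect ω) → ∀ i k : Fin 2, i ≠ k →
      ∀ f : L2Two (ω i),
      g ω s S k i f = -U2 (J (ContinuousLinearMap.adjoint (g ω s S i k) (J (U2 f)))) := by
    intro s S hs hs0 hS i k h f
    obtain ⟨r, hr, hsr⟩ := exists_isSymbol hω hs hs0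
    rw [g_congr hω hsr S h, g_congr hω hsr S h.symm]
    -- The argument is carried out for a measurable representative `r`, extended by zero to the
    -- plane, and then transferred back to `s`.
    exact g_relation hω hr (hS.congr hω hsr) h f
  obtain ⟨r, hr, hsr⟩ := exists_isSymbol hω hs hs0
  have hSr := hS.congr hω hsr
  have hG : G ω r S = G ω s S := G_eq_of_g_eq fun i k h => (g_congr hω hsr S h).symm
  have hψ := represents_psi hω hr hSr
  refine ⟨operatorsWellDefined_congr hω hsr (operatorsWellDefined hω hr hSr),
    hg_rel s S hs hs0 hS, ⟨S.symm hr.shift, psi ω r S, ?_, represents_of_G_eq hG hψ, ?_, ?_⟩, ?_⟩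
  · rw [ContinuousLinearEquiv.apply_symm_apply]
    exact hr.shift_ae.trans (shift_ae_of_ae hsr)
  · exact fun h' ψ' hψ' => representation_unique hψ (represents_of_G_eq hG.symm hψ')
  · exact fun i k h lam mu hne => rho_eq_pairing hω hr hSr h hne
  · intro s' S' hs' hs0' hS' i k h hg
    obtain ⟨r', hr', hsr'⟩ := exists_isSymbol hω hs' hs0'
    have hSr' := hS'.congr hω hsr'
    have hg' : g ω s S k i = g ω s' S' k i := by
      refine ContinuousLinearMap.ext fun f => ?_
      rw [hg_rel s S hs hs0 hS i k h, hg_rel s' S' hs' hs0' hS' i k h, hg]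
    have hGG : G ω r' S' = G ω r S := by
      refine (G_eq_of_g_eq fun j m hjm => ?_).symm
      rw [← g_congr hω hsr S hjm, ← g_congr hω hsr' S' hjm]
      by_cases hj : j = i
      · have hm : m = k := by rw [← one_sub_eq hjm, ← one_sub_eq h, hj]
        rw [hj, hm, hg]
      · have hm : m = i := by rw [← one_sub_eq hjm, one_sub_eq hj]
        have hj' : j = k := by rw [← one_sub_eq (Ne.symm hj), ← one_sub_eq h]
        rw [hj', hm, hg']
    -- With equal `G`, the functions `ψ` of `S` and `S'` represent the same expression up to the
    -- choice of `h`, so they coincide by uniqueness.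
    have hsymm : S.symm = S'.symm := symm_eq_of_psi_eq hω hr hr' hSr hSr'
      (representation_unique hψ (represents_of_G_eq hGG (represents_psi hω hr' hSr'))).2.symm
    refine ⟨hg', ?_, hsymm⟩
    funext lam mu
    rw [rho_eq, rho_eq, hsymm]
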